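/- \textbf{Conventions.} Superalgebras are commutative superalgebras over $\mathbb{C}$, and $\mathcal{A}^{p|q}=\mathcal{A}\otimes\mathbb{C}^{p|q}$. For a super vector space $V=\mathbb{C}^{p|q}$, the super Grassmannian of $r|0$-planes in $V$ is given by its functor of points $\mathcal{A}\mapsto\{$graded direct summands $L$ of $\mathcal{A}\otimes V$ that are projective of rank $r|0\}$, with base change as functoriality; $\mathbb{P}(V)$ is the case $r=1$. Let $\mathrm{Gr}$ be the super Grassmannian of $2|0$-planes in $\mathbb{C}^{4|1}$ (standard basis $e_1,\dots,e_4$ even, $\epsilon_5$ odd), and let $E=\wedge^2\mathbb{C}^{4|1}\cong\mathbb{C}^{7|4}$, with $u\wedge v=-(-1)^{|u||v|}v\wedge u$. Let $q_{ij}$ ($1\le i<j\le 4$, even), $\lambda_i$ ($1\le i\le 4$, odd), $a_{55}$ (even) be the coordinates on $E$ for the basis $e_i\wedge e_j$, $e_i\wedge\epsilon_5$, $-\epsilon_5\wedge\epsilon_5$; thus for even vectors $a,b$ with coordinates $a_i,\alpha_5$ and $b_i,\beta_5$, the vector $a\wedge b$ has $q_{ij}=a_ib_j-a_jb_i$, $\lambda_i=a_i\beta_5-b_i\alpha_5$,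 $a_{55}=\alpha_5\beta_5$. Let $$\mathcal{O}(\mathrm{Gr})=\mathbb{C}[q_{ij},\lambda_k,a_{55}]/I_P ,$$ where $I_P$ is the ideal generated by the super Plücker relations $$q_{12}q_{34}-q_{13}q_{24}+q_{14}q_{23},\qquad q_{ij}\lambda_k-q_{ik}\lambda_j+q_{jk}\lambda_i\ (i<j<k),$$ $$\lambda_i\lambda_j-a_{55}q_{ij}\ (i<j),\qquad \lambda_i a_{55},\qquad a_{55}^2 .$$ \textbf{Corollary.} \begin{enumerate} \item $\mathrm{Gr}$ is a projective supervariety, embedded in $\mathbb{P}(E)$, the projective superspace with $7|4$ homogeneous coordinates, by the super Plücker map $L\mapsto\wedge^2L$, and this embedding is encoded by $\mathcal{O}(\mathrm{Gr})$. Explicitly: \begin{itemize} \item the Grassmannian functors $\mathrm{Gr}$ and $\mathbb{P}(E)$ are compatible with base change, $L\mapsto\wedge^2L$ is a natural transformation $\mathrm{Gr}\to\mathbb{P}(E)$, and for every $\mathcal{A}$ it is a bijection of $\mathrm{Gr}(\mathcal{A})$ onto the set of those $M\in\mathbb{P}(E)(\mathcal{A})$ such that every $f\in I_P$ vanishes on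 all even elements of $M$; \item $I_P$ contains all the relations: a polynomial $f\in\mathbb{C}[q_{ij},\lambda_k,a_{55}]$ lies in $I_P$ if and only if $f$ vanishes on all even elements of $\wedge^2L$, for every $\mathcal{A}$ and every $L\in\mathrm{Gr}(\mathcal{A})$; \item for every even coordinate $x\in\{q_{ij},a_{55}\}$, the projective localization $\mathcal{O}(\mathrm{Gr})[x^{-1}]_0$ is an affine superalgebra (finitely generated, and without nilpotents modulo the ideal generated by its odd elements), and the superalgebra morphisms $\psi:\mathcal{O}(\mathrm{Gr})[x^{-1}]_0\to\mathcal{A}$ correspond bijectively to the points of $\mathrm{Gr}(\mathcal{A})$ on whose image $\wedge^2 L$ the coordinate $x$ takes the value $1$, the submodule $\wedge^2L$ corresponding to $\psi$ being spanned by the vector with coordinates $\psi(y/x)$, $y$ running over the $7|4$ coordinates; these affine charts cover $\mathrm{Gr}$, i.e. for every $\mathcal A$ and every $L\in\mathrm{Gr}(\mathcal{A})$ the values of the even coordinates on $\wedge^2L$ generate the unit ideal of $\mathcal{A}$. \end{itemize} \item In the polynomial superalgebra $\mathbb{C}[a_{ib}]$, $1\le i\le 5$, $b=1,2$ ($a_{ib}$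 even for $i\le 4$ and odd for $i=5$), put $d_{ij}=a_{i1}a_{j2}-a_{i2}a_{j1}$ for $1\le i<j\le 5$ and $d_{55}=a_{51}a_{52}$. There is an isomorphism of superalgebras from $\mathcal{O}(\mathrm{Gr})$ onto the $\mathbb{C}$-subalgebra of $\mathbb{C}[a_{ib}]$ generated by the $d_{ij}$ and $d_{55}$, with $q_{ij}\mapsto d_{ij}$, $\lambda_i\mapsto d_{i5}$, $a_{55}\mapsto d_{55}$. \end{enumerate} -/

import Mathlib

open scoped TensorProduct

namespace SuperGr

/-! ### Commutative superalgebras over `ℂ` -/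

/-- A commutative superalgebra over `ℂ`: a `ℂ`-algebra `A = part 0 ⊕ part 1` whose multiplication
adds parities and satisfies `a b = (-1)^{|a||b|} b a` for homogeneous `a`, `b`. -/
class SuperAlgebra (A : Type*) [Ring A] [Algebra ℂ A] where
  /-- the homogeneous elements of a given parity -/
  part : ZMod 2 → Submodule ℂ A
  isCompl : IsCompl (part 0) (part 1)
  one_mem : (1 : A) ∈ part 0
  mul_mem : ∀ {i j : ZMod 2} {a b : A}, a ∈ part i → b ∈ part j → a * b ∈ part (i + j)
  even_mul : ∀ {j : ZMod 2} {a b : A}, a ∈ part 0 → b ∈ part j → a * b = b * a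
  odd_mul_odd : ∀ {a b : A}, a ∈ part 1 → b ∈ part 1 → a * b = -(b * a)

/-- A morphism of superalgebras: a parity-preserving algebra homomorphism. -/
structure SuperHom (A B : Type*) [Ring A] [Algebra ℂ A] [SuperAlgebra A]
    [Ring B] [Algebra ℂ B] [SuperAlgebra B] extends A →ₐ[ℂ] B where
  map_part : ∀ (i : ZMod 2) (a : A), a ∈ SuperAlgebra.part i → toFun a ∈ SuperAlgebra.part (A := B) i

section Basic

variable {A : Type*} [Ring A] [Algebra ℂ A] [SuperAlgebra A]

open SuperAlgebra

theorem exists_add (a : A) :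
    ∃ a₀ ∈ part (A := A) 0, ∃ a₁ ∈ part (A := A) 1, a₀ + a₁ = a :=
  Submodule.mem_sup.1 ((isCompl (A := A)).sup_eq_top ▸ Submodule.mem_top)

theorem commute_of_even {a : A} (ha : a ∈ part (A := A) 0) (b : A) : a * b = b * a := by
  obtain ⟨b₀, h₀, b₁, h₁, rfl⟩ := exists_add b
  rw [mul_add, add_mul, even_mul ha h₀, even_mul ha h₁]

theorem odd_mul_self {a : A} (ha : a ∈ part (A := A) 1) : a * a = 0 := by
  have h := odd_mul_odd ha ha
  have h2 : (2 : ℂ) • (a * a) = 0 := by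
    rw [two_smul]
    nth_rewrite 1 [h]
    simp
  exact (smul_eq_zero_iff_right (by norm_num)).1 h2

/-- The parity involution `a₀ + a₁ ↦ a₀ - a₁`. -/
noncomputable def sigma (A : Type*) [Ring A] [Algebra ℂ A] [SuperAlgebra A] : A →ₗ[ℂ] A :=
  Submodule.projection _ _ (isCompl (A := A)) - Submodule.projection _ _ (isCompl (A := A)).symm

theorem sigma_even {a : A} (ha : a ∈ part (A := A) 0) : sigma A a = a := by
  rw [sigma, LinearMap.sub_apply,
    (Submodule.projection_eq_self_iff (isCompl (A := A)) a).2 ha,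
    (Submodule.projection_apply_eq_zero_iff (isCompl (A := A)).symm).2 ha, sub_zero]

theorem sigma_odd {a : A} (ha : a ∈ part (A := A) 1) : sigma A a = -a := by
  rw [sigma, LinearMap.sub_apply,
    (Submodule.projection_eq_self_iff (isCompl (A := A)).symm a).2 ha,
    (Submodule.projection_apply_eq_zero_iff (isCompl (A := A))).2 ha, zero_sub]

/-- The even part of a commutative superalgebra, a commutative ring. -/
def evenPart (A : Type*) [Ring A] [Algebra ℂ A] [SuperAlgebra A] : Subalgebra ℂ A where
  carrier := part (A := A) 0
  mul_mem' ha hb := by simpa using mul_mem ha hb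
  add_mem' ha hb := (part (A := A) 0).add_mem ha hb
  algebraMap_mem' r := by
    rw [Algebra.algebraMap_eq_smul_one]
    exact (part (A := A) 0).smul_mem r one_mem

noncomputable instance : CommRing (evenPart A) :=
  { (inferInstance : Ring (evenPart A)) with
    mul_comm := fun a b => Subtype.ext (commute_of_even a.2 b.1) }

/-- The ideal generated by the odd elements. -/
def oddIdeal (A : Type*) [Ring A] [Algebra ℂ A] [SuperAlgebra A] : TwoSidedIdeal A :=
  TwoSidedIdeal.span (part (A := A) 1 : Set A)

/-- Affine superalgebras: finitely generated, and the reduced algebra `A / (odd elements)` has no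
nilpotents. -/
def IsAffine (A : Type*) [Ring A] [Algebra ℂ A] [SuperAlgebra A] : Prop :=
  Algebra.FiniteType ℂ A ∧ IsReduced (A ⧸ (oddIdeal A).asIdeal)

end Basic

/-! ### The free modules `A^{σ|τ} = A ⊗ ℂ^{σ|τ}` and their submodules -/

section Modules

variable {A : Type*} [Ring A] [Algebra ℂ A] [SuperAlgebra A] {σ τ : Type*}

open SuperAlgebra

/-- Parity of the standard basis vectors of `ℂ^{σ|τ}`. -/
def par : σ ⊕ τ → ZMod 2 := Sum.elim (fun _ => 0) (fun _ => 1)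

/-- `v = ∑ v_j e_j` is homogeneous of parity `i`. -/
def IsHomog (i : ZMod 2) (v : σ ⊕ τ → A) : Prop := ∀ j, v j ∈ part (A := A) (i + par j)

/-- A graded submodule `L = L_0 ⊕ L_1` of `A^{σ|τ}`. -/
def IsGraded (L : Submodule A (σ ⊕ τ → A)) : Prop :=
  ∀ v ∈ L, ∃ v₀ ∈ L, ∃ v₁ ∈ L, IsHomog 0 v₀ ∧ IsHomog 1 v₁ ∧ v₀ + v₁ = v

/-- The localization `L_p` at a prime ideal `p` of the even part of `A` is free over `A_p` with a
basis of `r` even vectors (denominators cleared). -/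
def IsFreeAt (r : ℕ) (L : Submodule A (σ ⊕ τ → A)) (p : Ideal (evenPart A)) : Prop :=
  ∃ b : Fin r → σ ⊕ τ → A, (∀ k, b k ∈ L ∧ IsHomog 0 (b k)) ∧
    (∀ v ∈ L, ∃ s : evenPart A, s ∉ p ∧ (s : A) • v ∈ Submodule.span A (Set.range b)) ∧
    (∀ c : Fin r → A, ∑ k, c k • b k = 0 → ∃ s : evenPart A, s ∉ p ∧ ∀ k, (s : A) * c k = 0)

/-- The `A`-points of the Grassmannian of `r|0`-planes in `ℂ^{σ|τ}`: graded direct summands of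
`A^{σ|τ}` (hence projective modules) of rank `r|0`. -/
structure IsPoint (r : ℕ) (L : Submodule A (σ ⊕ τ → A)) : Prop where
  graded : IsGraded L
  summand : ∃ L' : Submodule A (σ ⊕ τ → A), IsGraded L' ∧ IsCompl L L'
  rank : ∀ p : Ideal (evenPart A), p.IsPrime → IsFreeAt r L p

/-- Base change of a submodule of `A^{σ|τ}` along `φ : A → B`: the submodule of `B^{σ|τ}` generated
by the image. -/
def baseChange {B : Type*} [Ring B] [Algebra ℂ B] [SuperAlgebra B] (φ : SuperHom A B)
    (L : Submodule A (σ ⊕ τ → A)) : Submodule B (σ ⊕ τ → B) :=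
  Submodule.span B ((fun v j => φ.toAlgHom (v j)) '' (L : Set (σ ⊕ τ → A)))

end Modules

/-! ### Polynomial superalgebras -/

/-- The polynomial superalgebra `ℂ[x_s, θ_t] = ℂ[x_s] ⊗ Λ(θ_t)`, `s ∈ σ` even, `t ∈ τ` odd. -/
def SPoly (σ τ : Type) : Type :=
  MvPolynomial σ ℂ ⊗[ℂ] ExteriorAlgebra ℂ (τ →₀ ℂ)

namespace SPoly

variable {σ τ : Type}

noncomputable instance : Ring (SPoly σ τ) :=
  inferInstanceAs (Ring (MvPolynomial σ ℂ ⊗[ℂ] ExteriorAlgebra ℂ (τ →₀ ℂ)))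

noncomputable instance : Algebra ℂ (SPoly σ τ) :=
  inferInstanceAs (Algebra ℂ (MvPolynomial σ ℂ ⊗[ℂ] ExteriorAlgebra ℂ (τ →₀ ℂ)))

/-- `p ⊗ w` as an element of `ℂ[x_s] ⊗ Λ(θ_t)`. -/
noncomputable def tmul (p : MvPolynomial σ ℂ) (w : ExteriorAlgebra ℂ (τ →₀ ℂ)) : SPoly σ τ :=
  p ⊗ₜ[ℂ] w

theorem tmul_add (p : MvPolynomial σ ℂ) (w w' : ExteriorAlgebra ℂ (τ →₀ ℂ)) :
    tmul p (w + w') = tmul p w + tmul p w' := TensorProduct.tmul_add p w w'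

theorem tmul_neg (p : MvPolynomial σ ℂ) (w : ExteriorAlgebra ℂ (τ →₀ ℂ)) :
    tmul p (-w) = -tmul p w := TensorProduct.tmul_neg p w

theorem tmul_mul_tmul (p p' : MvPolynomial σ ℂ) (w w' : ExteriorAlgebra ℂ (τ →₀ ℂ)) :
    tmul p w * tmul p' w' = tmul (p * p') (w * w') :=
  Algebra.TensorProduct.tmul_mul_tmul p p' w w'

theorem tmul_induction {P : SPoly σ τ → Prop} (z : SPoly σ τ) (zero : P 0)
    (tmul : ∀ p w, P (tmul p w)) (add : ∀ a b, P a → P b → P (a + b)) : P z :=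
  TensorProduct.induction_on (motive := P) z zero tmul add

/-- The even variables. -/
noncomputable def x (s : σ) : SPoly σ τ := tmul (MvPolynomial.X s) 1

/-- The odd variables. -/
noncomputable def θ (t : τ) : SPoly σ τ := tmul 1 (ExteriorAlgebra.ι ℂ (Finsupp.single t 1))

/-- All the variables, as a vector indexed by `σ ⊕ τ`. -/
noncomputable def var : σ ⊕ τ → SPoly σ τ := Sum.elim x θ

/-- The part of parity `i`, spanned by `p ⊗ w` with `w ∈ Λ` a combination of products of `m`
variables, `m ≡ i mod 2`. -/
noncomputable def parity (σ τ : Type) (i : ZMod 2) : Submodule ℂ (SPoly σ τ) :=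
  Submodule.span ℂ {z | ∃ (p : MvPolynomial σ ℂ) (w : ExteriorAlgebra ℂ (τ →₀ ℂ)),
    w ∈ CliffordAlgebra.evenOdd (0 : QuadraticForm ℂ (τ →₀ ℂ)) i ∧ z = tmul p w}


theorem exterior_comm {i j : ZMod 2} {w w' : ExteriorAlgebra ℂ (τ →₀ ℂ)}
    (hw : w ∈ CliffordAlgebra.evenOdd (0 : QuadraticForm ℂ (τ →₀ ℂ)) i)
    (hw' : w' ∈ CliffordAlgebra.evenOdd (0 : QuadraticForm ℂ (τ →₀ ℂ)) j) :
    w * w' = (-1 : ℤˣ) ^ (j * i) • (w' * w) := by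
  have h := CliffordAlgebra.map_mul_map_of_isOrtho_of_mem_evenOdd
    (QuadraticMap.Isometry.id (0 : QuadraticForm ℂ (τ →₀ ℂ)))
    (QuadraticMap.Isometry.id (0 : QuadraticForm ℂ (τ →₀ ℂ)))
    (fun x y => by simp [QuadraticMap.IsOrtho]) w w' hw hw'
  simpa [CliffordAlgebra.map_id] using h

theorem parity_comm {i j : ZMod 2} {a b : SPoly σ τ} (ha : a ∈ parity σ τ i)
    (hb : b ∈ parity σ τ j) : a * b = (-1 : ℤˣ) ^ (j * i) • (b * a) := by
  induction ha using Submodule.span_induction with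
  | zero => simp
  | add x y _ _ hx hy => rw [add_mul, mul_add, hx, hy, smul_add]
  | smul c x _ hx => rw [smul_mul_assoc, hx, mul_smul_comm, smul_comm]
  | mem x hx =>
    obtain ⟨p, w, hw, rfl⟩ := hx
    induction hb using Submodule.span_induction with
    | zero => simp
    | add x y _ _ hx hy => rw [add_mul, mul_add, hx, hy, smul_add]
    | smul c x _ hx => rw [smul_mul_assoc, mul_smul_comm, hx, smul_comm]
    | mem y hy =>
      obtain ⟨q, w', hw', rfl⟩ := hy
      rw [tmul_mul_tmul, tmul_mul_tmul,
        exterior_comm hw hw', mul_comm q p]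
      rcases Int.units_eq_one_or ((-1 : ℤˣ) ^ (j * i)) with h | h <;> rw [h] <;>
        simp [Units.smul_def, tmul_neg]

/-- The involution `p ⊗ w ↦ p ⊗ (-1)^{|w|} w`. -/
noncomputable def invol (σ τ : Type) : SPoly σ τ →ₐ[ℂ] SPoly σ τ :=
  Algebra.TensorProduct.map (AlgHom.id ℂ (MvPolynomial σ ℂ))
    (CliffordAlgebra.involute (Q := (0 : QuadraticForm ℂ (τ →₀ ℂ))))

theorem invol_tmul (p : MvPolynomial σ ℂ) (w : ExteriorAlgebra ℂ (τ →₀ ℂ)) :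
    invol σ τ (tmul p w) =
      tmul p (CliffordAlgebra.involute (Q := (0 : QuadraticForm ℂ (τ →₀ ℂ))) w) := rfl

theorem invol_even {a : SPoly σ τ} (ha : a ∈ parity σ τ 0) : invol σ τ a = a := by
  induction ha using Submodule.span_induction with
  | zero => simp
  | add x y _ _ hx hy => rw [map_add, hx, hy]
  | smul c x _ hx => rw [map_smul, hx]
  | mem x hx =>
    obtain ⟨p, w, hw, rfl⟩ := hx
    rw [invol_tmul, CliffordAlgebra.involute_eq_of_mem_even hw]

theorem invol_odd {a : SPoly σ τ} (ha : a ∈ parity σ τ 1) : invol σ τ a = -a := by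
  induction ha using Submodule.span_induction with
  | zero => simp
  | add x y _ _ hx hy => rw [map_add, hx, hy, neg_add]
  | smul c x _ hx => rw [map_smul, hx, smul_neg]
  | mem x hx =>
    obtain ⟨p, w, hw, rfl⟩ := hx
    rw [invol_tmul, CliffordAlgebra.involute_eq_of_mem_odd hw, tmul_neg]

noncomputable instance : SuperAlgebra (SPoly σ τ) where
  part := parity σ τ
  isCompl := by
    refine ⟨Submodule.disjoint_def.2 fun a h0 h1 => ?_, codisjoint_iff.2 (eq_top_iff.2 ?_)⟩
    · have h : a = -a := (invol_even h0).symm.trans (invol_odd h1)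
      have h2 : (2 : ℂ) • a = 0 := by
        rw [two_smul]
        nth_rewrite 1 [h]
        simp
      exact (smul_eq_zero_iff_right (by norm_num)).1 h2
    · intro z _
      induction z using tmul_induction with
      | zero => exact Submodule.zero_mem _
      | add x y hx hy => exact Submodule.add_mem _ (hx trivial) (hy trivial)
      | tmul p w =>
        have hw : w ∈ CliffordAlgebra.evenOdd (0 : QuadraticForm ℂ (τ →₀ ℂ)) 0 ⊔
            CliffordAlgebra.evenOdd (0 : QuadraticForm ℂ (τ →₀ ℂ)) 1 := by
          rw [(CliffordAlgebra.evenOdd_isCompl _).sup_eq_top]; trivial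
        obtain ⟨w₀, h₀, w₁, h₁, rfl⟩ := Submodule.mem_sup.1 hw
        rw [tmul_add]
        exact Submodule.add_mem_sup (Submodule.subset_span ⟨p, w₀, h₀, rfl⟩)
          (Submodule.subset_span ⟨p, w₁, h₁, rfl⟩)
  one_mem := Submodule.subset_span ⟨1, 1,
    CliffordAlgebra.one_le_evenOdd_zero _ (Submodule.mem_one.2 ⟨1, by simp⟩), rfl⟩
  mul_mem := by
    intro i j a b ha hb
    induction ha using Submodule.span_induction with
    | zero => simp
    | add x y _ _ hx hy => rw [add_mul]; exact Submodule.add_mem _ hx hy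
    | smul c x _ hx => rw [smul_mul_assoc]; exact Submodule.smul_mem _ _ hx
    | mem x hx =>
      obtain ⟨p, w, hw, rfl⟩ := hx
      induction hb using Submodule.span_induction with
      | zero => simp
      | add x y _ _ hx hy => rw [mul_add]; exact Submodule.add_mem _ hx hy
      | smul c x _ hx => rw [mul_smul_comm]; exact Submodule.smul_mem _ _ hx
      | mem y hy =>
        obtain ⟨q, w', hw', rfl⟩ := hy
        rw [tmul_mul_tmul]
        exact Submodule.subset_span ⟨_, _, CliffordAlgebra.evenOdd_mul_le _ i j
          (Submodule.mul_mem_mul hw hw'), rfl⟩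
  even_mul := by
    intro j a b ha hb
    simpa using parity_comm ha hb
  odd_mul_odd := by
    intro a b ha hb
    simpa using parity_comm ha hb

theorem x_mem (s : σ) : (x s : SPoly σ τ) ∈ SuperAlgebra.part (A := SPoly σ τ) 0 :=
  Submodule.subset_span ⟨MvPolynomial.X s, 1,
    CliffordAlgebra.one_le_evenOdd_zero _ (Submodule.mem_one.2 ⟨1, by simp⟩), rfl⟩

theorem θ_mem (t : τ) : (θ t : SPoly σ τ) ∈ SuperAlgebra.part (A := SPoly σ τ) 1 :=
  Submodule.subset_span ⟨1, _, CliffordAlgebra.ι_mem_evenOdd_one _ _, rfl⟩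

section Eval

variable {A : Type*} [Ring A] [Algebra ℂ A] [SuperAlgebra A]

theorem inl_mem {v : σ ⊕ τ → A} (hv : IsHomog 0 v) (s : σ) : v (Sum.inl s) ∈ evenPart A := by
  have h := hv (Sum.inl s)
  rw [par, Sum.elim_inl, add_zero] at h
  exact h

theorem inr_mem {v : σ ⊕ τ → A} (hv : IsHomog 0 v) (t : τ) :
    v (Sum.inr t) ∈ SuperAlgebra.part (A := A) 1 := by
  have h := hv (Sum.inr t)
  rwa [par, Sum.elim_inr, zero_add] at h

theorem linearCombination_mul_self {v : σ ⊕ τ → A} (hv : IsHomog 0 v) (m : τ →₀ ℂ) :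
    Finsupp.linearCombination ℂ (fun t => v (Sum.inr t)) m *
      Finsupp.linearCombination ℂ (fun t => v (Sum.inr t)) m = 0 := by
  apply odd_mul_self
  rw [Finsupp.linearCombination_apply]
  exact Submodule.sum_mem _ fun t _ => Submodule.smul_mem _ _ (inr_mem hv t)

/-- Substitution of an even vector of `A^{σ|τ}` (even entries for the `x_s`, odd entries for
the `θ_t`) in a polynomial. -/
noncomputable def eval (v : σ ⊕ τ → A) (hv : IsHomog 0 v) : SPoly σ τ →ₐ[ℂ] A :=
  Algebra.TensorProduct.lift (A := MvPolynomial σ ℂ) (B := ExteriorAlgebra ℂ (τ →₀ ℂ))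
    ((evenPart A).val.comp (MvPolynomial.aeval fun s =>
      (⟨v (Sum.inl s), inl_mem hv s⟩ : evenPart A)))
    (ExteriorAlgebra.lift ℂ ⟨Finsupp.linearCombination ℂ fun t => v (Sum.inr t),
      linearCombination_mul_self hv⟩)
    (fun p _ => commute_of_even (a := ((evenPart A).val (MvPolynomial.aeval _ p)))
      (Subtype.prop (MvPolynomial.aeval (R := ℂ) (S₁ := evenPart A) _ p)) _)

theorem eval_tmul (v : σ ⊕ τ → A) (hv : IsHomog 0 v) (p : MvPolynomial σ ℂ)
    (w : ExteriorAlgebra ℂ (τ →₀ ℂ)) :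
    eval v hv (tmul p w) =
      (MvPolynomial.aeval (fun s => (⟨v (Sum.inl s), inl_mem hv s⟩ : evenPart A)) p : A) *
        ExteriorAlgebra.lift ℂ ⟨Finsupp.linearCombination ℂ fun t => v (Sum.inr t),
          linearCombination_mul_self hv⟩ w := rfl

@[simp] theorem eval_x (v : σ ⊕ τ → A) (hv : IsHomog 0 v) (s : σ) :
    eval v hv (x s) = v (Sum.inl s) := by
  rw [x, eval_tmul]
  simp

@[simp] theorem eval_θ (v : σ ⊕ τ → A) (hv : IsHomog 0 v) (t : τ) :
    eval v hv (θ t) = v (Sum.inr t) := by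
  rw [θ, eval_tmul]
  simp

end Eval

theorem var_homog : IsHomog 0 (var : σ ⊕ τ → SPoly σ τ) := by
  rintro (s | t)
  · simpa [par, var] using x_mem s
  · simpa [par, var] using θ_mem t

theorem algHom_ext {R : Type*} [Ring R] [Algebra ℂ R] {f g : SPoly σ τ →ₐ[ℂ] R}
    (hx : ∀ s, f (x s) = g (x s)) (hθ : ∀ t, f (θ t) = g (θ t)) : f = g := by
  apply Algebra.TensorProduct.ext (A := MvPolynomial σ ℂ) (B := ExteriorAlgebra ℂ (τ →₀ ℂ))
  · ext s
    exact hx s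
  · ext t
    exact hθ t

end SPoly

/-! ### Quotients of superalgebras -/

section Quotient

open SuperAlgebra

variable {A : Type*} [Ring A] [Algebra ℂ A] [SuperAlgebra A]

/-- An ideal that contains the even (hence also the odd) component of each of its elements. -/
class HomogIdeal (I : TwoSidedIdeal A) : Prop where
  even_mem : ∀ {a b : A}, a ∈ part (A := A) 0 → b ∈ part (A := A) 1 → a + b ∈ I → a ∈ I

/-- The quotient of a commutative superalgebra by a homogeneous ideal. -/
noncomputable instance (I : TwoSidedIdeal A) [HomogIdeal I] : SuperAlgebra (A ⧸ I.asIdeal) where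
  part i := (part (A := A) i).map (Ideal.Quotient.mkₐ ℂ I.asIdeal).toLinearMap
  isCompl := by
    refine ⟨Submodule.disjoint_def.2 ?_, codisjoint_iff.2 (eq_top_iff.2 ?_)⟩
    · rintro _ ⟨a, ha, rfl⟩ ⟨b, hb, hab⟩
      have h : b - a ∈ I.asIdeal := Ideal.Quotient.eq.1 hab
      have h' : a + -b ∈ I := by
        have := I.neg_mem (TwoSidedIdeal.mem_asIdeal.1 h)
        rwa [neg_sub, sub_eq_add_neg] at this
      exact Ideal.Quotient.eq_zero_iff_mem.2 (TwoSidedIdeal.mem_asIdeal.2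
        (HomogIdeal.even_mem ha (Submodule.neg_mem _ hb) h'))
    · intro z _
      obtain ⟨z, rfl⟩ := Ideal.Quotient.mk_surjective z
      obtain ⟨a, ha, b, hb, rfl⟩ := exists_add z
      rw [map_add]
      exact Submodule.add_mem_sup ⟨a, ha, rfl⟩ ⟨b, hb, rfl⟩
  one_mem := ⟨1, one_mem, map_one (Ideal.Quotient.mkₐ ℂ I.asIdeal)⟩
  mul_mem := by
    rintro i j _ _ ⟨a, ha, rfl⟩ ⟨b, hb, rfl⟩
    exact ⟨a * b, mul_mem ha hb, map_mul (Ideal.Quotient.mkₐ ℂ I.asIdeal) a b⟩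
  even_mul := by
    rintro j _ _ ⟨a, ha, rfl⟩ ⟨b, hb, rfl⟩
    have := congrArg (Ideal.Quotient.mkₐ ℂ I.asIdeal) (even_mul ha hb)
    rwa [map_mul, map_mul] at this
  odd_mul_odd := by
    rintro _ _ ⟨a, ha, rfl⟩ ⟨b, hb, rfl⟩
    have := congrArg (Ideal.Quotient.mkₐ ℂ I.asIdeal) (odd_mul_odd ha hb)
    rwa [map_neg, map_mul, map_mul] at this

end Quotient

namespace SPoly

variable {σ τ : Type}

theorem homogIdeal_of_invol {I : TwoSidedIdeal (SPoly σ τ)}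
    (h : ∀ f ∈ I, invol σ τ f ∈ I) : HomogIdeal I where
  even_mem := by
    intro a b ha hb hab
    have h1 := I.add_mem hab (h _ hab)
    rw [map_add, invol_even ha, invol_odd hb] at h1
    have h2 : a + b + (a + -b) = algebraMap ℂ (SPoly σ τ) 2 * a := by
      rw [← Algebra.smul_def, two_smul]; abel
    have h3 := I.mul_mem_left (algebraMap ℂ (SPoly σ τ) (1 / 2)) _ h1
    rw [h2, ← mul_assoc, ← map_mul] at h3
    norm_num at h3
    exact h3

theorem invol_mem {I : TwoSidedIdeal (SPoly σ τ)} [hI : HomogIdeal I] {f : SPoly σ τ}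
    (hf : f ∈ I) : invol σ τ f ∈ I := by
  obtain ⟨a, ha, b, hb, rfl⟩ := exists_add f
  have h := hI.even_mem ha hb hf
  have hb' : b ∈ I := by simpa using I.sub_mem hf h
  rw [map_add, invol_even ha, invol_odd hb]
  exact I.add_mem h (I.neg_mem hb')

theorem homogIdeal_span {R : Set (SPoly σ τ)} (hR : ∀ f ∈ R, invol σ τ f ∈ TwoSidedIdeal.span R) :
    HomogIdeal (TwoSidedIdeal.span R) := by
  apply homogIdeal_of_invol
  intro f hf
  have h : TwoSidedIdeal.span R ≤ (TwoSidedIdeal.span R).comap (invol σ τ) :=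
    TwoSidedIdeal.span_le.2 fun g hg => (TwoSidedIdeal.mem_comap (invol σ τ)).2 (hR g hg)
  exact (TwoSidedIdeal.mem_comap (invol σ τ)).1 (h hf)

/-! ### Projective localizations

For a homogeneous ideal `I` of `S = ℂ[x_s, θ_t]` and an even variable `x_i`, the elements of degree
zero of `(S / I)[x_i⁻¹]` form the superalgebra
`ℂ[u_s, η_t | s ≠ i] / I_loc`, where `u_s = x_s / x_i`, `η_t = θ_t / x_i` and `I_loc` consists of
the `f (u, η)` with `u_i = 1`, for `f ∈ I`. -/

/-- The vector of the `x_s / x_i` and the `θ_t / x_i` in `ℂ[u_s, η_t | s ≠ i]`. -/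
noncomputable def affVar (i : σ) : σ ⊕ τ → SPoly {s : σ // s ≠ i} τ :=
  open Classical in
  Sum.elim (fun s => if h : s = i then 1 else x ⟨s, h⟩) θ

theorem affVar_homog (i : σ) : IsHomog 0 (affVar i : σ ⊕ τ → SPoly {s : σ // s ≠ i} τ) := by
  rintro (s | t)
  · by_cases h : s = i
    · simpa [par, affVar, h] using SuperAlgebra.one_mem
    · simpa [par, affVar, h] using x_mem _
  · simpa [par, affVar] using θ_mem t

/-- Dehomogenization `f ↦ f (u, η)`, with `u_i = 1`. -/
noncomputable def dehom (i : σ) : SPoly σ τ →ₐ[ℂ] SPoly {s : σ // s ≠ i} τ :=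
  eval (affVar i) (affVar_homog i)

/-- The ideal `I_loc`. -/
noncomputable def locIdeal (I : TwoSidedIdeal (SPoly σ τ)) (i : σ) :
    TwoSidedIdeal (SPoly {s : σ // s ≠ i} τ) :=
  TwoSidedIdeal.span (dehom i '' (I : Set (SPoly σ τ)))

theorem invol_x (s : σ) : invol σ τ (x s) = x s := invol_even (x_mem s)

theorem invol_θ (t : τ) : invol σ τ (θ t) = -θ t := invol_odd (θ_mem t)

theorem invol_dehom (i : σ) (f : SPoly σ τ) :
    invol _ τ (dehom i f) = dehom i (invol σ τ f) := by
  have : (invol _ τ).comp (dehom i) = (dehom i).comp (invol σ τ) := by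
    apply algHom_ext
    · intro s
      rw [AlgHom.comp_apply, AlgHom.comp_apply, invol_x, dehom, eval_x]
      by_cases h : s = i
      · simp [affVar, h]
      · simp only [affVar, Sum.elim_inl, h, dite_false, invol_x]
    · intro t
      rw [AlgHom.comp_apply, AlgHom.comp_apply, invol_θ, map_neg, dehom, eval_θ]
      exact invol_θ t
  exact DFunLike.congr_fun this f

instance (I : TwoSidedIdeal (SPoly σ τ)) [HomogIdeal I] (i : σ) : HomogIdeal (locIdeal I i) := by
  apply homogIdeal_span
  rintro _ ⟨f, hf, rfl⟩
  rw [invol_dehom]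
  exact TwoSidedIdeal.subset_span ⟨_, invol_mem hf, rfl⟩

/-- The coordinate superalgebra `((S / I)[x_i⁻¹])_0` of the `i`-th standard affine chart. -/
abbrev Chart (I : TwoSidedIdeal (SPoly σ τ)) (i : σ) : Type :=
  SPoly {s : σ // s ≠ i} τ ⧸ (locIdeal I i).asIdeal

/-- The elements `x_s / x_i`, `θ_t / x_i` of the coordinate superalgebra of the `i`-th chart. -/
noncomputable def chartVar (I : TwoSidedIdeal (SPoly σ τ)) (i : σ) : σ ⊕ τ → Chart I i :=
  fun j => Ideal.Quotient.mk _ (affVar i j)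

end SPoly

/-- The functor of points of the closed supersubvariety of the projective superspace `ℙ(ℂ^{σ|τ})`
defined by an ideal `I` (generated by homogeneous elements): the graded rank `1|0` direct summands
`M` of `A^{σ|τ}` on whose even elements all the `f ∈ I` vanish. -/
def IsProjPoint {A : Type*} [Ring A] [Algebra ℂ A] [SuperAlgebra A] {σ τ : Type}
    (I : TwoSidedIdeal (SPoly σ τ)) (M : Submodule A (σ ⊕ τ → A)) : Prop :=
  IsPoint 1 M ∧ ∀ Q ∈ M, ∀ hQ : IsHomog 0 Q, ∀ f ∈ I, SPoly.eval Q hQ f = 0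

/-! ### The super Plücker map of the Grassmannian of `2|0`-planes in `ℂ^{4|1}` -/

/-- The even Plücker coordinates: `q i j` for `i < j`, and `a55`. The odd ones are indexed
by `Fin 4`. -/
inductive EvenIdx : Type
  | q (i j : Fin 4) (h : i < j) : EvenIdx
  | a55 : EvenIdx

section Wedge

variable {A : Type*} [Ring A] [Algebra ℂ A] [SuperAlgebra A]

/-- The wedge product of `u, w ∈ A^{4|1}`, in coordinates: with `u = ∑ u_i e_i + u_5 ε_5`,
`w = ∑ w_i e_i + w_5 ε_5`, the sign rule `e w = (-1)^{|e||w|} w e` and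
`u ∧ w = -(-1)^{|u||w|} w ∧ u` give
`u ∧ w = ∑_{i<j} (u_i w_j - u_j w_i) e_i ∧ e_j + ∑_i (u_i w_5 - u_5 w̄_i) e_i ∧ ε_5
  + u_5 w̄_5 ε_5 ∧ ε_5`, where `w̄_i` is `sigma w_i`. The basis of `∧² A^{4|1}` used here is
`e_i ∧ e_j` (`i < j`), `-ε_5 ∧ ε_5` and `e_i ∧ ε_5`, so that the last even coordinate of a wedge
of two even vectors is `u_5 w_5`. -/
noncomputable def wedge (u w : Fin 4 ⊕ Fin 1 → A) : EvenIdx ⊕ Fin 4 → A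
  | .inl (.q i j _) => u (.inl i) * w (.inl j) - u (.inl j) * w (.inl i)
  | .inl .a55 => -(u (.inr 0) * sigma A (w (.inr 0)))
  | .inr i => u (.inl i) * w (.inr 0) - u (.inr 0) * sigma A (w (.inl i))

/-- `∧² L ⊆ ∧² A^{4|1}`, the submodule generated by the `u ∧ w`, `u, w ∈ L`. -/
noncomputable def wedgeSq (L : Submodule A (Fin 4 ⊕ Fin 1 → A)) :
    Submodule A (EvenIdx ⊕ Fin 4 → A) :=
  Submodule.span A {z | ∃ u ∈ L, ∃ w ∈ L, z = wedge u w}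

end Wedge

/-! ### The super Plücker relations -/

/-- `ℂ[q_ij, a_55, λ_k]`. -/
abbrev PluckerPoly : Type := SPoly EvenIdx (Fin 4)

/-- The coordinate `q_ij`, `i < j`. -/
noncomputable def q (i j : Fin 4) (h : i < j := by decide) : PluckerPoly := SPoly.x (.q i j h)

/-- The coordinate `a_55`. -/
noncomputable def a55 : PluckerPoly := SPoly.x .a55

/-- The coordinate `λ_k`. -/
noncomputable def lam (k : Fin 4) : PluckerPoly := SPoly.θ k

/-- The super Plücker relations. -/
inductive PluckerRel : PluckerPoly → Prop
  | classical : PluckerRel (q 0 1 * q 2 3 - q 0 2 * q 1 3 + q 0 3 * q 1 2)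
  | three (i j k : Fin 4) (hij : i < j) (hjk : j < k) :
      PluckerRel (q i j hij * lam k - q i k (hij.trans hjk) * lam j + q j k hjk * lam i)
  | lam_lam (i j : Fin 4) (hij : i < j) : PluckerRel (lam i * lam j - a55 * q i j hij)
  | lam_a (i : Fin 4) : PluckerRel (lam i * a55)
  | a_a : PluckerRel (a55 * a55)

/-- The ideal `I_P` of the super Plücker relations. -/
noncomputable def pluckerIdeal : TwoSidedIdeal PluckerPoly := TwoSidedIdeal.span {f | PluckerRel f}

/-- The superring `𝒪(Gr) = ℂ[q_ij, a_55, λ_k] / I_P`. -/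
abbrev GrRing : Type := PluckerPoly ⧸ pluckerIdeal.asIdeal

instance : HomogIdeal pluckerIdeal := by
  have hq : ∀ i j h, SPoly.invol _ _ (q i j h) = q i j h := fun i j h => SPoly.invol_x _
  have ha : SPoly.invol _ _ a55 = a55 := SPoly.invol_x _
  have hl : ∀ k, SPoly.invol _ _ (lam k) = -lam k := fun k => SPoly.invol_θ _
  apply SPoly.homogIdeal_span
  intro f hf
  have hf' : f ∈ TwoSidedIdeal.span {f | PluckerRel f} := TwoSidedIdeal.subset_span hf
  cases hf with
  | classical => simpa only [map_add, map_sub, map_mul, hq] using hf'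
  | three i j k hij hjk =>
    have := TwoSidedIdeal.neg_mem _ hf'
    convert this using 1
    simp only [map_add, map_sub, map_mul, hq, hl, mul_neg]
    abel
  | lam_lam i j hij => simpa only [map_sub, map_mul, hq, hl, ha, neg_mul_neg] using hf'
  | lam_a i => simpa only [map_mul, hl, ha, neg_mul, neg_neg] using TwoSidedIdeal.neg_mem _ hf'
  | a_a => simpa only [map_mul, ha] using hf'

/-! ### The determinants -/

/-- The polynomial superalgebra `ℂ[a_{ib}]`, `1 ≤ i ≤ 5`, `b = 1, 2`: the `a_{ib}` are even for
`i ≤ 4` and odd for `i = 5`. -/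
abbrev MatPoly : Type := SPoly (Fin 4 × Fin 2) (Fin 2)

/-- The determinants `d_ij = a_i1 a_j2 - a_i2 a_j1` for `i < j ≤ 5`, and `d_55 = a_51 a_52`,
indexed like the Plücker coordinates `q_ij`, `a_55`, `λ_i`. -/
noncomputable def det : EvenIdx ⊕ Fin 4 → MatPoly
  | .inl (.q i j _) => SPoly.x (i, 0) * SPoly.x (j, 1) - SPoly.x (i, 1) * SPoly.x (j, 0)
  | .inl .a55 => SPoly.θ 0 * SPoly.θ 1
  | .inr i => SPoly.x (i, 0) * SPoly.θ 1 - SPoly.x (i, 1) * SPoly.θ 0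

end SuperGr

open SuperGr

universe u

/-! ### Graded direct summands and their local frames. -/

namespace SuperGr

open SuperAlgebra

/-! ### Homogeneous elements and vectors -/

section Homogeneous

variable {A : Type*} [Ring A] [Algebra ℂ A] [SuperAlgebra A] {σ τ : Type*}

/-! Everything is local on the even part, a commutative ring. A graded direct summand of rank `r|0`
is the same as a submodule that has a frame near each prime: even vectors `b_k` in it and even
linear forms `c_k` with `c_l(b_k) = s δ_kl` and `s v = ∑ c_k(v) b_k`, where `s` lies outside the
prime (`IsPoint.of_frames`, `IsPoint.exists_frame`). Frames pass to base changes and, by a super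
Cauchy–Binet formula (`pairing_wedgeForm`), to `∧²`.

The Plücker map is inverted by contraction. For even `a`, `b`, contracting `a ∧ b` with the `j`-th
coordinate gives `a_j b - b_j a`, so the contractions of `∧²L` span `L`. Conversely, let an even
local generator `Q` satisfy the relations. Since `a_55` and all products of odd elements are
nilpotent, a prime containing every `q_ij` contains the value at `Q` of every even form; hence some
`q_ij` is invertible. There the contractions `ι_i Q`, `ι_j Q` form a frame of the span of all
contractions, and `ι_i Q ∧ ι_j Q = q_ij Q`. This gives `bijOn_wedgeSq` and the covering by charts.

No relation is missing because restriction of `𝒪(Gr)` to the big cell is injective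
(`eq_zero_of_toCell_eq_zero`). The relations bring every element to the form `p + ∑ m_k λ_k + c
a_55` with `p`, `m_k`, `c` polynomials in the `q_ij`. On the cell, with odd coordinates `θ_0`,
`θ_1`, the coefficients of `1`, `θ_1`, `θ_0`, `θ_0 θ_1` are compared: `p` and `c` vanish on the
classical Grassmannian and are multiples of the quadric, while `m` is a syzygy of the `λ_k` and
hence a combination of three-term relations. The cell carries a scaling factor `x_0`, without which
the inhomogeneous `q_12 - 1` would vanish on it. The cell has a universal plane, and the generic
determinants specialize to its coordinates; so the ideal of all relations and the isomorphism with
the algebra of determinants both come from this injectivity.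

A point whose `i`-th coordinate takes the value `1` has a unique normalized even generator, which is
the same as a morphism from the `i`-th chart. Modulo odd elements the chart of `q_ij` embeds in a
polynomial ring; the chart of `a_55` is zero. -/

theorem eq_zero_of_mem_part {i : ZMod 2} {a : A} (h : a ∈ part (A := A) i)
    (h' : a ∈ part (A := A) (1 + i)) : a = 0 := by
  have key : ∀ a : A, a ∈ part (A := A) 0 → a ∈ part (A := A) 1 → a = 0 :=
    Submodule.disjoint_def.1 (isCompl (A := A)).disjoint
  fin_cases i
  · exact key a h h'
  · exact key a h' h

theorem exists_add_part (i : ZMod 2) (a : A) :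
    ∃ a₀ ∈ part (A := A) i, ∃ a₁ ∈ part (A := A) (1 + i), a₀ + a₁ = a := by
  obtain ⟨a₀, h₀, a₁, h₁, h⟩ := exists_add a
  fin_cases i
  · exact ⟨a₀, h₀, a₁, h₁, h⟩
  · exact ⟨a₁, h₁, a₀, h₀, by rw [add_comm, h]⟩

theorem eq_of_add_eq {i : ZMod 2} {a₀ a₁ b₀ b₁ : A} (h₀ : a₀ ∈ part (A := A) i)
    (h₁ : a₁ ∈ part (A := A) (1 + i)) (k₀ : b₀ ∈ part (A := A) i)
    (k₁ : b₁ ∈ part (A := A) (1 + i)) (h : a₀ + a₁ = b₀ + b₁) : a₀ = b₀ := by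
  refine sub_eq_zero.1 (eq_zero_of_mem_part (Submodule.sub_mem _ h₀ k₀) ?_)
  have : a₀ - b₀ = b₁ - a₁ := by
    rw [sub_eq_sub_iff_add_eq_add, h, add_comm]
  rw [this]
  exact Submodule.sub_mem _ k₁ h₁

theorem even_smul_mem {i : ZMod 2} {s a : A} (hs : s ∈ part (A := A) 0)
    (ha : a ∈ part (A := A) i) : s * a ∈ part (A := A) i := by
  simpa using mul_mem hs ha

theorem IsHomog.add {i : ZMod 2} {v w : σ ⊕ τ → A} (hv : IsHomog i v) (hw : IsHomog i w) :
    IsHomog i (v + w) := fun j => Submodule.add_mem _ (hv j) (hw j)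

theorem IsHomog.zero {i : ZMod 2} : IsHomog i (0 : σ ⊕ τ → A) :=
  fun _ => Submodule.zero_mem _

theorem IsHomog.sum {i : ZMod 2} {κ : Type*} {s : Finset κ} {v : κ → σ ⊕ τ → A}
    (hv : ∀ k ∈ s, IsHomog i (v k)) : IsHomog i (∑ k ∈ s, v k) := fun j => by
  rw [Finset.sum_apply]
  exact Submodule.sum_mem _ fun k hk => hv k hk j

theorem IsHomog.smul {i k : ZMod 2} {a : A} {v : σ ⊕ τ → A} (ha : a ∈ part (A := A) k)
    (hv : IsHomog i v) : IsHomog (k + i) (a • v) := fun j => by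
  rw [add_assoc]
  exact mul_mem ha (hv j)

theorem IsHomog.even_smul {i : ZMod 2} {a : A} {v : σ ⊕ τ → A} (ha : a ∈ part (A := A) 0)
    (hv : IsHomog i v) : IsHomog i (a • v) := by
  simpa using hv.smul ha

theorem exists_homog_add (v : σ ⊕ τ → A) :
    ∃ v₀ v₁ : σ ⊕ τ → A, IsHomog 0 v₀ ∧ IsHomog 1 v₁ ∧ v₀ + v₁ = v := by
  choose v₀ h₀ v₁ h₁ h using fun j => exists_add_part (0 + par j) (v j)
  refine ⟨v₀, v₁, h₀, fun j => ?_, funext h⟩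
  have := h₁ j
  rwa [zero_add] at this

theorem homog_eq_of_add_eq {v₀ v₁ w₀ w₁ : σ ⊕ τ → A} (h₀ : IsHomog 0 v₀) (h₁ : IsHomog 1 v₁)
    (k₀ : IsHomog 0 w₀) (k₁ : IsHomog 1 w₁) (h : v₀ + v₁ = w₀ + w₁) : v₀ = w₀ ∧ v₁ = w₁ := by
  have : v₀ = w₀ := funext fun j => eq_of_add_eq (i := par j) (by simpa using h₀ j) (h₁ j)
    (by simpa using k₀ j) (k₁ j) (congrFun h j)
  subst this
  exact ⟨rfl, add_left_cancel h⟩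

/-- Even elements are scalars that commute with every linear map. -/
theorem even_smul_comm {N : Type*} [AddCommGroup N] [Module A N] {s : A}
    (hs : s ∈ part (A := A) 0) (a : A) (v : N) : s • a • v = a • s • v := by
  rw [smul_smul, smul_smul, commute_of_even hs]

end Homogeneous

/-! ### Localization on the even part -/

section Local

variable {A : Type*} [Ring A] [Algebra ℂ A] [SuperAlgebra A]

theorem ideal_eq_top_of_local {J : Ideal (evenPart A)}
    (h : ∀ p : Ideal (evenPart A), p.IsPrime → ∃ s, s ∉ p ∧ s ∈ J) : J = ⊤ := by
  by_contra hJ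
  obtain ⟨m, hm, hJm⟩ := Ideal.exists_le_maximal J hJ
  obtain ⟨s, hs, hsJ⟩ := h m hm.isPrime
  exact hs (hJm hsJ)

/-- The even elements that multiply `v` into a submodule. -/
def evenColon {N : Type*} [AddCommGroup N] [Module A N] (L : Submodule A N) (v : N) :
    Ideal (evenPart A) where
  carrier := {s | (s : A) • v ∈ L}
  add_mem' {a b} ha hb := by
    change ((a : A) + (b : A)) • v ∈ L
    rw [add_smul]
    exact L.add_mem ha hb
  zero_mem' := by
    change (0 : A) • v ∈ L
    rw [zero_smul]
    exact L.zero_mem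
  smul_mem' a s hs := by
    change ((a : A) * (s : A)) • v ∈ L
    rw [mul_smul]
    exact L.smul_mem _ hs

/-- The even multipliers of `v` into `L` form an ideal contained in no prime. Equalities of
submodules are reduced to frames in this way. -/
theorem mem_of_local {N : Type*} [AddCommGroup N] [Module A N] {L : Submodule A N} {v : N}
    (h : ∀ p : Ideal (evenPart A), p.IsPrime → ∃ s : evenPart A, s ∉ p ∧ (s : A) • v ∈ L) :
    v ∈ L := by
  have h1 : (1 : evenPart A) ∈ evenColon L v := by
    rw [ideal_eq_top_of_local (J := evenColon L v) h]
    trivial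
  have : (1 : A) • v ∈ L := h1
  rwa [one_smul] at this

theorem eq_zero_of_local {N : Type*} [AddCommGroup N] [Module A N] {v : N}
    (h : ∀ p : Ideal (evenPart A), p.IsPrime → ∃ s : evenPart A, s ∉ p ∧ (s : A) • v = 0) :
    v = 0 := by
  rw [← Submodule.mem_bot A]
  exact mem_of_local fun p hp => (h p hp).imp fun s hs => ⟨hs.1, (Submodule.mem_bot A).2 hs.2⟩

end Local

/-! ### Local frames -/

section Pairing

variable {A : Type*} [Ring A] {σ τ : Type*} [Fintype σ] [Fintype τ]

/-- The linear form `v ↦ ∑ v_j c_j`. -/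
def pairing (c : σ ⊕ τ → A) : (σ ⊕ τ → A) →ₗ[A] A := Fintype.linearCombination A c

theorem pairing_apply (c v : σ ⊕ τ → A) : pairing c v = ∑ j, v j * c j := rfl

theorem pairing_add (c d v : σ ⊕ τ → A) : pairing (c + d) v = pairing c v + pairing d v := by
  simp [pairing_apply, mul_add, Finset.sum_add_distrib]

end Pairing

section Frames

variable {A : Type*} [Ring A] [Algebra ℂ A] [SuperAlgebra A] {σ τ : Type*}
  [Fintype σ] [Fintype τ]

theorem pairing_even_smul {s : A} (hs : s ∈ part (A := A) 0) (c v : σ ⊕ τ → A) :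
    pairing (s • c) v = s * pairing c v := by
  simp only [pairing_apply, Finset.mul_sum, Pi.smul_apply, smul_eq_mul]
  exact Finset.sum_congr rfl fun j _ => by
    rw [← mul_assoc, ← mul_assoc, commute_of_even hs]

theorem pairing_mem {i k : ZMod 2} {c v : σ ⊕ τ → A} (hv : IsHomog i v) (hc : IsHomog k c) :
    pairing c v ∈ part (A := A) (i + k) := by
  refine Submodule.sum_mem _ fun j _ => ?_
  have := mul_mem (hv j) (hc j)
  rwa [add_add_add_comm, CharTwo.add_self_eq_zero, add_zero] at this

/-- A basis `b` of `L` over `A[s⁻¹]` and linear forms `c` that restrict to the dual basis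
(denominators cleared). -/
structure IsFrame {r : ℕ} (s : evenPart A) (L : Submodule A (σ ⊕ τ → A))
    (b c : Fin r → σ ⊕ τ → A) : Prop where
  mem : ∀ k, b k ∈ L
  homog : ∀ k, IsHomog 0 (b k)
  homog_form : ∀ k, IsHomog 0 (c k)
  dual : ∀ k l, pairing (c l) (b k) = if k = l then (s : A) else 0
  expand : ∀ v ∈ L, (s : A) • v = ∑ k, pairing (c k) v • b k

/-- The forms `c` may be inhomogeneous: as the `b k` are even, comparing parities shows that the
even components of `c` are already dual to them. The denominator is squared because applying these
forms to `t v = ∑ a_l b_l` determines only the products `a_l t`. -/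
theorem isFrame_of_mem_span {r : ℕ} {t : evenPart A} {L : Submodule A (σ ⊕ τ → A)}
    {b c : Fin r → σ ⊕ τ → A} (mem : ∀ k, b k ∈ L) (homog : ∀ k, IsHomog 0 (b k))
    (dual : ∀ k l, pairing (c l) (b k) = if k = l then (t : A) else 0)
    (span : ∀ v ∈ L, (t : A) • v ∈ Submodule.span A (Set.range b)) :
    ∃ c', IsFrame (t * t) L b c' := by
  choose c₀ c₁ h₀ h₁ h using fun l => exists_homog_add (c l)
  have ht : (t : A) ∈ part (A := A) 0 := t.2
  have dual₀ : ∀ k l, pairing (c₀ l) (b k) = if k = l then (t : A) else 0 := by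
    intro k l
    refine eq_of_add_eq (i := 0) (a₁ := pairing (c₁ l) (b k)) (b₁ := 0)
      (by simpa using pairing_mem (homog k) (h₀ l)) (by simpa using pairing_mem (homog k) (h₁ l))
      ?_ (Submodule.zero_mem _) ?_
    · split_ifs
      · exact t.2
      · exact Submodule.zero_mem _
    · rw [← pairing_add, h, dual, add_zero]
  refine ⟨fun k => (t : A) • c₀ k, mem, homog, fun k => (h₀ k).even_smul ht, fun k l => ?_,
    fun v hv => ?_⟩
  · rw [pairing_even_smul ht, dual₀]
    split_ifs <;> simp
  · obtain ⟨a, ha⟩ := (Submodule.mem_span_range_iff_exists_fun A).1 (span v hv)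
    have hpa : ∀ l, (t : A) * pairing (c₀ l) v = a l * t := by
      intro l
      rw [← smul_eq_mul, ← map_smul, ← ha, map_sum]
      simp [dual₀]
    change ((t : A) * t) • v = _
    rw [mul_smul, ← ha, Finset.smul_sum]
    refine Finset.sum_congr rfl fun k _ => ?_
    rw [pairing_even_smul ht, hpa, smul_smul, commute_of_even ht]

/-- The even endomorphisms with image in `L` that are multiplication by `s` on `L`. -/
theorem IsFrame.exists_matrix {r : ℕ} {s : evenPart A} {L : Submodule A (σ ⊕ τ → A)}
    {b c : Fin r → σ ⊕ τ → A} (h : IsFrame s L b c) :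
    ∃ w : σ ⊕ τ → σ ⊕ τ → A, (∀ j, w j ∈ L ∧ IsHomog (par j) (w j)) ∧
      ∀ v ∈ L, (s : A) • v = ∑ j, v j • w j := by
  refine ⟨fun j => ∑ k, c k j • b k, fun j => ⟨L.sum_mem fun k _ => L.smul_mem _ (h.mem k),
    IsHomog.sum fun k _ => ?_⟩, fun v hv => ?_⟩
  · have := (h.homog k).smul (h.homog_form k j)
    simpa using this
  · rw [h.expand v hv]
    simp only [pairing_apply, Finset.sum_smul, Finset.smul_sum, mul_smul]
    exact Finset.sum_comm

/-- The scalars `s` admitting such a matrix form an ideal, since matrices can be added and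
multiplied by even elements. The ideal lies in no prime, so it contains `1`: local projections glue.
-/
theorem exists_projection {L : Submodule A (σ ⊕ τ → A)}
    (h : ∀ p : Ideal (evenPart A), p.IsPrime → ∃ s : evenPart A, s ∉ p ∧
      ∃ w : σ ⊕ τ → σ ⊕ τ → A, (∀ j, w j ∈ L ∧ IsHomog (par j) (w j)) ∧
        ∀ v ∈ L, (s : A) • v = ∑ j, v j • w j) :
    ∃ w : σ ⊕ τ → σ ⊕ τ → A, (∀ j, w j ∈ L ∧ IsHomog (par j) (w j)) ∧
      ∀ v ∈ L, v = ∑ j, v j • w j := by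
  let J : Ideal (evenPart A) :=
    { carrier := {s | ∃ w : σ ⊕ τ → σ ⊕ τ → A, (∀ j, w j ∈ L ∧ IsHomog (par j) (w j)) ∧
        ∀ v ∈ L, (s : A) • v = ∑ j, v j • w j}
      add_mem' := by
        rintro s t ⟨w, hw, h⟩ ⟨w', hw', h'⟩
        refine ⟨fun j => w j + w' j, fun j => ⟨L.add_mem (hw j).1 (hw' j).1,
          (hw j).2.add (hw' j).2⟩, fun v hv => ?_⟩
        simp only [smul_add, Finset.sum_add_distrib]
        rw [← h v hv, ← h' v hv, ← add_smul]
        rfl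
      zero_mem' := ⟨fun _ => 0, fun _ => ⟨L.zero_mem, IsHomog.zero⟩, fun v _ => by simp⟩
      smul_mem' := by
        rintro t s ⟨w, hw, h⟩
        refine ⟨fun j => (t : A) • w j, fun j => ⟨L.smul_mem _ (hw j).1,
          (hw j).2.even_smul t.2⟩, fun v hv => ?_⟩
        change ((t : A) * s) • v = _
        rw [mul_smul, h v hv, Finset.smul_sum]
        exact Finset.sum_congr rfl fun j _ => even_smul_comm t.2 _ _ }
  have hJ : (1 : evenPart A) ∈ J := by
    rw [ideal_eq_top_of_local (J := J) h]
    trivial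
  obtain ⟨w, hw, hv⟩ := hJ
  refine ⟨w, hw, fun v hvL => ?_⟩
  rw [← hv v hvL]
  exact (one_smul A v).symm

/-- The glued matrix defines a parity-preserving projection onto `L`. Its image and its kernel are
therefore graded, and the kernel is the complement sought. -/
theorem IsPoint.of_frames {r : ℕ} {L : Submodule A (σ ⊕ τ → A)}
    (h : ∀ p : Ideal (evenPart A), p.IsPrime → ∃ s : evenPart A, s ∉ p ∧
      ∃ b c : Fin r → σ ⊕ τ → A, IsFrame s L b c) : IsPoint r L := by
  obtain ⟨w, hw, hL⟩ := exists_projection (L := L) fun p hp => by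
    obtain ⟨s, hs, b, c, hbc⟩ := h p hp
    exact ⟨s, hs, hbc.exists_matrix⟩
  let π : (σ ⊕ τ → A) →ₗ[A] (σ ⊕ τ → A) := Fintype.linearCombination A w
  have hπ : ∀ v, π v = ∑ j, v j • w j := fun v => rfl
  have hπL : LinearMap.IsProj L π :=
    ⟨fun v => L.sum_mem fun j _ => L.smul_mem _ (hw j).1, fun v hv => (hL v hv).symm⟩
  have hhom : ∀ {i v}, IsHomog i v → IsHomog i (π v) := by
    intro i v hv
    refine IsHomog.sum fun j _ => ?_
    have := (hw j).2.smul (hv j)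
    rwa [add_assoc, CharTwo.add_self_eq_zero, add_zero] at this
  refine ⟨fun v hv => ?_, ⟨LinearMap.ker π, fun v hv => ?_, hπL.isCompl⟩, fun p hp => ?_⟩
  · obtain ⟨v₀, v₁, h₀, h₁, hadd⟩ := exists_homog_add v
    have h2 : π v₀ + π v₁ = v₀ + v₁ := by
      rw [← map_add, hadd]
      exact hπL.map_id v hv
    obtain ⟨e₀, e₁⟩ := homog_eq_of_add_eq (hhom h₀) (hhom h₁) h₀ h₁ h2
    exact ⟨v₀, e₀ ▸ hπL.map_mem _, v₁, e₁ ▸ hπL.map_mem _, h₀, h₁, hadd⟩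
  · obtain ⟨v₀, v₁, h₀, h₁, hadd⟩ := exists_homog_add v
    have h2 : π v₀ + π v₁ = 0 + 0 := by
      rw [← map_add, hadd, LinearMap.mem_ker.1 hv, add_zero]
    obtain ⟨e₀, e₁⟩ := homog_eq_of_add_eq (hhom h₀) (hhom h₁) IsHomog.zero IsHomog.zero h2
    exact ⟨v₀, e₀, v₁, e₁, h₀, h₁, hadd⟩
  · obtain ⟨s, hs, b, c, hbc⟩ := h p hp
    refine ⟨b, fun k => ⟨hbc.mem k, hbc.homog k⟩, fun v hv => ⟨s, hs, ?_⟩, fun a ha => ⟨s, hs, ?_⟩⟩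
    · rw [hbc.expand v hv]
      exact Submodule.sum_mem _ fun k _ => Submodule.smul_mem _ _ (Submodule.subset_span ⟨k, rfl⟩)
    · intro l
      have h0 := congrArg (pairing (c l)) ha
      rw [map_sum, map_zero] at h0
      rw [commute_of_even s.2]
      simpa [hbc.dual] using h0

/-- The complement extends local coordinates on `L` to the whole space: the projections of the
standard basis vectors are expanded in the local basis, and their coefficients `x` define forms that
expand every `v ∈ L`. Local independence makes these forms dual to the basis after one more
denominator. -/
theorem IsPoint.exists_frame {r : ℕ} {L : Submodule A (σ ⊕ τ → A)} (hL : IsPoint r L)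
    (p : Ideal (evenPart A)) (hp : p.IsPrime) :
    ∃ s : evenPart A, s ∉ p ∧ ∃ b c : Fin r → σ ⊕ τ → A, IsFrame s L b c := by
  classical
  obtain ⟨L', -, hc⟩ := hL.summand
  obtain ⟨b, hb, hspan, hind⟩ := hL.rank p hp
  let π : (σ ⊕ τ → A) →ₗ[A] (σ ⊕ τ → A) := Submodule.projection L L' hc
  have hπ : ∀ v, π v ∈ L := fun v => by
    simp [π]
  have hπL : ∀ v ∈ L, π v = v := fun v hv =>
    (Submodule.projection_eq_self_iff hc v).2 hv
  choose t ht htb using fun j : σ ⊕ τ => hspan (π (Pi.single j 1)) (hπ _)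
  let s : evenPart A := ∏ j, t j
  have hs : s ∉ p := fun h => by
    obtain ⟨j, -, hj⟩ := (Ideal.IsPrime.prod_mem_iff).1 h
    exact ht j hj
  have hsb : ∀ j, (s : A) • π (Pi.single j 1) ∈ Submodule.span A (Set.range b) := by
    intro j
    have : s = (∏ k ∈ Finset.univ.erase j, t k) * t j := by
      rw [Finset.prod_erase_mul _ _ (Finset.mem_univ j)]
    rw [this]
    change (((∏ k ∈ Finset.univ.erase j, t k : evenPart A) : A) * (t j : A)) • _ ∈ _
    rw [mul_smul]
    exact Submodule.smul_mem _ _ (htb j)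
  choose x hx using fun j => (Submodule.mem_span_range_iff_exists_fun A).1 (hsb j)
  have hexp : ∀ v ∈ L, (s : A) • v = ∑ k, pairing (fun j => x j k) v • b k := by
    intro v hv
    have h1 : v = ∑ j, v j • π (Pi.single j 1) := by
      conv_lhs => rw [← hπL v hv, pi_eq_sum_univ' v, map_sum]
      refine Finset.sum_congr rfl fun j _ => ?_
      rw [map_smul]
    conv_lhs => rw [h1, Finset.smul_sum]
    simp only [pairing_apply, Finset.sum_smul, mul_smul]
    rw [Finset.sum_comm]
    refine Finset.sum_congr rfl fun j _ => ?_
    rw [even_smul_comm s.2, ← hx j, Finset.smul_sum]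
  -- Expanding `s • b k` by these forms is a linear relation among the `b l`.
  have hrel : ∀ k, ∃ s' : evenPart A, s' ∉ p ∧ ∀ l,
      (s' : A) * (pairing (fun j => x j l) (b k) - if k = l then (s : A) else 0) = 0 := by
    intro k
    refine hind _ ?_
    simp only [sub_smul, Finset.sum_sub_distrib]
    rw [← hexp _ (hb k).1]
    simp
  choose s' hs' hrel using hrel
  let u : evenPart A := ∏ k, s' k
  have hu : u ∉ p := fun h => by
    obtain ⟨j, -, hj⟩ := (Ideal.IsPrime.prod_mem_iff).1 h
    exact hs' j hj
  have hus : u * s ∉ p := fun h => (hp.mem_or_mem h).elim hu hs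
  obtain ⟨c, hc⟩ := isFrame_of_mem_span (t := u * s) (L := L) (b := b)
    (c := fun k => (u : A) • fun j => x j k) (fun k => (hb k).1) (fun k => (hb k).2)
    (fun k l => by
      have hul : u = (∏ i ∈ Finset.univ.erase k, s' i) * s' k := by
        rw [Finset.prod_erase_mul _ _ (Finset.mem_univ k)]
      have : (u : A) * (pairing (fun j => x j l) (b k) - if k = l then (s : A) else 0) = 0 := by
        rw [hul]
        change (((∏ k ∈ Finset.univ.erase k, s' k : evenPart A) : A) * (s' k : A)) * _ = _
        rw [mul_assoc, hrel, mul_zero]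
      rw [pairing_even_smul u.2]
      rw [mul_sub, sub_eq_zero] at this
      rw [this]
      split_ifs
      · rfl
      · rw [mul_zero])
    (fun v hv => by
      change ((u : A) * s) • v ∈ _
      rw [mul_smul, hexp v hv]
      exact Submodule.smul_mem _ _ (Submodule.sum_mem _ fun k _ =>
        Submodule.smul_mem _ _ (Submodule.subset_span ⟨k, rfl⟩)))
  exact ⟨_, fun h => (hp.mem_or_mem h).elim hus hus, b, c, hc⟩

end Frames

/-! ### Base change -/

section BaseChange

variable {A B : Type*} [Ring A] [Algebra ℂ A] [SuperAlgebra A] [Ring B] [Algebra ℂ B]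
  [SuperAlgebra B] (φ : SuperHom A B) {σ τ : Type*}

/-- The map induced on even parts. -/
def SuperHom.even : evenPart A →+* evenPart B where
  toFun a := ⟨φ.toAlgHom a, φ.map_part 0 a a.2⟩
  map_one' := Subtype.ext (map_one φ.toAlgHom)
  map_zero' := Subtype.ext (map_zero φ.toAlgHom)
  map_mul' a b := Subtype.ext (map_mul φ.toAlgHom (a : A) b)
  map_add' a b := Subtype.ext (map_add φ.toAlgHom (a : A) b)

/-- The map induced on vectors. -/
def SuperHom.vec (v : σ ⊕ τ → A) : σ ⊕ τ → B := fun j => φ.toAlgHom (v j)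

theorem SuperHom.vec_homog {i : ZMod 2} {v : σ ⊕ τ → A} (hv : IsHomog i v) :
    IsHomog i (φ.vec v) := fun j => φ.map_part _ _ (hv j)

theorem SuperHom.vec_smul (a : A) (v : σ ⊕ τ → A) : φ.vec (a • v) = φ.toAlgHom a • φ.vec v :=
  funext fun j => map_mul φ.toAlgHom a (v j)

theorem SuperHom.vec_sum {κ : Type*} (s : Finset κ) (v : κ → σ ⊕ τ → A) :
    φ.vec (∑ k ∈ s, v k) = ∑ k ∈ s, φ.vec (v k) := by
  ext j
  simp [SuperHom.vec]

theorem mem_baseChange {L : Submodule A (σ ⊕ τ → A)} {v : σ ⊕ τ → A} (hv : v ∈ L) :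
    φ.vec v ∈ baseChange φ L := Submodule.subset_span ⟨v, hv, rfl⟩

theorem IsFrame.baseChange [Fintype σ] [Fintype τ] {r : ℕ} {s : evenPart A}
    {L : Submodule A (σ ⊕ τ → A)} {b c : Fin r → σ ⊕ τ → A} (h : IsFrame s L b c) :
    IsFrame (φ.even s) (baseChange φ L) (fun k => φ.vec (b k)) (fun k => φ.vec (c k)) := by
  have hpair : ∀ c v : σ ⊕ τ → A, pairing (φ.vec c) (φ.vec v) = φ.toAlgHom (pairing c v) := by
    intro c v
    simp [pairing_apply, SuperHom.vec]
  refine ⟨fun k => mem_baseChange φ (h.mem k), fun k => φ.vec_homog (h.homog k),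
    fun k => φ.vec_homog (h.homog_form k), fun k l => ?_, fun v hv => ?_⟩
  · rw [hpair, h.dual]
    split_ifs
    · rfl
    · exact map_zero _
  · induction hv using Submodule.span_induction with
    | zero => simp
    | add x y _ _ hx hy => simp only [smul_add, map_add, add_smul, Finset.sum_add_distrib, hx, hy]
    | smul a x _ hx =>
      rw [even_smul_comm (φ.even s).2, hx, Finset.smul_sum]
      simp only [map_smul, smul_smul, smul_eq_mul]
    | mem x hx =>
      obtain ⟨v, hv, rfl⟩ := hx
      change φ.toAlgHom s • φ.vec v = ∑ k, pairing (φ.vec (c k)) (φ.vec v) • φ.vec (b k)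
      rw [← φ.vec_smul, h.expand v hv, φ.vec_sum]
      simp only [φ.vec_smul, hpair]

/-- A prime of the even part of `B` is pulled back to `A`; the image of a denominator outside the
pullback is outside the prime. -/
theorem IsPoint.baseChange [Fintype σ] [Fintype τ] {r : ℕ} {L : Submodule A (σ ⊕ τ → A)}
    (hL : IsPoint r L) : IsPoint r (baseChange φ L) := by
  refine IsPoint.of_frames fun p hp => ?_
  obtain ⟨s, hs, b, c, h⟩ := hL.exists_frame (p.comap φ.even) (Ideal.IsPrime.comap _)
  exact ⟨φ.even s, hs, _, _, h.baseChange φ⟩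

end BaseChange

end SuperGr

/-! ### The super Plücker map: compatibility with frames, injectivity and naturality. -/

namespace SuperGr

open SuperAlgebra

/-! ### The wedge product -/

instance : Fintype EvenIdx where
  elems := ⟨↑[EvenIdx.q 0 1 (by decide), .q 0 2 (by decide), .q 0 3 (by decide),
    .q 1 2 (by decide), .q 1 3 (by decide), .q 2 3 (by decide), .a55], by simp⟩
  complete := by
    rintro (⟨i, j, h⟩ | _)
    · fin_cases i <;> fin_cases j <;> first | exact absurd h (by decide) | simp
    · simp

theorem sum_evenIdx {M : Type*} [AddCommMonoid M] (f : EvenIdx → M) :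
    ∑ e, f e = f (.q 0 1 (by decide)) + f (.q 0 2 (by decide)) + f (.q 0 3 (by decide)) +
      f (.q 1 2 (by decide)) + f (.q 1 3 (by decide)) + f (.q 2 3 (by decide)) + f .a55 := by
  change (Multiset.map f ((_ :: _ :: _ :: _ :: _ :: _ :: [_] : List EvenIdx) : Multiset EvenIdx)).sum = _
  simp [add_assoc]

section Coordinates

variable {A : Type*} [Ring A] [Algebra ℂ A] [SuperAlgebra A] {σ τ : Type}

/-- The even coordinates of an even vector. -/
def IsHomog.evenCoord {v : σ ⊕ τ → A} (hv : IsHomog 0 v) (i : σ) : evenPart A :=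
  ⟨v (.inl i), SPoly.inl_mem hv i⟩

@[simp] theorem IsHomog.coe_evenCoord {v : σ ⊕ τ → A} (hv : IsHomog 0 v) (i : σ) :
    (hv.evenCoord i : A) = v (.inl i) := rfl

/-- The product of two odd elements, as an element of the even part. -/
def oddMul {x y : A} (hx : x ∈ part (A := A) 1) (hy : y ∈ part (A := A) 1) : evenPart A :=
  ⟨x * y, by have := mul_mem hx hy; exact this⟩

@[simp] theorem coe_oddMul {x y : A} (hx : x ∈ part (A := A) 1) (hy : y ∈ part (A := A) 1) :
    (oddMul hx hy : A) = x * y := rfl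

theorem even_mul_mul_even_mul (x y : evenPart A) (p q : A) :
    ((x : A) * p) * (y * q) = (x * y : A) * (p * q) := by
  rw [mul_assoc, ← mul_assoc p, ← commute_of_even y.2 p, mul_assoc, mul_assoc]

/-- This absorbs the signs in `wedge`: for even `a`, the coordinates of `wedge a b` can be written
with those of `b` on the left, and are then visibly linear in `b`. -/
theorem odd_mul_sigma {x : A} (hx : x ∈ part (A := A) 1) (y : A) : x * sigma A y = y * x := by
  obtain ⟨y₀, h₀, y₁, h₁, rfl⟩ := exists_add y
  rw [map_add, sigma_even h₀, sigma_odd h₁, mul_add, add_mul, mul_neg, odd_mul_odd h₁ hx,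
    even_mul h₀ hx]

theorem sigma_even_mul {s : A} (hs : s ∈ part (A := A) 0) (y : A) :
    sigma A (s * y) = s * sigma A y := by
  obtain ⟨y₀, h₀, y₁, h₁, rfl⟩ := exists_add y
  have e₀ : s * y₀ ∈ part (A := A) 0 := even_smul_mem hs h₀
  have e₁ : s * y₁ ∈ part (A := A) 1 := even_smul_mem hs h₁
  simp only [mul_add, map_add, sigma_even h₀, sigma_odd h₁, sigma_even e₀, sigma_odd e₁, mul_neg]

end Coordinates

/-! ### Contractions -/

section Contraction

variable {A : Type*} [Ring A]

/-- The antisymmetric array `q_ij` of a vector of `∧² A^{4|1}`. -/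
def skew (m : EvenIdx ⊕ Fin 4 → A) (i j : Fin 4) : A :=
  if h : i < j then m (.inl (.q i j h)) else if h : j < i then -m (.inl (.q j i h)) else 0

/-- Contraction of an element of `∧² A^{4|1}` with a coordinate function of `A^{4|1}`: it maps
`a ∧ b` to `a_j b - b_j a` if `a`, `b` are even. -/
def contraction : Fin 4 ⊕ Fin 1 → (EvenIdx ⊕ Fin 4 → A) →ₗ[A] (Fin 4 ⊕ Fin 1 → A)
  | .inl i =>
    { toFun := fun m => Sum.elim (skew m i) fun _ => m (.inr i)
      map_add' := fun m m' => by
        funext j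
        rcases j with j | j
        · change skew (m + m') i j = skew m i j + skew m' i j
          unfold skew
          split_ifs
          · rfl
          · exact neg_add _ _
          · exact (add_zero _).symm
        · rfl
      map_smul' := fun a m => by
        funext j
        rcases j with j | j
        · change skew (a • m) i j = a * skew m i j
          unfold skew
          split_ifs
          · rfl
          · exact (mul_neg _ _).symm
          · exact (mul_zero _).symm
        · rfl }
  | .inr _ =>
    { toFun := fun m => Sum.elim (fun j => -m (.inr j)) fun _ => m (.inl .a55) + m (.inl .a55)
      map_add' := fun m m' => by
        funext j
        rcases j with j | j
        · exact neg_add _ _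
        · exact add_add_add_comm _ _ _ _
      map_smul' := fun a m => by
        funext j
        rcases j with j | j
        · exact (mul_neg _ _).symm
        · exact (mul_add _ _ _).symm }

/-- The submodule of `A^{4|1}` spanned by the contractions of the elements of `M`. -/
def contractionSpan (M : Submodule A (EvenIdx ⊕ Fin 4 → A)) :
    Submodule A (Fin 4 ⊕ Fin 1 → A) :=
  ⨆ j, M.map (contraction j)

theorem contraction_mem {M : Submodule A (EvenIdx ⊕ Fin 4 → A)} {m : EvenIdx ⊕ Fin 4 → A}
    (hm : m ∈ M) (j : Fin 4 ⊕ Fin 1) : contraction j m ∈ contractionSpan M :=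
  Submodule.mem_iSup_of_mem j (Submodule.mem_map_of_mem hm)

end Contraction

section WedgeLemmas

variable {A : Type*} [Ring A] [Algebra ℂ A] [SuperAlgebra A]

theorem wedge_add_left (u u' w : Fin 4 ⊕ Fin 1 → A) :
    wedge (u + u') w = wedge u w + wedge u' w := by
  funext j
  rcases j with (⟨i, j, h⟩ | _) | i <;> simp only [wedge, Pi.add_apply, add_mul] <;> abel

theorem wedge_smul_left (a : A) (u w : Fin 4 ⊕ Fin 1 → A) :
    wedge (a • u) w = a • wedge u w := by
  funext j
  rcases j with (⟨i, j, h⟩ | _) | i <;>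
    simp only [wedge, Pi.smul_apply, smul_eq_mul, mul_sub, mul_neg, mul_assoc]

theorem wedge_add_right (u w w' : Fin 4 ⊕ Fin 1 → A) :
    wedge u (w + w') = wedge u w + wedge u w' := by
  funext j
  rcases j with (⟨i, j, h⟩ | _) | i <;>
    simp only [wedge, Pi.add_apply, mul_add, map_add] <;> abel

theorem wedge_even_smul_right {s : A} (hs : s ∈ part (A := A) 0) (u w : Fin 4 ⊕ Fin 1 → A) :
    wedge u (s • w) = s • wedge u w := by
  have hcomm : ∀ x y : A, x * (s * y) = s * (x * y) := fun x y => by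
    rw [← mul_assoc, ← commute_of_even hs, mul_assoc]
  funext j
  rcases j with (⟨i, j, h⟩ | _) | i <;>
    simp only [wedge, Pi.smul_apply, smul_eq_mul, sigma_even_mul hs, mul_sub, mul_neg, hcomm]

theorem wedge_q {a : Fin 4 ⊕ Fin 1 → A} (ha : IsHomog 0 a) (b : Fin 4 ⊕ Fin 1 → A)
    (i j : Fin 4) (h : i < j) :
    wedge a b (.inl (.q i j h)) = b (.inl j) * a (.inl i) - b (.inl i) * a (.inl j) := by
  rw [wedge, commute_of_even (SPoly.inl_mem ha i), commute_of_even (SPoly.inl_mem ha j)]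

theorem wedge_a55 {a : Fin 4 ⊕ Fin 1 → A} (ha : IsHomog 0 a) (b : Fin 4 ⊕ Fin 1 → A) :
    wedge a b (.inl .a55) = -(b (.inr 0) * a (.inr 0)) := by
  rw [wedge, odd_mul_sigma (SPoly.inr_mem ha 0)]

theorem wedge_lam {a : Fin 4 ⊕ Fin 1 → A} (ha : IsHomog 0 a) (b : Fin 4 ⊕ Fin 1 → A)
    (i : Fin 4) :
    wedge a b (.inr i) = b (.inr 0) * a (.inl i) - b (.inl i) * a (.inr 0) := by
  rw [wedge, odd_mul_sigma (SPoly.inr_mem ha 0), commute_of_even (SPoly.inl_mem ha i)]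

theorem wedge_smul_right {a : Fin 4 ⊕ Fin 1 → A} (ha : IsHomog 0 a) (x : A)
    (b : Fin 4 ⊕ Fin 1 → A) : wedge a (x • b) = x • wedge a b := by
  funext j
  rcases j with (⟨i, j, h⟩ | _) | i
  · simp only [Pi.smul_apply, wedge_q ha, smul_eq_mul, mul_sub, mul_assoc]
  · simp only [Pi.smul_apply, wedge_a55 ha, smul_eq_mul, mul_neg, mul_assoc]
  · simp only [Pi.smul_apply, wedge_lam ha, smul_eq_mul, mul_sub, mul_assoc]

theorem wedge_self {a : Fin 4 ⊕ Fin 1 → A} (ha : IsHomog 0 a) : wedge a a = 0 := by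
  funext j
  rcases j with (⟨i, j, h⟩ | _) | i
  · rw [wedge_q ha, commute_of_even (SPoly.inl_mem ha i), sub_self, Pi.zero_apply]
  · rw [wedge_a55 ha, odd_mul_self (SPoly.inr_mem ha 0), neg_zero, Pi.zero_apply]
  · rw [wedge_lam ha, commute_of_even (SPoly.inl_mem ha i), sub_self, Pi.zero_apply]

theorem wedge_swap {a b : Fin 4 ⊕ Fin 1 → A} (ha : IsHomog 0 a) (hb : IsHomog 0 b) :
    wedge b a = -wedge a b := by
  have h := wedge_self (ha.add hb)
  rw [wedge_add_left, wedge_add_right, wedge_add_right, wedge_self ha, wedge_self hb, zero_add,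
    add_zero] at h
  exact eq_neg_of_add_eq_zero_right h

theorem wedge_homog {a b : Fin 4 ⊕ Fin 1 → A} (ha : IsHomog 0 a) (hb : IsHomog 0 b) :
    IsHomog 0 (wedge a b) := by
  have ha0 := SPoly.inl_mem ha
  have hb0 := SPoly.inl_mem hb
  have ha1 := SPoly.inr_mem ha 0
  have hb1 := SPoly.inr_mem hb 0
  rintro ((⟨i, j, h⟩ | _) | i)
  · rw [wedge_q ha]
    exact Submodule.sub_mem _ (even_smul_mem (hb0 _) (ha0 _)) (even_smul_mem (hb0 _) (ha0 _))
  · rw [wedge_a55 ha]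
    exact Submodule.neg_mem _ (oddMul hb1 ha1).2
  · rw [wedge_lam ha, ← commute_of_even (ha0 i)]
    exact Submodule.sub_mem _ (even_smul_mem (ha0 _) hb1) (even_smul_mem (hb0 _) ha1)

theorem wedge_mem {L : Submodule A (Fin 4 ⊕ Fin 1 → A)} {u w : Fin 4 ⊕ Fin 1 → A} (hu : u ∈ L)
    (hw : w ∈ L) : wedge u w ∈ wedgeSq L := Submodule.subset_span ⟨u, hu, w, hw, rfl⟩

/-- The linear form `u ∧ w ↦ c(u) d(w) - c(w) d(u)`. -/
def wedgeForm (c d : Fin 4 ⊕ Fin 1 → A) : EvenIdx ⊕ Fin 4 → A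
  | .inl (.q i j _) => c (.inl i) * d (.inl j) - c (.inl j) * d (.inl i)
  | .inl .a55 => -(c (.inr 0) * d (.inr 0) + c (.inr 0) * d (.inr 0))
  | .inr i => c (.inl i) * d (.inr 0) - d (.inl i) * c (.inr 0)

/-- A super Cauchy–Binet formula. For odd coordinates `α, β, γ, δ` one has `(αγ)(βδ) = -αβγδ` and
`(βγ)(αδ) = αβγδ`; the difference `-2αβγδ` accounts for the doubled negative entry of `wedgeForm` at
`a55`. All other terms are identities among commuting even elements. -/
theorem pairing_wedgeForm {a b c d : Fin 4 ⊕ Fin 1 → A} (ha : IsHomog 0 a) (hb : IsHomog 0 b)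
    (hc : IsHomog 0 c) (hd : IsHomog 0 d) :
    pairing (wedgeForm c d) (wedge a b) =
      pairing c a * pairing d b - pairing c b * pairing d a := by
  have hα := SPoly.inr_mem ha 0
  have hβ := SPoly.inr_mem hb 0
  have hγ := SPoly.inr_mem hc 0
  have hδ := SPoly.inr_mem hd 0
  have hpair : ∀ {v c : Fin 4 ⊕ Fin 1 → A} (hv : IsHomog 0 v) (hc : IsHomog 0 c),
      pairing c v = ((∑ i, hv.evenCoord i * hc.evenCoord i +
        oddMul (SPoly.inr_mem hv 0) (SPoly.inr_mem hc 0) : evenPart A) : A) := by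
    intro v c hv hc
    rw [pairing_apply, Fintype.sum_sum_type]
    simp
  have h1 : oddMul hα hγ * oddMul hβ hδ = -(oddMul hα hβ * oddMul hγ hδ) := Subtype.ext (by
    change a (.inr 0) * c (.inr 0) * (b (.inr 0) * d (.inr 0)) =
      -(a (.inr 0) * b (.inr 0) * (c (.inr 0) * d (.inr 0)))
    rw [mul_assoc, ← mul_assoc (c (.inr 0)), odd_mul_odd hγ hβ]
    simp only [neg_mul, mul_neg, mul_assoc])
  have h2 : oddMul hβ hγ * oddMul hα hδ = oddMul hα hβ * oddMul hγ hδ := Subtype.ext (by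
    change b (.inr 0) * c (.inr 0) * (a (.inr 0) * d (.inr 0)) =
      (a (.inr 0) * b (.inr 0) * (c (.inr 0) * d (.inr 0)))
    rw [mul_assoc, ← mul_assoc (c (.inr 0)), odd_mul_odd hγ hα, odd_mul_odd hα hβ]
    simp only [neg_mul, mul_neg, ← mul_assoc])
  have hlam : ∀ i, wedge a b (.inr i) * wedgeForm c d (.inr i) =
      ((ha.evenCoord i * hc.evenCoord i * oddMul hβ hδ
        - ha.evenCoord i * hd.evenCoord i * oddMul hβ hγ
        - hb.evenCoord i * hc.evenCoord i * oddMul hα hδ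
        + hb.evenCoord i * hd.evenCoord i * oddMul hα hγ : evenPart A) : A) := by
    intro i
    rw [wedge_lam ha, wedgeForm, ← commute_of_even (SPoly.inl_mem ha i)]
    have e := even_mul_mul_even_mul (A := A)
    simp only [sub_mul, mul_sub, Subalgebra.coe_add, Subalgebra.coe_sub, Subalgebra.coe_mul,
      coe_oddMul, ← e]
    simp only [IsHomog.coe_evenCoord]
    abel
  have hq : ∀ i j h, wedge a b (.inl (.q i j h)) * wedgeForm c d (.inl (.q i j h)) =
      (((ha.evenCoord i * hb.evenCoord j - ha.evenCoord j * hb.evenCoord i) *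
        (hc.evenCoord i * hd.evenCoord j - hc.evenCoord j * hd.evenCoord i) : evenPart A) : A) :=
    fun i j h => rfl
  have ha55 : wedge a b (.inl .a55) * wedgeForm c d (.inl .a55) =
      ((oddMul hα hβ * -(oddMul hγ hδ + oddMul hγ hδ) : evenPart A) : A) := by
    rw [wedge_a55 ha, ← odd_mul_odd hα hβ]
    rfl
  rw [hpair ha hc, hpair hb hd, hpair hb hc, hpair ha hd, pairing_apply, Fintype.sum_sum_type,
    sum_evenIdx]
  simp only [hlam, hq, ha55, Fin.sum_univ_four, ← Subalgebra.coe_add, ← Subalgebra.coe_sub,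
    ← Subalgebra.coe_mul]
  congr 1
  linear_combination h2 - h1

/-- One factor `s` expands each argument of the wedge; the diagonal terms vanish. -/
theorem smul_wedgeSq_mem {s : evenPart A} {L : Submodule A (Fin 4 ⊕ Fin 1 → A)}
    {b c : Fin 2 → Fin 4 ⊕ Fin 1 → A} (h : IsFrame s L b c) {z : EvenIdx ⊕ Fin 4 → A}
    (hz : z ∈ wedgeSq L) :
    ((s * s : evenPart A) : A) • z ∈ Submodule.span A {wedge (b 0) (b 1)} := by
  induction hz using Submodule.span_induction with
  | zero => simp
  | add x y _ _ hx hy => rw [smul_add]; exact Submodule.add_mem _ hx hy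
  | smul a x _ hx => rw [even_smul_comm (s * s).2]; exact Submodule.smul_mem _ _ hx
  | mem x hx =>
    obtain ⟨u, hu, w, hw, rfl⟩ := hx
    rw [Subalgebra.coe_mul, mul_smul, ← wedge_even_smul_right s.2, ← wedge_smul_left,
      h.expand u hu, h.expand w hw]
    simp only [Fin.sum_univ_two, wedge_add_left, wedge_smul_left, wedge_add_right,
      wedge_smul_right (h.homog _), wedge_self (h.homog _), smul_zero, zero_add, add_zero,
      wedge_swap (h.homog 0) (h.homog 1), smul_neg]
    have hm := Submodule.mem_span_singleton_self (R := A) (wedge (b 0) (b 1))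
    exact Submodule.add_mem _ (Submodule.neg_mem _ (Submodule.smul_mem _ _
      (Submodule.smul_mem _ _ hm))) (Submodule.smul_mem _ _ (Submodule.smul_mem _ _ hm))

/-- The form built from `c 0` and `c 1` takes the value `s * s` on `wedge (b 0) (b 1)`;
`isFrame_of_mem_span` squares this denominator. -/
theorem IsFrame.wedgeSq {s : evenPart A} {L : Submodule A (Fin 4 ⊕ Fin 1 → A)}
    {b c : Fin 2 → Fin 4 ⊕ Fin 1 → A} (h : IsFrame s L b c) :
    ∃ c', IsFrame (s * s * (s * s)) (wedgeSq L) (fun _ : Fin 1 => wedge (b 0) (b 1)) c' := by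
  refine isFrame_of_mem_span (c := fun _ => wedgeForm (c 0) (c 1))
    (fun _ => wedge_mem (h.mem 0) (h.mem 1)) (fun _ => wedge_homog (h.homog 0) (h.homog 1))
    (fun k l => ?_) (fun v hv => ?_)
  · rw [if_pos (Subsingleton.elim k l), pairing_wedgeForm (h.homog 0) (h.homog 1)
      (h.homog_form 0) (h.homog_form 1)]
    simp [h.dual]
  · rw [Set.range_const]
    exact smul_wedgeSq_mem h hv

theorem IsPoint.wedgeSq {L : Submodule A (Fin 4 ⊕ Fin 1 → A)} (hL : IsPoint 2 L) :
    IsPoint 1 (wedgeSq L) := by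
  refine IsPoint.of_frames fun p hp => ?_
  obtain ⟨s, hs, b, c, h⟩ := hL.exists_frame p hp
  obtain ⟨c', h'⟩ := h.wedgeSq
  have hss : s * s ∉ p := fun h => (hp.mem_or_mem h).elim hs hs
  exact ⟨_, fun h => (hp.mem_or_mem h).elim hss hss, _, c', h'⟩

theorem skew_wedge {a : Fin 4 ⊕ Fin 1 → A} (ha : IsHomog 0 a) (b : Fin 4 ⊕ Fin 1 → A)
    (i j : Fin 4) :
    skew (wedge a b) i j = a (.inl i) * b (.inl j) - b (.inl i) * a (.inl j) := by
  unfold skew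
  split_ifs with h h'
  · rw [wedge, commute_of_even (SPoly.inl_mem ha j)]
  · rw [wedge, commute_of_even (SPoly.inl_mem ha j), neg_sub]
  · obtain rfl : i = j := le_antisymm (not_lt.1 h') (not_lt.1 h)
    rw [commute_of_even (SPoly.inl_mem ha i), sub_self]

theorem contraction_wedge {a b : Fin 4 ⊕ Fin 1 → A} (ha : IsHomog 0 a) (hb : IsHomog 0 b)
    (j : Fin 4 ⊕ Fin 1) : contraction j (wedge a b) = a j • b - b j • a := by
  funext k
  rcases j with i | j <;> rcases k with k | k
  · exact skew_wedge ha b i k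
  · obtain rfl := Subsingleton.elim k 0
    change wedge a b (.inr i) = a (.inl i) * b (.inr 0) - b (.inl i) * a (.inr 0)
    rw [wedge_lam ha, commute_of_even (SPoly.inl_mem ha i)]
  · obtain rfl := Subsingleton.elim j 0
    change -wedge a b (.inr k) = a (.inr 0) * b (.inl k) - b (.inr 0) * a (.inl k)
    rw [wedge_lam ha, neg_sub, commute_of_even (SPoly.inl_mem hb k)]
  · obtain rfl := Subsingleton.elim j 0
    obtain rfl := Subsingleton.elim k 0
    -- For odd `α`, `β` the difference `αβ - βα` is `2αβ`, which is why the odd contraction doubles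
    -- `a_55`.
    change wedge a b (.inl .a55) + wedge a b (.inl .a55) =
      a (.inr 0) * b (.inr 0) - b (.inr 0) * a (.inr 0)
    rw [wedge_a55 ha, ← odd_mul_odd (SPoly.inr_mem ha 0) (SPoly.inr_mem hb 0),
      sub_eq_add_neg, ← odd_mul_odd (SPoly.inr_mem ha 0) (SPoly.inr_mem hb 0)]

/-- Up to signs, `c(a) b - c(b) a` is a combination of the contractions of `a ∧ b`. -/
theorem pairing_smul_sub_mem {a b c : Fin 4 ⊕ Fin 1 → A} (ha : IsHomog 0 a) (hb : IsHomog 0 b)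
    (hc : IsHomog 0 c) {L : Submodule A (Fin 4 ⊕ Fin 1 → A)}
    (hL : ∀ j, contraction j (wedge a b) ∈ L) : pairing c a • b - pairing c b • a ∈ L := by
  rw [pairing_apply, pairing_apply, Finset.sum_smul, Finset.sum_smul, ← Finset.sum_sub_distrib]
  refine L.sum_mem fun j _ => ?_
  have h := hL j
  rw [contraction_wedge ha hb] at h
  rcases j with j | j
  · rw [commute_of_even (SPoly.inl_mem ha j), commute_of_even (SPoly.inl_mem hb j), mul_smul,
      mul_smul, ← smul_sub]
    exact L.smul_mem _ h
  · rw [odd_mul_odd (SPoly.inr_mem ha j) (SPoly.inr_mem hc j),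
      odd_mul_odd (SPoly.inr_mem hb j) (SPoly.inr_mem hc j), neg_smul, neg_smul, mul_smul,
      mul_smul, ← neg_sub', ← smul_sub]
    exact L.neg_mem (L.smul_mem _ h)

/-- Injectivity of the Plücker map. The dual forms recover the frame from contractions of `b 0 ∧ b
1`: `c 0` yields `s b_1`, and `c 1` yields `-s b_0`. A second factor `s` expands the given vector of
`L`. -/
theorem contractionSpan_wedgeSq {L : Submodule A (Fin 4 ⊕ Fin 1 → A)} (hL : IsPoint 2 L) :
    contractionSpan (wedgeSq L) = L := by
  apply le_antisymm
  · refine iSup_le fun j => ?_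
    rintro _ ⟨m, hm, rfl⟩
    refine mem_of_local fun p hp => ?_
    obtain ⟨s, hs, b, c, h⟩ := hL.exists_frame p hp
    refine ⟨s * s, fun h => (hp.mem_or_mem h).elim hs hs, ?_⟩
    obtain ⟨x, hx⟩ := Submodule.mem_span_singleton.1 (smul_wedgeSq_mem h hm)
    rw [← map_smul, ← hx, map_smul, contraction_wedge (h.homog 0) (h.homog 1)]
    exact L.smul_mem _ (L.sub_mem (L.smul_mem _ (h.mem 1)) (L.smul_mem _ (h.mem 0)))
  · intro v hv
    refine mem_of_local fun p hp => ?_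
    obtain ⟨s, hs, b, c, h⟩ := hL.exists_frame p hp
    refine ⟨s * s, fun h => (hp.mem_or_mem h).elim hs hs, ?_⟩
    have hmem := fun k => pairing_smul_sub_mem (h.homog 0) (h.homog 1) (h.homog_form k)
      (L := contractionSpan (SuperGr.wedgeSq L))
      fun j => contraction_mem (wedge_mem (h.mem 0) (h.mem 1)) j
    have h1 := hmem 0
    have h0 := hmem 1
    simp only [h.dual, Fin.isValue, if_true, one_ne_zero, zero_ne_one, if_false, zero_smul,
      sub_zero, zero_sub] at h0 h1
    rw [Subalgebra.coe_mul, mul_smul, h.expand v hv, Finset.smul_sum]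
    refine Submodule.sum_mem _ fun k _ => ?_
    rw [even_smul_comm s.2]
    refine Submodule.smul_mem _ _ ?_
    fin_cases k
    · simpa using Submodule.neg_mem _ h0
    · exact h1

/-! ### Naturality -/

theorem SuperHom.vec_wedge {B : Type*} [Ring B] [Algebra ℂ B] [SuperAlgebra B] (φ : SuperHom A B)
    {a b : Fin 4 ⊕ Fin 1 → A} (ha : IsHomog 0 a) :
    φ.vec (wedge a b) = wedge (φ.vec a) (φ.vec b) := by
  funext j
  rcases j with (⟨i, j, h⟩ | _) | i
  · rw [wedge_q (φ.vec_homog ha), SuperHom.vec, wedge_q ha]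
    simp [SuperHom.vec]
  · rw [wedge_a55 (φ.vec_homog ha), SuperHom.vec, wedge_a55 ha]
    simp [SuperHom.vec]
  · rw [wedge_lam (φ.vec_homog ha), SuperHom.vec, wedge_lam ha]
    simp [SuperHom.vec]

/-- Up to denominators both sides are generated by the image of `b 0 ∧ b 1`. -/
theorem wedgeSq_baseChange {B : Type*} [Ring B] [Algebra ℂ B] [SuperAlgebra B] (φ : SuperHom A B)
    {L : Submodule A (Fin 4 ⊕ Fin 1 → A)} (hL : IsPoint 2 L) :
    wedgeSq (baseChange φ L) = baseChange φ (wedgeSq L) := by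
  apply le_antisymm
  · intro z hz
    refine mem_of_local fun p hp => ?_
    obtain ⟨s, hs, b, c, h⟩ := hL.exists_frame (p.comap φ.even) (Ideal.IsPrime.comap _)
    refine ⟨_, fun h => (hp.mem_or_mem h).elim hs hs,
      (Submodule.span_singleton_le_iff_mem _ _).2 ?_ (smul_wedgeSq_mem (h.baseChange φ) hz)⟩
    rw [← φ.vec_wedge (h.homog 0)]
    exact mem_baseChange φ (wedge_mem (h.mem 0) (h.mem 1))
  · refine Submodule.span_le.2 ?_
    rintro _ ⟨z, hz, rfl⟩
    refine mem_of_local fun p hp => ?_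
    obtain ⟨s, hs, b, c, h⟩ := hL.exists_frame (p.comap φ.even) (Ideal.IsPrime.comap _)
    refine ⟨φ.even s * φ.even s, fun h => (hp.mem_or_mem h).elim hs hs, ?_⟩
    obtain ⟨x, hx⟩ := Submodule.mem_span_singleton.1 (smul_wedgeSq_mem h hz)
    have : ((φ.even s * φ.even s : evenPart B) : B) • φ.vec z =
        φ.toAlgHom x • wedge (φ.vec (b 0)) (φ.vec (b 1)) := by
      rw [← φ.vec_wedge (h.homog 0), ← φ.vec_smul, hx, φ.vec_smul, ← map_mul]
      rfl
    change ((φ.even s * φ.even s : evenPart B) : B) • φ.vec z ∈ _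
    rw [this]
    exact Submodule.smul_mem _ _
      (wedge_mem (mem_baseChange φ (h.mem 0)) (mem_baseChange φ (h.mem 1)))

end WedgeLemmas

end SuperGr

/-! ### The image of the Plücker map. -/

namespace SuperGr

open SuperAlgebra

/-! ### The Plücker relations on even vectors -/

/-- When an index is repeated, antisymmetry and commutativity suffice; when the four are distinct,
the identity is the classical relation up to sign. -/
theorem plucker_skew {R : Type*} [CommRing R] (S : Fin 4 → Fin 4 → R) (h0 : ∀ i, S i i = 0)
    (hS : ∀ i j, S j i = -S i j) (h : S 0 1 * S 2 3 - S 0 2 * S 1 3 + S 0 3 * S 1 2 = 0)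
    (i j k l : Fin 4) : S i k * S j l - S i l * S j k = S i j * S k l := by
  have h10 := hS 0 1
  have h20 := hS 0 2
  have h30 := hS 0 3
  have h21 := hS 1 2
  have h31 := hS 1 3
  have h32 := hS 2 3
  fin_cases i <;> fin_cases j <;> fin_cases k <;> fin_cases l <;>
    simp only [Fin.zero_eta, Fin.mk_one, Fin.reduceFinMk, h0, h10, h20, h30, h21, h31, h32] <;>
    first | ring1 | linear_combination h | linear_combination -h

/-- The expression is alternating in the three indices, so increasing triples suffice. -/
theorem three_skew {R : Type*} [Ring R] (S : Fin 4 → Fin 4 → R) (x : Fin 4 → R)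
    (h0 : ∀ i, S i i = 0) (hS : ∀ i j, S j i = -S i j)
    (h : ∀ i j k, i < j → j < k → S i j * x k - S i k * x j + S j k * x i = 0) (i j k : Fin 4) :
    S i j * x k - S i k * x j + S j k * x i = 0 := by
  let T : Fin 4 → Fin 4 → Fin 4 → R := fun i j k => S i j * x k - S i k * x j + S j k * x i
  have h1 : ∀ i j k, T i j k = 0 → T j i k = 0 := fun i j k hT => by
    rw [← neg_eq_zero, ← hT]
    simp only [T, hS i j, neg_mul]
    abel
  have h2 : ∀ i j k, T i j k = 0 → T i k j = 0 := fun i j k hT => by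
    rw [← neg_eq_zero, ← hT]
    simp only [T, hS j k, neg_mul]
    abel
  have h3 : ∀ i k, T i i k = 0 := fun i k => by simp [T, h0]
  have h4 : ∀ i k, T i k k = 0 := fun i k => by simp [T, h0]
  have h5 : ∀ i j k, i < j → T i j k = 0 := by
    intro i j k hij
    rcases lt_trichotomy j k with hjk | rfl | hjk
    · exact h i j k hij hjk
    · exact h4 _ _
    · rcases lt_trichotomy i k with hik | rfl | hik
      · exact h2 _ _ _ (h i k j hik hjk)
      · exact h2 _ _ _ (h3 _ _)
      · exact h2 _ _ _ (h1 _ _ _ (h k i j hik hij))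
  rcases lt_trichotomy i j with hij | rfl | hij
  · exact h5 i j k hij
  · exact h3 _ _
  · exact h1 _ _ _ (h5 j i k hij)

theorem skew_self {A : Type*} [Ring A] (Q : EvenIdx ⊕ Fin 4 → A) (i : Fin 4) : skew Q i i = 0 := by
  simp [skew]

theorem skew_swap {A : Type*} [Ring A] (Q : EvenIdx ⊕ Fin 4 → A) (i j : Fin 4) : skew Q j i = -skew Q i j := by
  rcases lt_trichotomy i j with h | rfl | h
  · simp [skew, h, h.not_gt]
  · simp [skew]
  · simp [skew, h, h.not_gt]

theorem skew_of_lt {A : Type*} [Ring A] (Q : EvenIdx ⊕ Fin 4 → A) {i j : Fin 4} (h : i < j) :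
    skew Q i j = Q (.inl (.q i j h)) := by
  simp [skew, h]

section Relations

variable {A : Type*} [Ring A] [Algebra ℂ A] [SuperAlgebra A]

theorem eval_congr {σ τ : Type} {Q Q' : σ ⊕ τ → A} (h : Q = Q') (hQ : IsHomog 0 Q)
    (hQ' : IsHomog 0 Q') (f : SPoly σ τ) : SPoly.eval Q hQ f = SPoly.eval Q' hQ' f := by
  subst h
  rfl

/-- The Plücker relations hold for the coordinates of `Q`. -/
def IsPluckerVec (Q : EvenIdx ⊕ Fin 4 → A) (hQ : IsHomog 0 Q) : Prop :=
  ∀ f, PluckerRel f → SPoly.eval Q hQ f = 0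

theorem IsPluckerVec.eval_eq_zero {Q : EvenIdx ⊕ Fin 4 → A} {hQ : IsHomog 0 Q}
    (h : IsPluckerVec Q hQ) {f : PluckerPoly} (hf : f ∈ pluckerIdeal) :
    SPoly.eval Q hQ f = 0 := by
  have : pluckerIdeal ≤ TwoSidedIdeal.ker (SPoly.eval Q hQ) :=
    TwoSidedIdeal.span_le.2 fun g hg => (TwoSidedIdeal.mem_ker _).2 (h g hg)
  exact (TwoSidedIdeal.mem_ker _).1 (this hf)

theorem isPluckerVec_of_vanishing {Q : EvenIdx ⊕ Fin 4 → A} {hQ : IsHomog 0 Q}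
    (h : ∀ f ∈ pluckerIdeal, SPoly.eval Q hQ f = 0) : IsPluckerVec Q hQ :=
  fun f hf => h f (TwoSidedIdeal.subset_span hf)

/-- All the relations are homogeneous of degree two, hence need to be tested only on a local
generator. -/
theorem eval_rel_smul {Q : EvenIdx ⊕ Fin 4 → A} (hQ : IsHomog 0 Q) {x : A}
    (hx : x ∈ part (A := A) 0) {f : PluckerPoly} (hf : PluckerRel f) :
    SPoly.eval (x • Q) (hQ.even_smul hx) f = x * x * SPoly.eval Q hQ f := by
  have h : ∀ y z : A, x * y * (x * z) = x * x * (y * z) := fun y z => by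
    rw [mul_assoc, ← mul_assoc y, ← commute_of_even hx y, mul_assoc, mul_assoc]
  cases hf <;>
    simp only [q, a55, lam, map_add, map_sub, map_mul, SPoly.eval_x, SPoly.eval_θ, Pi.smul_apply,
      smul_eq_mul, h, mul_add, mul_sub]

theorem isPluckerVec_wedge {a b : Fin 4 ⊕ Fin 1 → A} (ha : IsHomog 0 a) (hb : IsHomog 0 b) :
    IsPluckerVec (wedge a b) (wedge_homog ha hb) := by
  have hα := SPoly.inr_mem ha 0
  have hβ := SPoly.inr_mem hb 0
  have hαα := odd_mul_self hα
  have hββ := odd_mul_self hβ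
  have hβα := odd_mul_odd hβ hα
  have e := even_mul_mul_even_mul (A := A)
  have hq : ∀ i j h, wedge a b (.inl (.q i j h)) =
      ((ha.evenCoord i * hb.evenCoord j - ha.evenCoord j * hb.evenCoord i : evenPart A) : A) :=
    fun i j h => rfl
  have hl : ∀ i, wedge a b (.inr i) =
      (ha.evenCoord i : A) * b (.inr 0) - (hb.evenCoord i : A) * a (.inr 0) := fun i => by
    rw [wedge_lam ha, ← commute_of_even (SPoly.inl_mem ha i)]
    rfl
  have h55 : wedge a b (.inl .a55) = a (.inr 0) * b (.inr 0) := by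
    rw [wedge_a55 ha, ← odd_mul_odd hα hβ]
  have hαβα : a (.inr 0) * (a (.inr 0) * b (.inr 0)) = 0 := by rw [← mul_assoc, hαα, zero_mul]
  have hβαβ : b (.inr 0) * (a (.inr 0) * b (.inr 0)) = 0 := by
    rw [← mul_assoc, hβα, neg_mul, mul_assoc, hββ, mul_zero, neg_zero]
  intro f hf
  cases hf with
  | classical =>
    simp only [q, map_add, map_sub, map_mul, SPoly.eval_x, hq, ← Subalgebra.coe_mul,
      ← Subalgebra.coe_sub, ← Subalgebra.coe_add]
    refine congrArg Subtype.val (a₂ := (0 : evenPart A)) ?_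
    ring
  | three i j k hij hjk =>
    -- As `λ_k = a_k β - b_k α`, the three-term relation splits into a multiple of `β` and one of
    -- `α`; each coefficient is the expansion of a `3 × 3` determinant with a repeated column.
    have key : ∀ (X Y Z : evenPart A) (hX : X * ha.evenCoord k - Y * ha.evenCoord j +
        Z * ha.evenCoord i = 0) (hY : X * hb.evenCoord k - Y * hb.evenCoord j +
        Z * hb.evenCoord i = 0), (X : A) * wedge a b (.inr k) - (Y : A) * wedge a b (.inr j) +
        (Z : A) * wedge a b (.inr i) = 0 := by
      intro X Y Z hX hY
      have e₁ := congrArg (fun t : evenPart A => (t : A) * b (.inr 0)) hX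
      have e₂ := congrArg (fun t : evenPart A => (t : A) * a (.inr 0)) hY
      have e₃ := congrArg₂ (· - ·) e₁ e₂
      simp only [Subalgebra.coe_add, Subalgebra.coe_sub, Subalgebra.coe_mul, Subalgebra.coe_zero,
        zero_mul, sub_zero, add_mul, sub_mul, mul_assoc] at e₃
      rw [← e₃]
      simp only [hl, mul_sub]
      abel
    simp only [q, lam, map_add, map_sub, map_mul, SPoly.eval_x, SPoly.eval_θ, hq]
    refine key _ _ _ ?_ ?_ <;> ring
  | lam_lam i j hij =>
    simp only [q, lam, a55, map_sub, map_mul, SPoly.eval_x, SPoly.eval_θ, hq, hl, h55]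
    rw [← commute_of_even (Subtype.prop (_ : evenPart A))]
    simp only [mul_sub, sub_mul, e, hαα, hββ, hβα, mul_zero, mul_neg, Subalgebra.coe_sub,
      Subalgebra.coe_mul]
    rw [← commute_of_even (ha.evenCoord j).2]
    abel
  | lam_a i =>
    simp only [lam, a55, map_mul, SPoly.eval_x, SPoly.eval_θ, hl, h55, sub_mul, mul_assoc, hαβα,
      hβαβ, mul_zero, sub_zero]
  | a_a =>
    simp only [a55, map_mul, SPoly.eval_x, h55, mul_assoc, hβαβ, mul_zero]

variable {Q : EvenIdx ⊕ Fin 4 → A} {hQ : IsHomog 0 Q}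

theorem skew_mem (hQ : IsHomog 0 Q) (i j : Fin 4) : skew Q i j ∈ evenPart A := by
  unfold skew
  split_ifs
  · exact SPoly.inl_mem hQ _
  · exact neg_mem (SPoly.inl_mem hQ _)
  · exact zero_mem _

theorem IsPluckerVec.skew_mul_skew (h : IsPluckerVec Q hQ) (i j k l : Fin 4) :
    skew Q i k * skew Q j l - skew Q i l * skew Q j k = skew Q i j * skew Q k l := by
  have hc := h _ .classical
  simp only [q, map_add, map_sub, map_mul, SPoly.eval_x] at hc
  have := plucker_skew (R := evenPart A) (fun i j => ⟨skew Q i j, skew_mem hQ i j⟩)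
    (fun i => Subtype.ext (skew_self Q i)) (fun i j => Subtype.ext (skew_swap Q i j))
    (Subtype.ext hc) i j k l
  exact congrArg Subtype.val this

theorem IsPluckerVec.skew_mul_lam (h : IsPluckerVec Q hQ) (i j k : Fin 4) :
    skew Q i j * Q (.inr k) - skew Q i k * Q (.inr j) + skew Q j k * Q (.inr i) = 0 := by
  refine three_skew _ (fun k => Q (.inr k)) (skew_self Q) (skew_swap Q) (fun i j k hij hjk => ?_)
    i j k
  have := h _ (.three i j k hij hjk)
  simp only [q, lam, map_add, map_sub, map_mul, SPoly.eval_x, SPoly.eval_θ] at this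
  rwa [skew_of_lt Q hij, skew_of_lt Q hjk, skew_of_lt Q (hij.trans hjk)]

theorem IsPluckerVec.lam_mul_lam (h : IsPluckerVec Q hQ) (i j : Fin 4) :
    Q (.inr i) * Q (.inr j) = Q (.inl .a55) * skew Q i j := by
  have key : ∀ i j, i < j → Q (.inr i) * Q (.inr j) = Q (.inl .a55) * skew Q i j := by
    intro i j hij
    have := h _ (.lam_lam i j hij)
    simp only [q, lam, a55, map_sub, map_mul, SPoly.eval_x, SPoly.eval_θ] at this
    rw [skew_of_lt Q hij]
    exact sub_eq_zero.1 this
  rcases lt_trichotomy i j with hij | rfl | hij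
  · exact key i j hij
  · rw [skew_self, mul_zero, odd_mul_self (SPoly.inr_mem hQ i)]
  · rw [odd_mul_odd (SPoly.inr_mem hQ i) (SPoly.inr_mem hQ j), key j i hij, skew_swap Q j i,
      mul_neg]

theorem IsPluckerVec.a55_mul_a55 (h : IsPluckerVec Q hQ) :
    Q (.inl .a55) * Q (.inl .a55) = 0 := by
  have := h _ .a_a
  simpa only [a55, map_mul, SPoly.eval_x] using this

/-- The coordinates `a_55` and `λ_i` are nilpotent, so that `Q` can only be a basis vector where
some `q_ij` is invertible. -/
theorem IsPluckerVec.exists_q_notMem (h : IsPluckerVec Q hQ) {c : EvenIdx ⊕ Fin 4 → A}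
    (hc : IsHomog 0 c) {p : Ideal (evenPart A)} (hp : p.IsPrime) {s : evenPart A} (hs : s ∉ p)
    (hcQ : pairing c Q = s) :
    ∃ (i j : Fin 4) (hij : i < j), hQ.evenCoord (.q i j hij) ∉ p := by
  by_contra! hcon
  refine hs ?_
  have hs' : s = ∑ e, hQ.evenCoord e * hc.evenCoord e +
      ∑ i, oddMul (SPoly.inr_mem hQ i) (SPoly.inr_mem hc i) := by
    apply Subtype.ext
    rw [← hcQ, pairing_apply, Fintype.sum_sum_type]
    simp
  rw [hs']
  refine p.add_mem (p.sum_mem fun e _ => ?_) (p.sum_mem fun i _ => ?_)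
  · rcases e with ⟨i, j, hij⟩ | _
    · exact p.mul_mem_right _ (hcon i j hij)
    · refine p.mul_mem_right _ (hp.mem_of_pow_mem 2 ?_)
      have : hQ.evenCoord .a55 ^ 2 = 0 := by
        rw [sq]
        exact Subtype.ext h.a55_mul_a55
      rw [this]
      exact p.zero_mem
  · refine hp.mem_of_pow_mem 2 ?_
    have : oddMul (SPoly.inr_mem hQ i) (SPoly.inr_mem hc i) ^ 2 = 0 := by
      rw [sq]
      apply Subtype.ext
      change Q (.inr i) * c (.inr i) * (Q (.inr i) * c (.inr i)) = 0
      rw [mul_assoc, ← mul_assoc (c _), odd_mul_odd (SPoly.inr_mem hc i) (SPoly.inr_mem hQ i),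
        neg_mul, mul_assoc (Q _), odd_mul_self (SPoly.inr_mem hc i), mul_zero, neg_zero, mul_zero]
    rw [this]
    exact p.zero_mem

theorem contraction_inl_homog (hQ : IsHomog 0 Q) (i : Fin 4) :
    IsHomog 0 (contraction (.inl i) Q) := by
  rintro (j | j)
  · have := skew_mem hQ i j
    exact this
  · exact SPoly.inr_mem hQ i

/-- For `Q = a ∧ b` this is `(a_i b - b_i a) ∧ (a_j b - b_j a) = q_ij a ∧ b`. For general `Q` the
coordinates of the identity are Plücker relations, and this makes the Plücker map surjective onto
their zero locus. -/
theorem IsPluckerVec.wedge_contraction (h : IsPluckerVec Q hQ) (i j : Fin 4) :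
    wedge (contraction (.inl i) Q) (contraction (.inl j) Q) = skew Q i j • Q := by
  funext k
  rcases k with (⟨k, l, hkl⟩ | _) | k
  · rw [Pi.smul_apply, smul_eq_mul, ← skew_of_lt Q hkl, ← h.skew_mul_skew]
    rfl
  · rw [wedge_a55 (contraction_inl_homog hQ i)]
    change -(Q (.inr j) * Q (.inr i)) = skew Q i j * Q (.inl .a55)
    rw [h.lam_mul_lam, skew_swap Q i j, mul_neg, neg_neg, commute_of_even (skew_mem hQ i j)]
  · rw [wedge_lam (contraction_inl_homog hQ i)]
    change Q (.inr j) * skew Q i k - skew Q j k * Q (.inr i) = skew Q i j * Q (.inr k)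
    have := h.skew_mul_lam i j k
    rw [← commute_of_even (skew_mem hQ i k), ← sub_eq_zero, ← neg_eq_zero, ← this]
    abel

/-- Together with the odd analogue below: once `q_ij` is inverted, the contractions with `i` and `j`
span all the others. -/
theorem IsPluckerVec.skew_smul_contraction_inl (h : IsPluckerVec Q hQ) (i j k : Fin 4) :
    skew Q i j • contraction (.inl k) Q =
      skew Q i k • contraction (.inl j) Q - skew Q j k • contraction (.inl i) Q := by
  funext l
  rcases l with l | l
  · change skew Q i j * skew Q k l = skew Q i k * skew Q j l - skew Q j k * skew Q i l
    rw [← h.skew_mul_skew i j k l, commute_of_even (skew_mem hQ i l)]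
  · change skew Q i j * Q (.inr k) = skew Q i k * Q (.inr j) - skew Q j k * Q (.inr i)
    rw [← sub_eq_zero, ← h.skew_mul_lam i j k]
    abel

theorem IsPluckerVec.skew_smul_contraction_inr (h : IsPluckerVec Q hQ) (i j : Fin 4)
    (k : Fin 1) :
    skew Q i j • contraction (.inr k) Q =
      Q (.inr i) • contraction (.inl j) Q - Q (.inr j) • contraction (.inl i) Q := by
  funext l
  rcases l with l | l
  · change skew Q i j * -Q (.inr l) = Q (.inr i) * skew Q j l - Q (.inr j) * skew Q i l
    rw [← commute_of_even (skew_mem hQ j l), ← commute_of_even (skew_mem hQ i l), ← sub_eq_zero,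
      mul_neg, ← neg_eq_zero, ← h.skew_mul_lam i j l]
    abel
  · change skew Q i j * (Q (.inl .a55) + Q (.inl .a55)) =
      Q (.inr i) * Q (.inr j) - Q (.inr j) * Q (.inr i)
    rw [h.lam_mul_lam, h.lam_mul_lam, skew_swap Q i j, mul_neg, sub_neg_eq_add, mul_add,
      commute_of_even (skew_mem hQ i j)]

end Relations

section Image

variable {A : Type*} [Ring A] [Algebra ℂ A] [SuperAlgebra A]

theorem isProjPoint_wedgeSq {L : Submodule A (Fin 4 ⊕ Fin 1 → A)} (hL : IsPoint 2 L) :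
    IsProjPoint pluckerIdeal (wedgeSq L) := by
  refine ⟨hL.wedgeSq, fun Q hQL hQ => fun f hf => IsPluckerVec.eval_eq_zero (fun r hr => ?_) hf⟩
  refine eq_zero_of_local (A := A) fun p hp => ?_
  obtain ⟨s, hs, b, c, h⟩ := hL.exists_frame p hp
  obtain ⟨c', h'⟩ := h.wedgeSq
  have hss : s * s ∉ p := fun h => (hp.mem_or_mem h).elim hs hs
  have hsss : s * s * (s * s) ∉ p := fun h => (hp.mem_or_mem h).elim hss hss
  refine ⟨_, fun h => (hp.mem_or_mem h).elim hsss hsss, ?_⟩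
  -- A quadratic relation absorbs the square of the frame's denominator, and the rescaled `Q` is a
  -- multiple of `b 0 ∧ b 1`.
  rw [Subalgebra.coe_mul, smul_eq_mul, ← eval_rel_smul hQ (s * s * (s * s)).2 hr]
  have hx : pairing (c' 0) Q ∈ part (A := A) 0 := by
    simpa using pairing_mem hQ (h'.homog_form 0)
  have hw := wedge_homog (h.homog 0) (h.homog 1)
  rw [eval_congr (Q' := pairing (c' 0) Q • wedge (b 0) (b 1)) (by simpa using h'.expand Q hQL) _
    (hw.even_smul hx), eval_rel_smul hw hx hr,
    isPluckerVec_wedge (h.homog 0) (h.homog 1) r hr, mul_zero]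

/-- Where `M` is generated by `m` and `q_ij` is invertible, the contractions of `m` with the
coordinate functions `i`, `j` are a basis of the space of all contractions. -/
theorem exists_frame_contractionSpan {M : Submodule A (EvenIdx ⊕ Fin 4 → A)} {s : evenPart A}
    {m c : Fin 1 → EvenIdx ⊕ Fin 4 → A} (hm : IsFrame s M m c)
    (hP : IsPluckerVec (m 0) (hm.homog 0)) {i j : Fin 4} (hij : i < j) :
    ∃ c' : Fin 2 → Fin 4 ⊕ Fin 1 → A,
      IsFrame (s * (hm.homog 0).evenCoord (.q i j hij) * (s * (hm.homog 0).evenCoord (.q i j hij)))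
        (contractionSpan M) ![contraction (.inl i) (m 0), contraction (.inl j) (m 0)] c' := by
  have ht : skew (m 0) i j = (hm.homog 0).evenCoord (.q i j hij) := skew_of_lt _ hij
  have hsingle : ∀ (k : Fin 4) (v : Fin 4 ⊕ Fin 1 → A),
      pairing ((s : A) • (Pi.single (.inl k) 1 : Fin 4 ⊕ Fin 1 → A)) v = s * v (.inl k) := by
    intro k v
    rw [pairing_even_smul s.2, pairing_apply]
    congr 1
    rw [Finset.sum_eq_single (.inl k)]
    · simp
    · intro b _ hb
      simp [hb]
    · simp
  have hneg : ∀ c v : Fin 4 ⊕ Fin 1 → A, pairing (-c) v = -pairing c v := by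
    intro c v
    simp [pairing_apply]
  -- The contraction with `i` has coordinates `0` at `i` and `q_ij` at `j`; the one with `j` has
  -- `-q_ij` at `i` and `0` at `j`. So the `j`-th coordinate and minus the `i`-th are dual to them
  -- up to `q_ij`. The factor `s` matches the denominator needed to express elements of `M` through
  -- `m 0`.
  refine isFrame_of_mem_span (c := ![(s : A) • (Pi.single (.inl j) 1 : Fin 4 ⊕ Fin 1 → A),
    -((s : A) • (Pi.single (.inl i) 1 : Fin 4 ⊕ Fin 1 → A))]) (fun k => ?_) (fun k => ?_) (fun k l => ?_)
    (fun v hv => ?_)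
  · fin_cases k
    · exact contraction_mem (hm.mem 0) _
    · exact contraction_mem (hm.mem 0) _
  · fin_cases k
    · exact contraction_inl_homog (hm.homog 0) i
    · exact contraction_inl_homog (hm.homog 0) j
  · have e1 : contraction (.inl i) (m 0) (.inl j) = skew (m 0) i j := rfl
    have e2 : contraction (.inl i) (m 0) (.inl i) = 0 := skew_self _ _
    have e3 : contraction (.inl j) (m 0) (.inl j) = 0 := skew_self _ _
    have e4 : contraction (.inl j) (m 0) (.inl i) = -skew (m 0) i j := skew_swap _ _ _
    fin_cases k <;> fin_cases l <;> simp [hsingle, hneg, e1, e2, e3, e4, ht]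
  · have hspan : ∀ k, skew (m 0) i j • contraction k (m 0) ∈ Submodule.span A
        (Set.range ![contraction (.inl i) (m 0), contraction (.inl j) (m 0)]) := by
      have h0 : contraction (.inl i) (m 0) ∈ Submodule.span A
          (Set.range ![contraction (.inl i) (m 0), contraction (.inl j) (m 0)]) :=
        Submodule.subset_span ⟨0, rfl⟩
      have h1 : contraction (.inl j) (m 0) ∈ Submodule.span A
          (Set.range ![contraction (.inl i) (m 0), contraction (.inl j) (m 0)]) :=
        Submodule.subset_span ⟨1, rfl⟩
      rintro (k | k)
      · rw [hP.skew_smul_contraction_inl]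
        exact Submodule.sub_mem _ (Submodule.smul_mem _ _ h1) (Submodule.smul_mem _ _ h0)
      · rw [hP.skew_smul_contraction_inr]
        exact Submodule.sub_mem _ (Submodule.smul_mem _ _ h1) (Submodule.smul_mem _ _ h0)
    induction hv using Submodule.iSup_induction' with
    | mem k v hv =>
      obtain ⟨m', hm', rfl⟩ := hv
      have : ((s * (hm.homog 0).evenCoord (.q i j hij) : evenPart A) : A) • contraction k m' =
          pairing (c 0) m' • skew (m 0) i j • contraction k (m 0) := by
        have hexp : (s : A) • m' = pairing (c 0) m' • m 0 := by simpa using hm.expand m' hm'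
        rw [mul_comm, Subalgebra.coe_mul, mul_smul, ← map_smul, hexp, map_smul, ← ht,
          even_smul_comm (skew_mem (hm.homog 0) i j)]
      rw [this]
      exact Submodule.smul_mem _ _ (hspan k)
    | zero => simp
    | add x y _ _ hx hy => rw [smul_add]; exact Submodule.add_mem _ hx hy

/-- The vector of a frame is itself an even element of `M`, so it satisfies the relations; the dual
form takes on it a value outside `p`, which forces some `q_ij` outside `p`. -/
theorem IsProjPoint.exists_local {M : Submodule A (EvenIdx ⊕ Fin 4 → A)}
    (hM : IsProjPoint pluckerIdeal M) (p : Ideal (evenPart A)) (hp : p.IsPrime) :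
    ∃ s ∉ p, ∃ (m c : Fin 1 → EvenIdx ⊕ Fin 4 → A) (hm : IsFrame s M m c),
      IsPluckerVec (m 0) (hm.homog 0) ∧
        ∃ (i j : Fin 4) (hij : i < j), (hm.homog 0).evenCoord (.q i j hij) ∉ p := by
  obtain ⟨s, hs, m, c, hm⟩ := hM.1.exists_frame p hp
  have hP : IsPluckerVec (m 0) (hm.homog 0) :=
    isPluckerVec_of_vanishing (hM.2 _ (hm.mem 0) (hm.homog 0))
  exact ⟨s, hs, m, c, hm, hP, hP.exists_q_notMem (hm.homog_form 0) hp hs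
    (by simpa using hm.dual 0 0)⟩

theorem isPoint_contractionSpan {M : Submodule A (EvenIdx ⊕ Fin 4 → A)}
    (hM : IsProjPoint pluckerIdeal M) : IsPoint 2 (contractionSpan M) := by
  refine IsPoint.of_frames fun p hp => ?_
  obtain ⟨s, hs, m, c, hm, hP, i, j, hij, hq⟩ := hM.exists_local p hp
  obtain ⟨c', h'⟩ := exists_frame_contractionSpan hm hP hij
  have hst := fun h => (hp.mem_or_mem h).elim hs hq
  exact ⟨_, fun h => (hp.mem_or_mem h).elim hst hst, _, c', h'⟩

/-- Locally the contractions with `i` and `j` wedge to `q_ij • m 0`, and `q_ij` is outside the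
prime. -/
theorem wedgeSq_contractionSpan {M : Submodule A (EvenIdx ⊕ Fin 4 → A)}
    (hM : IsProjPoint pluckerIdeal M) : wedgeSq (contractionSpan M) = M := by
  apply le_antisymm
  · intro z hz
    refine mem_of_local fun p hp => ?_
    obtain ⟨s, hs, m, c, hm, hP, i, j, hij, hq⟩ := hM.exists_local p hp
    obtain ⟨c', h'⟩ := exists_frame_contractionSpan hm hP hij
    have hst := fun h => (hp.mem_or_mem h).elim hs hq
    have hst2 := fun h => (hp.mem_or_mem h).elim hst hst
    refine ⟨_, fun h => (hp.mem_or_mem h).elim hst2 hst2,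
      (Submodule.span_singleton_le_iff_mem _ _).2 ?_ (smul_wedgeSq_mem h' hz)⟩
    have := hP.wedge_contraction i j
    change wedge (contraction (.inl i) (m 0)) (contraction (.inl j) (m 0)) ∈ M
    rw [this]
    exact M.smul_mem _ (hm.mem 0)
  · intro z hz
    refine mem_of_local fun p hp => ?_
    obtain ⟨s, hs, m, c, hm, hP, i, j, hij, hq⟩ := hM.exists_local p hp
    refine ⟨(hm.homog 0).evenCoord (.q i j hij) * s, fun h => (hp.mem_or_mem h).elim hq hs, ?_⟩
    have hexp : (s : A) • z = pairing (c 0) z • m 0 := by simpa using hm.expand z hz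
    rw [Subalgebra.coe_mul, mul_smul, hexp,
      even_smul_comm ((hm.homog 0).evenCoord (.q i j hij)).2,
      IsHomog.coe_evenCoord, ← skew_of_lt (m 0) hij, ← hP.wedge_contraction]
    exact Submodule.smul_mem _ _
      (wedge_mem (contraction_mem (hm.mem 0) _) (contraction_mem (hm.mem 0) _))

theorem bijOn_wedgeSq : Set.BijOn (wedgeSq (A := A)) {L | IsPoint 2 L}
    {M | IsProjPoint pluckerIdeal M} := by
  refine ⟨fun L hL => isProjPoint_wedgeSq hL, fun L hL L' hL' h => ?_, fun M hM =>
    ⟨contractionSpan M, isPoint_contractionSpan hM, wedgeSq_contractionSpan hM⟩⟩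
  rw [← contractionSpan_wedgeSq hL, ← contractionSpan_wedgeSq hL']
  exact congrArg contractionSpan h

theorem span_even_coordinates_eq_top {L : Submodule A (Fin 4 ⊕ Fin 1 → A)} (hL : IsPoint 2 L) :
    Ideal.span {a : A | ∃ i : EvenIdx, ∃ Q ∈ wedgeSq L, Q (Sum.inl i) = a} = ⊤ := by
  rw [Ideal.eq_top_iff_one]
  refine mem_of_local fun p hp => ?_
  obtain ⟨s, hs, m, c, hm, hP, i, j, hij, hq⟩ := (isProjPoint_wedgeSq hL).exists_local p hp
  refine ⟨_, hq, ?_⟩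
  rw [smul_eq_mul, mul_one]
  exact Ideal.subset_span ⟨_, m 0, hm.mem 0, rfl⟩

end Image

end SuperGr

/-! ### Classical input: the ideal of `Gr(2, 4)` and its linear syzygies. -/

namespace SuperGr

open SuperAlgebra

/-! ### The quadric of the classical Plücker relation -/

section Quadric

open MvPolynomial

/-- The polynomial ring in the `q_ij`, in the order `q_12`, `q_13`, `q_14`, `q_23`, `q_24`,
`q_34`. -/
abbrev QPoly : Type := MvPolynomial (Fin 6) ℂ

/-- The classical Plücker relation. -/
noncomputable def quadric : QPoly := X 0 * X 5 - X 1 * X 4 + X 2 * X 3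

/-- The ring of the big cell `{(1, 0, x_1, x_2), (0, 1, x_3, x_4)}`, with a scaling factor
`x_0`. -/
abbrev CellPoly : Type := MvPolynomial (Fin 5) ℂ

/-- The values of the `q_ij` on the big cell. -/
noncomputable def quadricParam : QPoly →ₐ[ℂ] CellPoly :=
  aeval ![X 0, X 0 * X 3, X 0 * X 4, -(X 0 * X 1), -(X 0 * X 2),
    X 0 * (X 1 * X 4 - X 2 * X 3)]

theorem quadricParam_X (i : Fin 6) : quadricParam (X i) =
    ![X 0, X 0 * X 3, X 0 * X 4, -(X 0 * X 1), -(X 0 * X 2),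
      X 0 * (X 1 * X 4 - X 2 * X 3)] i := aeval_X _ _

/-- `X 0` is prime and does not divide the quadric: at the point used below `X 0` is `0` and the
quadric is `1`. So the power of `X 0` divides the cofactor and cancels. -/
theorem quadric_dvd_of_X_pow_mul {N : ℕ} {p : QPoly} (h : quadric ∣ X 0 ^ N * p) :
    quadric ∣ p := by
  obtain ⟨r, hr⟩ := h
  have hX : ¬(X 0 : QPoly) ∣ quadric := by
    rintro ⟨g, hg⟩
    have := congrArg (eval ![0, 0, 1, 1, 0, 0]) hg
    simp [quadric] at this
  obtain ⟨r', rfl⟩ := (X_prime (R := ℂ) (i := (0 : Fin 6))).pow_dvd_of_dvd_mul_left N hX ⟨p, hr.symm⟩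
  refine ⟨r', mul_left_cancel₀ (pow_ne_zero N (X_ne_zero (0 : Fin 6))) ?_⟩
  rw [hr]
  ring

/-- The inverse of `quadricParam` on the locus where `q_12` is invertible. -/
noncomputable def cellInverse : CellPoly →ₐ[ℂ] FractionRing QPoly :=
  let y : Fin 6 → FractionRing QPoly := fun i => algebraMap QPoly (FractionRing QPoly) (X i)
  aeval ![y 0, -(y 3 / y 0), -(y 4 / y 0), y 1 / y 0, y 2 / y 0]

/-- Division by the quadric, which is linear in `X 5` with leading coefficient `X 0`. The second
equation identifies `r / X 0 ^ N` as `p` with `(X 1 * X 4 - X 2 * X 3) / X 0` put for `X 5`; hence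
`r` vanishes as soon as `quadricParam p` does. -/
theorem exists_X_pow_mul_eq (p : QPoly) : ∃ (N : ℕ) (h r : QPoly),
    X 0 ^ N * p = quadric * h + r ∧
      algebraMap QPoly (FractionRing QPoly) r =
        algebraMap QPoly (FractionRing QPoly) (X 0) ^ N * cellInverse (quadricParam p) := by
  induction p using MvPolynomial.induction_on with
  | C a =>
    refine ⟨0, 0, C a, by simp, ?_⟩
    rw [pow_zero, one_mul]
    exact ((cellInverse.comp quadricParam).commutes a).symm ▸
      (IsScalarTower.algebraMap_apply ℂ QPoly (FractionRing QPoly) a).symm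
  | add p p' hp hp' =>
    obtain ⟨N, h, r, e, e'⟩ := hp
    obtain ⟨N', h', r', f, f'⟩ := hp'
    refine ⟨N + N', X 0 ^ N' * h + X 0 ^ N * h', X 0 ^ N' * r + X 0 ^ N * r', ?_, ?_⟩
    · linear_combination X 0 ^ N' * e + X 0 ^ N * f
    · simp only [map_add, map_mul, map_pow, e', f']
      ring
  | mul_X p i hp =>
    obtain ⟨N, h, r, e, e'⟩ := hp
    have h0 : algebraMap QPoly (FractionRing QPoly) (X 0) ≠ 0 := by
      rw [Ne, map_eq_zero_iff _ (IsFractionRing.injective QPoly (FractionRing QPoly))]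
      exact X_ne_zero _
    by_cases hi : i = 5
    · subst hi
      -- One more power of `X 0` allows `X 0 * X 5` to be exchanged for `X 1 * X 4 - X 2 * X 3`
      -- modulo the quadric.
      refine ⟨N + 1, X 0 * X 5 * h + r, (X 1 * X 4 - X 2 * X 3) * r, ?_, ?_⟩
      · have : quadric = X 0 * X 5 - X 1 * X 4 + X 2 * X 3 := rfl
        linear_combination X 0 * X 5 * e - r * this
      · simp only [map_sub, map_mul, e', quadricParam_X]
        simp [cellInverse]
        field_simp
        ring
    · refine ⟨N, h * X i, r * X i, by linear_combination X i * e, ?_⟩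
      rw [map_mul, map_mul, map_mul, e', mul_assoc]
      congr 2
      rw [quadricParam_X]
      fin_cases i <;> first | exact absurd rfl hi | (simp [cellInverse]; try field_simp)

/-- The ideal of the Grassmannian `Gr(2, 4)` is generated by the Plücker relation. -/
theorem quadric_dvd_of_quadricParam_eq_zero {p : QPoly} (hp : quadricParam p = 0) :
    quadric ∣ p := by
  obtain ⟨N, h, r, e, e'⟩ := exists_X_pow_mul_eq p
  rw [hp, map_zero, mul_zero,
    map_eq_zero_iff _ (IsFractionRing.injective QPoly (FractionRing QPoly))] at e'
  rw [e', add_zero] at e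
  exact quadric_dvd_of_X_pow_mul ⟨h, e⟩

/-- The syzygies of the `λ_k` on the big cell are generated by the three-term relations. -/
theorem exists_of_syzygy (m : Fin 4 → QPoly)
    (ha : quadricParam (m 0) + quadricParam (m 2) * X 1 + quadricParam (m 3) * X 2 = 0)
    (hb : quadricParam (m 1) + quadricParam (m 2) * X 3 + quadricParam (m 3) * X 4 = 0) :
    ∃ n : Fin 4 → QPoly, m 0 = X 5 * n 1 - X 4 * n 2 + X 3 * n 3 ∧
      m 1 = -(X 5 * n 0) + X 2 * n 2 - X 1 * n 3 ∧ m 2 = X 4 * n 0 - X 2 * n 1 + X 0 * n 3 ∧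
      m 3 = -(X 3 * n 0) + X 1 * n 1 - X 0 * n 2 := by
  -- On the cell `q_ij = X 0 (a_i b_j - a_j b_i)`, and the hypotheses say that `m` is orthogonal to
  -- both rows `a` and `b`. So the skew matrix `(q_ij)` sends `m` to multiples of the quadric; the
  -- quotients, up to sign, are `n`. This matrix times its dual skew matrix is the quadric up to
  -- sign, so the dual matrix recovers `m` from `n`.
  have h0 : quadric ∣ -(m 1 * X 0 + m 2 * X 1 + m 3 * X 2) := by
    apply quadric_dvd_of_quadricParam_eq_zero
    simp only [map_neg, map_add, map_mul, quadricParam_X, Matrix.cons_val]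
    linear_combination -X 0 * hb
  have h1 : quadric ∣ m 0 * X 0 - m 2 * X 3 - m 3 * X 4 := by
    apply quadric_dvd_of_quadricParam_eq_zero
    simp only [map_sub, map_mul, quadricParam_X, Matrix.cons_val]
    linear_combination X 0 * ha
  have h2 : quadric ∣ m 0 * X 1 + m 1 * X 3 - m 3 * X 5 := by
    apply quadric_dvd_of_quadricParam_eq_zero
    simp only [map_sub, map_add, map_mul, quadricParam_X, Matrix.cons_val]
    linear_combination X 0 * X 3 * ha - X 0 * X 1 * hb
  have h3 : quadric ∣ m 0 * X 2 + m 1 * X 4 + m 2 * X 5 := by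
    apply quadric_dvd_of_quadricParam_eq_zero
    simp only [map_add, map_mul, quadricParam_X, Matrix.cons_val]
    linear_combination X 0 * X 4 * ha - X 0 * X 2 * hb
  obtain ⟨n0, h0⟩ := h0
  obtain ⟨n1, h1⟩ := h1
  obtain ⟨n2, h2⟩ := h2
  obtain ⟨n3, h3⟩ := h3
  have hF : quadric ≠ 0 := fun h => by
    have := congrArg (eval ![0, 0, 1, 1, 0, 0]) h
    simp [quadric] at this
  have hQ : quadric = X 0 * X 5 - X 1 * X 4 + X 2 * X 3 := rfl
  refine ⟨![n0, n1, n2, n3], ?_, ?_, ?_, ?_⟩ <;> refine mul_left_cancel₀ hF ?_ <;>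
    simp only [Matrix.cons_val]
  · linear_combination X 5 * h1 - X 4 * h2 + X 3 * h3 + m 0 * hQ
  · linear_combination -X 5 * h0 + X 2 * h2 - X 1 * h3 + m 1 * hQ
  · linear_combination X 4 * h0 - X 2 * h1 + X 0 * h3 + m 2 * hQ
  · linear_combination -X 3 * h0 + X 1 * h1 - X 0 * h2 + m 3 * hQ

end Quadric

end SuperGr

/-! ### Parity, substitution and coefficients in polynomial superalgebras. -/

namespace SuperGr

open SuperAlgebra

/-! ### The parity involution -/

theorem eq_zero_of_eq_neg {V : Type*} [AddCommGroup V] [Module ℂ V] {a : V} (h : a = -a) : a = 0 := by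
  have h2 : (2 : ℂ) • a = 0 := by
    rw [two_smul]
    nth_rewrite 1 [h]
    simp
  exact (smul_eq_zero_iff_right (by norm_num)).1 h2

section Sigma

variable {A : Type*} [Ring A] [Algebra ℂ A] [SuperAlgebra A]

theorem sigma_mul (a b : A) : sigma A (a * b) = sigma A a * sigma A b := by
  obtain ⟨a₀, ha₀, a₁, ha₁, rfl⟩ := exists_add a
  obtain ⟨b₀, hb₀, b₁, hb₁, rfl⟩ := exists_add b
  have h₀₁ : a₀ * b₁ ∈ part (A := A) 1 := even_smul_mem ha₀ hb₁
  have h₁₀ : a₁ * b₀ ∈ part (A := A) 1 := mul_mem ha₁ hb₀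
  have h₁₁ : a₁ * b₁ ∈ part (A := A) 0 := mul_mem ha₁ hb₁
  simp only [add_mul, mul_add, map_add, sigma_even ha₀, sigma_odd ha₁, sigma_even hb₀,
    sigma_odd hb₁, sigma_even (even_smul_mem ha₀ hb₀), sigma_odd h₀₁, sigma_odd h₁₀,
    sigma_even h₁₁, mul_neg, neg_mul]
  abel

/-- The parity involution as an algebra homomorphism. -/
noncomputable def sigmaHom (A : Type*) [Ring A] [Algebra ℂ A] [SuperAlgebra A] : A →ₐ[ℂ] A :=
  AlgHom.ofLinearMap (sigma A) (sigma_even one_mem) sigma_mul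

theorem mem_even_of_sigma_eq {a : A} (h : sigma A a = a) : a ∈ part (A := A) 0 := by
  obtain ⟨a₀, h₀, a₁, h₁, rfl⟩ := exists_add a
  rw [map_add, sigma_even h₀, sigma_odd h₁, add_right_inj] at h
  rw [eq_zero_of_eq_neg h.symm, add_zero]
  exact h₀

theorem mem_odd_of_sigma_eq {a : A} (h : sigma A a = -a) : a ∈ part (A := A) 1 := by
  obtain ⟨a₀, h₀, a₁, h₁, rfl⟩ := exists_add a
  rw [map_add, sigma_even h₀, sigma_odd h₁, neg_add, add_left_inj] at h
  rw [eq_zero_of_eq_neg h, zero_add]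
  exact h₁

end Sigma

/-! ### Generators, quotients and coefficients of polynomial superalgebras -/

theorem ιInv_ι_mul_ι {R M : Type*} [CommRing R] [AddCommGroup M] [Module R M] (x y : M) :
    ExteriorAlgebra.ιInv (ExteriorAlgebra.ι R x * ExteriorAlgebra.ι R y) = 0 := by
  -- The right action is the one underlying `ExteriorAlgebra.ιInv`, which is the projection to the
  -- square-zero extension; there products of two vectors vanish.
  let : Module Rᵐᵒᵖ M := Module.compHom _ ((RingHom.id R).fromOpposite mul_comm)
  have : IsCentralScalar R M := ⟨fun r m => rfl⟩
  change TrivSqZeroExt.snd (ExteriorAlgebra.toTrivSqZeroExt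
    (ExteriorAlgebra.ι R x * ExteriorAlgebra.ι R y)) = 0
  rw [map_mul, ExteriorAlgebra.toTrivSqZeroExt_ι, ExteriorAlgebra.toTrivSqZeroExt_ι,
    TrivSqZeroExt.inr_mul_inr, TrivSqZeroExt.snd_zero]

namespace SPoly

variable {σ τ : Type}

theorem adjoin_range_var : Algebra.adjoin ℂ (Set.range (var : σ ⊕ τ → SPoly σ τ)) = ⊤ := by
  rw [eq_top_iff]
  set S := Algebra.adjoin ℂ (Set.range (var : σ ⊕ τ → SPoly σ τ))
  have hvar : ∀ j, (var j : SPoly σ τ) ∈ S := fun j => Algebra.subset_adjoin ⟨j, rfl⟩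
  have hp : ∀ p : MvPolynomial σ ℂ, (tmul p 1 : SPoly σ τ) ∈ S := by
    intro p
    let f : MvPolynomial σ ℂ →ₐ[ℂ] SPoly σ τ := Algebra.TensorProduct.includeLeft
    change f p ∈ S
    induction p using MvPolynomial.induction_on with
    | C a => exact (f.commutes a).symm ▸ S.algebraMap_mem a
    | add p q hp hq => rw [map_add]; exact S.add_mem hp hq
    | mul_X p i hp => rw [map_mul]; exact S.mul_mem hp (hvar (.inl i))
  have hw : ∀ w : ExteriorAlgebra ℂ (τ →₀ ℂ), (tmul 1 w : SPoly σ τ) ∈ S := by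
    intro w
    let f : ExteriorAlgebra ℂ (τ →₀ ℂ) →ₐ[ℂ] SPoly σ τ := Algebra.TensorProduct.includeRight
    change f w ∈ S
    induction w using ExteriorAlgebra.induction with
    | algebraMap a => exact (f.commutes a).symm ▸ S.algebraMap_mem a
    | ι m =>
      induction m using Finsupp.induction_linear with
      | zero => rw [map_zero, map_zero]; exact S.zero_mem
      | add m n hm hn => rw [map_add, map_add]; exact S.add_mem hm hn
      | single t a =>
        have : (Finsupp.single t a : τ →₀ ℂ) = a • Finsupp.single t 1 := by simp
        rw [this, map_smul, map_smul]
        exact S.smul_mem (hvar (.inr t)) a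
    | mul a b ha hb => rw [map_mul]; exact S.mul_mem ha hb
    | add a b ha hb => rw [map_add]; exact S.add_mem ha hb
  intro z _
  induction z using tmul_induction with
  | zero => exact S.zero_mem
  | add x y hx hy => exact S.add_mem (hx trivial) (hy trivial)
  | tmul p w =>
    have : (tmul p w : SPoly σ τ) = tmul p 1 * tmul 1 w := by
      rw [tmul_mul_tmul, mul_one, one_mul]
    rw [this]
    exact S.mul_mem (hp p) (hw w)

theorem map_eval {A B : Type*} [Ring A] [Algebra ℂ A] [SuperAlgebra A] [Ring B] [Algebra ℂ B]
    [SuperAlgebra B] (φ : SuperHom A B) {Q : σ ⊕ τ → A} (hQ : IsHomog 0 Q) (f : SPoly σ τ) :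
    φ.toAlgHom (eval Q hQ f) = eval (φ.vec Q) (φ.vec_homog hQ) f := by
  have : φ.toAlgHom.comp (eval Q hQ) = eval (φ.vec Q) (φ.vec_homog hQ) := by
    apply algHom_ext
    · intro s
      rw [AlgHom.comp_apply, eval_x, eval_x]
      rfl
    · intro t
      rw [AlgHom.comp_apply, eval_θ, eval_θ]
      rfl
  exact DFunLike.congr_fun this f

/-- Substitution intertwines the parity involutions, whose eigenspaces are the even and odd parts.
-/
theorem eval_mem {A : Type*} [Ring A] [Algebra ℂ A] [SuperAlgebra A] {Q : σ ⊕ τ → A}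
    (hQ : IsHomog 0 Q) {i : ZMod 2} {f : SPoly σ τ} (hf : f ∈ part (A := SPoly σ τ) i) :
    eval Q hQ f ∈ part (A := A) i := by
  have hinv : sigma A (eval Q hQ f) = eval Q hQ (invol σ τ f) := by
    have : (sigmaHom A).comp (eval Q hQ) = (eval Q hQ).comp (invol σ τ) := by
      apply algHom_ext
      · intro s
        rw [AlgHom.comp_apply, AlgHom.comp_apply, eval_x, invol_x, eval_x]
        exact sigma_even (inl_mem hQ s)
      · intro t
        rw [AlgHom.comp_apply, AlgHom.comp_apply, eval_θ, invol_θ, map_neg, eval_θ]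
        exact sigma_odd (inr_mem hQ t)
    exact DFunLike.congr_fun this f
  have hcases : i = 0 ∨ i = 1 := by
    fin_cases i
    · exact Or.inl rfl
    · exact Or.inr rfl
  rcases hcases with rfl | rfl
  · exact mem_even_of_sigma_eq (by rw [hinv, invol_even hf])
  · exact mem_odd_of_sigma_eq (by rw [hinv, invol_odd hf, map_neg])

/-- The quotient map as a morphism of superalgebras. -/
noncomputable def mkHom (I : TwoSidedIdeal (SPoly σ τ)) [HomogIdeal I] :
    SuperHom (SPoly σ τ) (SPoly σ τ ⧸ I.asIdeal) :=
  { Ideal.Quotient.mkₐ ℂ I.asIdeal with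
    map_part := fun _ a ha => ⟨a, ha, rfl⟩ }

theorem eval_var (f : SPoly σ τ) : eval var var_homog f = f := by
  have : eval var var_homog = AlgHom.id ℂ (SPoly σ τ) :=
    algHom_ext (fun s => eval_x _ _ s) (fun t => eval_θ _ _ t)
  exact DFunLike.congr_fun this f

/-- The coefficient with respect to the odd variables given by a linear form on the exterior
algebra. -/
noncomputable def coeff (ℓ : ExteriorAlgebra ℂ (τ →₀ ℂ) →ₗ[ℂ] ℂ) :
    SPoly σ τ →ₗ[ℂ] MvPolynomial σ ℂ :=
  (TensorProduct.rid ℂ (MvPolynomial σ ℂ)).toLinearMap.comp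
    (LinearMap.lTensor (MvPolynomial σ ℂ) ℓ)

theorem coeff_tmul (ℓ : ExteriorAlgebra ℂ (τ →₀ ℂ) →ₗ[ℂ] ℂ) (p : MvPolynomial σ ℂ)
    (w : ExteriorAlgebra ℂ (τ →₀ ℂ)) : coeff ℓ (tmul p w) = ℓ w • p := by
  change TensorProduct.rid ℂ (MvPolynomial σ ℂ) (p ⊗ₜ ℓ w) = _
  rw [TensorProduct.rid_tmul]

theorem θ_mul_θ_coeff (σ : Type) : ∃ c : SPoly σ (Fin 2) →ₗ[ℂ] MvPolynomial σ ℂ,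
    ∀ p, c (tmul p 1 * (θ 0 * θ 1)) = p := by
  -- The determinant in exterior degree two, and zero in all other degrees.
  let ℓ : ExteriorAlgebra ℂ (Fin 2 →₀ ℂ) →ₗ[ℂ] ℂ := ExteriorAlgebra.liftAlternating
    (Pi.single 2 ((Matrix.detRowAlternating (n := Fin 2) (R := ℂ)).compLinearMap
      (Finsupp.linearEquivFunOnFinite ℂ ℂ (Fin 2)).toLinearMap))
  refine ⟨coeff ℓ, fun p => ?_⟩
  rw [θ, θ, tmul_mul_tmul, tmul_mul_tmul, coeff_tmul, one_mul, one_mul, mul_one]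
  have : ℓ (ExteriorAlgebra.ι ℂ (Finsupp.single 0 1) * ExteriorAlgebra.ι ℂ (Finsupp.single 1 1)) =
      1 := by
    have e := ExteriorAlgebra.liftAlternating_apply_ιMulti (Pi.single 2
      ((Matrix.detRowAlternating (n := Fin 2) (R := ℂ)).compLinearMap
      (Finsupp.linearEquivFunOnFinite ℂ ℂ (Fin 2)).toLinearMap))
      ![(Finsupp.single 0 1 : Fin 2 →₀ ℂ), Finsupp.single 1 1]
    rw [ExteriorAlgebra.ιMulti_apply] at e
    simp only [List.ofFn_succ, List.ofFn_zero, List.prod_cons, List.prod_nil, mul_one] at e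
    refine e.trans ?_
    rw [Pi.single_eq_same, AlternatingMap.compLinearMap_apply]
    exact (Matrix.det_fin_two _).trans (by simp)
  rw [this, one_smul]

theorem one_coeff (σ : Type) : ∃ c : SPoly σ (Fin 2) →ₗ[ℂ] MvPolynomial σ ℂ,
    (∀ p, c (tmul p 1) = p) ∧ (∀ p k, c (tmul p 1 * θ k) = 0) ∧
      ∀ p, c (tmul p 1 * (θ 0 * θ 1)) = 0 := by
  refine ⟨coeff ExteriorAlgebra.algebraMapInv.toLinearMap, fun p => ?_, fun p k => ?_,
    fun p => ?_⟩
  · rw [coeff_tmul]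
    simp
  · rw [θ, tmul_mul_tmul, coeff_tmul]
    simp [ExteriorAlgebra.algebraMapInv]
  · rw [θ, θ, tmul_mul_tmul, tmul_mul_tmul, coeff_tmul]
    simp [ExteriorAlgebra.algebraMapInv]

theorem θ_coeff (σ : Type) (k : Fin 2) : ∃ c : SPoly σ (Fin 2) →ₗ[ℂ] MvPolynomial σ ℂ,
    (∀ p l, c (tmul p 1 * θ l) = if l = k then p else 0) ∧
      ∀ p, c (tmul p 1 * (θ 0 * θ 1)) = 0 := by
  refine ⟨coeff ((Finsupp.lapply k).comp ExteriorAlgebra.ιInv), fun p l => ?_, fun p => ?_⟩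
  · rw [θ, tmul_mul_tmul, coeff_tmul, mul_one, one_mul, LinearMap.comp_apply,
      ExteriorAlgebra.ι_leftInverse]
    simp [Finsupp.single_apply]
  · rw [θ, θ, tmul_mul_tmul, tmul_mul_tmul, coeff_tmul, one_mul, LinearMap.comp_apply,
      ιInv_ι_mul_ι]
    simp

end SPoly

end SuperGr

/-! ### Completeness of the Plücker relations. -/

namespace SuperGr

open SuperAlgebra

/-! ### Normal forms in the coordinate ring of the Grassmannian -/

section NormalForm

open MvPolynomial (X)

/-- The Plücker coordinates in `𝒪(Gr)`. -/
noncomputable def grVar : EvenIdx ⊕ Fin 4 → GrRing := (SPoly.mkHom pluckerIdeal).vec SPoly.var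

theorem grVar_homog : IsHomog 0 grVar := (SPoly.mkHom pluckerIdeal).vec_homog SPoly.var_homog

theorem eval_grVar (f : PluckerPoly) :
    SPoly.eval grVar grVar_homog f = Ideal.Quotient.mk pluckerIdeal.asIdeal f := by
  refine (SPoly.map_eval (SPoly.mkHom pluckerIdeal) SPoly.var_homog f).symm.trans ?_
  rw [SPoly.eval_var]
  rfl

theorem isPluckerVec_grVar : IsPluckerVec grVar grVar_homog := fun f hf => by
  rw [eval_grVar]
  exact Ideal.Quotient.eq_zero_iff_mem.2
    (TwoSidedIdeal.mem_asIdeal.2 (TwoSidedIdeal.subset_span hf))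

theorem adjoin_range_grVar : Algebra.adjoin ℂ (Set.range grVar) = ⊤ := by
  have h : Set.range grVar = Ideal.Quotient.mkₐ ℂ pluckerIdeal.asIdeal '' Set.range SPoly.var := by
    rw [← Set.range_comp]
    rfl
  rw [h, ← AlgHom.map_adjoin, SPoly.adjoin_range_var, Algebra.map_top,
    (AlgHom.range_eq_top _).2 (Ideal.Quotient.mkₐ_surjective ℂ _)]

/-- The enumeration of the `q_ij` used for `QPoly`. -/
def qIdx : Fin 6 → EvenIdx :=
  ![.q 0 1 (by decide), .q 0 2 (by decide), .q 0 3 (by decide), .q 1 2 (by decide),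
    .q 1 3 (by decide), .q 2 3 (by decide)]

theorem exists_qIdx_eq (i j : Fin 4) (h : i < j) : ∃ k, qIdx k = .q i j h := by
  fin_cases i <;> fin_cases j <;> first
    | exact absurd h (by decide)
    | exact ⟨0, rfl⟩
    | exact ⟨1, rfl⟩
    | exact ⟨2, rfl⟩
    | exact ⟨3, rfl⟩
    | exact ⟨4, rfl⟩
    | exact ⟨5, rfl⟩

/-- Polynomials in the `q_ij` as elements of `𝒪(Gr)`. -/
noncomputable def ofQ : QPoly →ₐ[ℂ] GrRing :=
  (evenPart GrRing).val.comp (MvPolynomial.aeval fun i => grVar_homog.evenCoord (qIdx i))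

theorem ofQ_X (i : Fin 6) : ofQ (X i) = grVar (.inl (qIdx i)) := by
  rw [ofQ, AlgHom.comp_apply, MvPolynomial.aeval_X]
  rfl

theorem ofQ_mem (p : QPoly) : ofQ p ∈ part (A := GrRing) 0 :=
  Subtype.prop (MvPolynomial.aeval (fun i => grVar_homog.evenCoord (qIdx i)) p)

theorem exists_ofQ_eq_skew (i j : Fin 4) : ∃ p, ofQ p = skew grVar i j := by
  have key : ∀ i j, i < j → ∃ p, ofQ p = skew grVar i j := fun i j h => by
    obtain ⟨k, hk⟩ := exists_qIdx_eq i j h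
    exact ⟨X k, by rw [ofQ_X, hk, skew_of_lt _ h]⟩
  rcases lt_trichotomy i j with h | rfl | h
  · exact key i j h
  · exact ⟨0, by rw [map_zero, skew_self]⟩
  · obtain ⟨p, hp⟩ := key j i h
    exact ⟨-p, by rw [map_neg, hp, ← skew_swap]⟩

/-- The element `p + ∑ m_k λ_k + c a_55`. -/
noncomputable def normalForm (p : QPoly) (m : Fin 4 → QPoly) (c : QPoly) : GrRing :=
  ofQ p + ∑ k, ofQ (m k) * grVar (.inr k) + ofQ c * grVar (.inl .a55)

/-- The elements of the form `p + ∑ m_k λ_k + c a_55`. -/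
noncomputable def normalForms : Submodule ℂ GrRing where
  carrier := {g | ∃ p m c, g = normalForm p m c}
  add_mem' := by
    rintro _ _ ⟨p, m, c, rfl⟩ ⟨p', m', c', rfl⟩
    refine ⟨p + p', m + m', c + c', ?_⟩
    simp only [normalForm, Pi.add_apply, map_add, add_mul, Finset.sum_add_distrib]
    abel
  zero_mem' := ⟨0, 0, 0, by simp [normalForm]⟩
  smul_mem' := by
    rintro a _ ⟨p, m, c, rfl⟩
    refine ⟨a • p, a • m, a • c, ?_⟩
    simp only [normalForm, Pi.smul_apply, map_smul, smul_add, Finset.smul_sum, smul_mul_assoc]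

theorem lam_mul_a55 (j : Fin 4) : grVar (.inr j) * grVar (.inl .a55) = 0 := by
  have := isPluckerVec_grVar _ (.lam_a j)
  simpa only [lam, a55, map_mul, SPoly.eval_x, SPoly.eval_θ] using this

/-- The relations `λ_j λ_k = a_55 q_jk`, `λ_k a_55 = 0` and `a_55² = 0` rewrite every product with
an odd coordinate or with `a_55`. -/
theorem grVar_mul_mem (j : EvenIdx ⊕ Fin 4) {g : GrRing} (hg : g ∈ normalForms) :
    grVar j * g ∈ normalForms := by
  obtain ⟨p, m, c, rfl⟩ := hg
  have hcomm : ∀ (p : QPoly) j, grVar j * ofQ p = ofQ p * grVar j := fun p j =>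
    (commute_of_even (ofQ_mem p) _).symm
  have hcomm' : ∀ (p : QPoly) j h, grVar j * (ofQ p * h) = ofQ p * (grVar j * h) :=
    fun p j h => by rw [← mul_assoc, hcomm, mul_assoc]
  rcases j with (⟨i, j, h⟩ | _) | j
  · obtain ⟨k, hk⟩ := exists_qIdx_eq i j h
    rw [← hk, ← ofQ_X]
    refine ⟨X k * p, fun l => X k * m l, X k * c, ?_⟩
    simp only [normalForm, mul_add, Finset.mul_sum, map_mul, mul_assoc]
  · have hl : ∀ k, grVar (.inl .a55) * grVar (.inr k) = 0 := fun k => by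
      rw [commute_of_even (SPoly.inl_mem grVar_homog .a55), lam_mul_a55]
    refine ⟨0, 0, p, ?_⟩
    simp only [normalForm, mul_add, Finset.mul_sum, hcomm, hcomm', hl,
      isPluckerVec_grVar.a55_mul_a55]
    simp
  · choose s hs using exists_ofQ_eq_skew j
    refine ⟨0, Pi.single j p, ∑ k, m k * s k, ?_⟩
    simp only [normalForm, mul_add, Finset.mul_sum, hcomm, hcomm', lam_mul_a55,
      isPluckerVec_grVar.lam_mul_lam, ← hs]
    have hsum : ∑ k, ofQ ((Pi.single j p : Fin 4 → QPoly) k) * grVar (.inr k) =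
        ofQ p * grVar (.inr j) := by
      rw [Finset.sum_eq_single j
        (by intro k _ hk; rw [Pi.single_eq_of_ne hk, map_zero, zero_mul]) (by simp),
        Pi.single_eq_same]
    rw [hsum, map_zero, mul_zero, add_zero, zero_add, map_sum, Finset.sum_mul]
    refine congrArg _ (Finset.sum_congr rfl fun k _ => ?_)
    rw [map_mul, mul_assoc]

/-- The elements whose left multiplication preserves `normalForms` form a subalgebra containing the
generators; it is then applied to `1`. -/
theorem exists_normalForm (g : GrRing) : ∃ p m c, g = normalForm p m c := by
  let B : Subalgebra ℂ GrRing :=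
    { carrier := {g | ∀ f ∈ normalForms, g * f ∈ normalForms}
      mul_mem' := fun {a b} ha hb f hf => by
        rw [mul_assoc]
        exact ha _ (hb f hf)
      add_mem' := fun {a b} ha hb f hf => by
        rw [add_mul]
        exact normalForms.add_mem (ha f hf) (hb f hf)
      algebraMap_mem' := fun r f hf => by
        rw [← Algebra.smul_def]
        exact normalForms.smul_mem r hf }
  have hB : (⊤ : Subalgebra ℂ GrRing) ≤ B := by
    rw [← adjoin_range_grVar, Algebra.adjoin_le_iff]
    rintro _ ⟨j, rfl⟩ f hf
    exact grVar_mul_mem j hf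
  have h1 : (1 : GrRing) ∈ normalForms := ⟨1, 0, 0, by simp [normalForm]⟩
  have := hB (Algebra.mem_top (x := g)) 1 h1
  rwa [mul_one] at this

theorem ofQ_eq_zero {p : QPoly} (h : quadric ∣ p) : ofQ p = 0 := by
  obtain ⟨r, rfl⟩ := h
  have := isPluckerVec_grVar _ .classical
  simp only [q, map_add, map_sub, map_mul, SPoly.eval_x] at this
  rw [map_mul]
  simp only [quadric, map_add, map_sub, map_mul, ofQ_X]
  change (grVar (.inl (.q 0 1 _)) * grVar (.inl (.q 2 3 _)) -
    grVar (.inl (.q 0 2 _)) * grVar (.inl (.q 1 3 _)) +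
    grVar (.inl (.q 0 3 _)) * grVar (.inl (.q 1 2 _))) * ofQ r = 0
  rw [this, zero_mul]

/-- Here `n k` is the coefficient, up to the sign `-, +, -, +`, of the three-term relation that
omits the index `k`. -/
theorem sum_ofQ_mul_lam_eq_zero (m n : Fin 4 → QPoly)
    (h0 : m 0 = X 5 * n 1 - X 4 * n 2 + X 3 * n 3) (h1 : m 1 = -(X 5 * n 0) + X 2 * n 2 - X 1 * n 3)
    (h2 : m 2 = X 4 * n 0 - X 2 * n 1 + X 0 * n 3)
    (h3 : m 3 = -(X 3 * n 0) + X 1 * n 1 - X 0 * n 2) :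
    ∑ k, ofQ (m k) * grVar (.inr k) = 0 := by
  have key : ∀ (a b c : Fin 6) (i j k : Fin 4) (hij : i < j) (hjk : j < k),
      qIdx a = .q i j hij → qIdx b = .q i k (hij.trans hjk) → qIdx c = .q j k hjk →
      ∀ p, ofQ (X a * p) * grVar (.inr k) - ofQ (X b * p) * grVar (.inr j) +
        ofQ (X c * p) * grVar (.inr i) = 0 := by
    intro a b c i j k hij hjk ha hb hc p
    have := isPluckerVec_grVar.skew_mul_lam i j k
    rw [skew_of_lt _ hij, skew_of_lt _ hjk, skew_of_lt _ (hij.trans hjk), ← ha, ← hb, ← hc,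
      ← ofQ_X, ← ofQ_X, ← ofQ_X] at this
    rw [mul_comm _ p, mul_comm _ p, mul_comm _ p, map_mul, map_mul, map_mul, mul_assoc, mul_assoc,
      mul_assoc, ← mul_sub, ← mul_add, this, mul_zero]
  have e0 := key 3 4 5 1 2 3 (by decide) (by decide) rfl rfl rfl (n 0)
  have e1 := key 1 2 5 0 2 3 (by decide) (by decide) rfl rfl rfl (n 1)
  have e2 := key 0 2 4 0 1 3 (by decide) (by decide) rfl rfl rfl (n 2)
  have e3 := key 0 1 3 0 1 2 (by decide) (by decide) rfl rfl rfl (n 3)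
  have e : ∀ a b c d : GrRing, a = 0 → b = 0 → c = 0 → d = 0 → -a + b - c + d = 0 := by
    rintro _ _ _ _ rfl rfl rfl rfl
    simp
  rw [← e _ _ _ _ e0 e1 e2 e3, Fin.sum_univ_four, h0, h1, h2, h3]
  simp only [map_add, map_sub, map_neg, add_mul, sub_mul, neg_mul]
  abel

end NormalForm

/-! ### The big cell -/

section Cell

open MvPolynomial (X)

/-- The coordinate superalgebra of the big cell, with a scaling factor. -/
abbrev CellRing : Type := SPoly (Fin 5) (Fin 2)

/-- The first basis vector of the universal plane in the big cell. -/
noncomputable def cellA : Fin 4 ⊕ Fin 1 → CellRing :=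
  Sum.elim ![1, 0, SPoly.x 1, SPoly.x 2] fun _ => SPoly.θ 0

/-- The second basis vector of the universal plane in the big cell. -/
noncomputable def cellB : Fin 4 ⊕ Fin 1 → CellRing :=
  Sum.elim ![0, 1, SPoly.x 3, SPoly.x 4] fun _ => SPoly.θ 1

theorem cellA_homog : IsHomog 0 cellA := by
  rintro (j | j)
  · have : cellA (.inl j) ∈ part (A := CellRing) 0 := by
      fin_cases j
      · exact one_mem
      · exact Submodule.zero_mem _
      · exact SPoly.x_mem _
      · exact SPoly.x_mem _
    exact this
  · exact SPoly.θ_mem 0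

theorem cellB_homog : IsHomog 0 cellB := by
  rintro (j | j)
  · have : cellB (.inl j) ∈ part (A := CellRing) 0 := by
      fin_cases j
      · exact Submodule.zero_mem _
      · exact one_mem
      · exact SPoly.x_mem _
      · exact SPoly.x_mem _
    exact this
  · exact SPoly.θ_mem 1

/-- The Plücker coordinates of the universal plane in the big cell, up to a scaling factor. -/
noncomputable def cellVec : EvenIdx ⊕ Fin 4 → CellRing :=
  (SPoly.x 0 : CellRing) • wedge cellA cellB

theorem cellVec_homog : IsHomog 0 cellVec :=
  (wedge_homog cellA_homog cellB_homog).even_smul (SPoly.x_mem 0)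

theorem isPluckerVec_cellVec : IsPluckerVec cellVec cellVec_homog := fun f hf =>
  (eval_rel_smul (wedge_homog cellA_homog cellB_homog) (SPoly.x_mem 0) hf).trans (by
    rw [isPluckerVec_wedge cellA_homog cellB_homog f hf, mul_zero])

/-- The restriction from `𝒪(Gr)` to the big cell. -/
noncomputable def toCell : GrRing →ₐ[ℂ] CellRing :=
  Ideal.Quotient.liftₐ _ (SPoly.eval cellVec cellVec_homog) fun _ hf =>
    isPluckerVec_cellVec.eval_eq_zero (TwoSidedIdeal.mem_asIdeal.1 hf)

theorem toCell_mk (f : PluckerPoly) : toCell (Ideal.Quotient.mk pluckerIdeal.asIdeal f) =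
    SPoly.eval cellVec cellVec_homog f := rfl

theorem toCell_grVar (j : EvenIdx ⊕ Fin 4) : toCell (grVar j) = cellVec j := by
  refine (toCell_mk (SPoly.var j)).trans ?_
  rcases j with j | j
  · exact SPoly.eval_x _ _ _
  · exact SPoly.eval_θ _ _ _

/-- The inclusion of the even polynomials in the coordinate superalgebra of the big cell. -/
noncomputable def cellIncl : CellPoly →ₐ[ℂ] CellRing := Algebra.TensorProduct.includeLeft

theorem cellIncl_apply (p : CellPoly) : cellIncl p = SPoly.tmul p 1 := rfl

theorem cellIncl_X (i : Fin 5) : cellIncl (X i) = SPoly.x i := rfl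

theorem cellIncl_mem (p : CellPoly) : cellIncl p ∈ part (A := CellRing) 0 :=
  Submodule.subset_span ⟨p, 1,
    CliffordAlgebra.one_le_evenOdd_zero _ (Submodule.mem_one.2 ⟨1, by simp⟩), rfl⟩

theorem toCell_ofQ (p : QPoly) : toCell (ofQ p) = cellIncl (quadricParam p) := by
  have : toCell.comp ofQ = cellIncl.comp quadricParam := by
    apply MvPolynomial.algHom_ext
    intro i
    rw [AlgHom.comp_apply, AlgHom.comp_apply, ofQ_X, toCell_grVar, quadricParam_X, cellVec]
    fin_cases i <;> simp [qIdx, wedge, cellA, cellB, cellIncl_X]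
  exact DFunLike.congr_fun this p

theorem toCell_lam (k : Fin 4) : toCell (grVar (.inr k)) =
    cellIncl (X 0 * ![1, 0, X 1, X 2] k) * SPoly.θ 1 -
      cellIncl (X 0 * ![0, 1, X 3, X 4] k) * SPoly.θ 0 := by
  have ha : cellA (.inl k) = cellIncl (![1, 0, X 1, X 2] k) := by
    fin_cases k <;> simp [cellA, cellIncl_X]
  have hb : cellB (.inl k) = cellIncl (![0, 1, X 3, X 4] k) := by
    fin_cases k <;> simp [cellB, cellIncl_X]
  rw [toCell_grVar, cellVec, Pi.smul_apply, wedge_lam cellA_homog, ha, hb,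
    ← commute_of_even (cellIncl_mem _), smul_eq_mul, ← cellIncl_X, mul_sub, ← mul_assoc,
    ← mul_assoc, ← map_mul, ← map_mul]
  rfl

theorem toCell_a55 :
    toCell (grVar (.inl .a55)) = cellIncl (X 0) * (SPoly.θ 0 * SPoly.θ 1) := by
  rw [toCell_grVar, cellVec, Pi.smul_apply, wedge_a55 cellA_homog, cellIncl_X, smul_eq_mul]
  change SPoly.x 0 * -(SPoly.θ 1 * SPoly.θ 0) = _
  rw [← odd_mul_odd (SPoly.θ_mem 0) (SPoly.θ_mem 1)]

/-- The coefficients of `θ 1` and `-θ 0` are, up to the factor `X 0`, the pairings of `m` with the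
two rows of the cell: this is the syzygy condition of `exists_of_syzygy`. -/
theorem toCell_normalForm (p : QPoly) (m : Fin 4 → QPoly) (c : QPoly) :
    toCell (normalForm p m c) = cellIncl (quadricParam p) +
      cellIncl (X 0 * (quadricParam (m 0) + quadricParam (m 2) * X 1 + quadricParam (m 3) * X 2)) *
        SPoly.θ 1 -
      cellIncl (X 0 * (quadricParam (m 1) + quadricParam (m 2) * X 3 + quadricParam (m 3) * X 4)) *
        SPoly.θ 0 +
      cellIncl (X 0 * quadricParam c) * (SPoly.θ 0 * SPoly.θ 1) := by
  have ha : X 0 * (quadricParam (m 0) + quadricParam (m 2) * X 1 + quadricParam (m 3) * X 2) =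
      quadricParam (m 0) * X 0 * 1 + quadricParam (m 1) * X 0 * 0 +
        quadricParam (m 2) * X 0 * X 1 + quadricParam (m 3) * X 0 * X 2 := by ring
  have hb : X 0 * (quadricParam (m 1) + quadricParam (m 2) * X 3 + quadricParam (m 3) * X 4) =
      quadricParam (m 0) * X 0 * 0 + quadricParam (m 1) * X 0 * 1 +
        quadricParam (m 2) * X 0 * X 3 + quadricParam (m 3) * X 0 * X 4 := by ring
  rw [ha, hb, mul_comm (X 0)]
  simp only [normalForm, map_add, map_mul, Fin.sum_univ_four, toCell_ofQ, toCell_lam, toCell_a55,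
    Matrix.cons_val, mul_sub, add_mul, mul_assoc]
  abel

/-- The coefficients in the odd variables vanish separately, and `X 0` cancels in a domain. What
remains says that `p` and `c` are multiples of the quadric and that `m` comes from three-term
relations. -/
theorem eq_zero_of_toCell_eq_zero {g : GrRing} (hg : toCell g = 0) : g = 0 := by
  obtain ⟨p, m, c, rfl⟩ := exists_normalForm g
  rw [toCell_normalForm] at hg
  have hX : (X 0 : CellPoly) ≠ 0 := MvPolynomial.X_ne_zero _
  have hp : quadricParam p = 0 := by
    obtain ⟨k, k0, k1, k2⟩ := SPoly.one_coeff (Fin 5)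
    have := congrArg k hg
    rw [map_add, map_sub, map_add, map_zero] at this
    simp only [cellIncl_apply, k0, k1, k2, sub_zero, add_zero] at this
    exact this
  have ha : quadricParam (m 0) + quadricParam (m 2) * X 1 + quadricParam (m 3) * X 2 = 0 := by
    obtain ⟨k, k1, k2⟩ := SPoly.θ_coeff (Fin 5) 1
    have := congrArg k hg
    rw [hp, map_zero, zero_add, map_add, map_sub, map_zero] at this
    simp only [cellIncl_apply, k1, k2] at this
    simpa [hX] using this
  have hb : quadricParam (m 1) + quadricParam (m 2) * X 3 + quadricParam (m 3) * X 4 = 0 := by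
    obtain ⟨k, k1, k2⟩ := SPoly.θ_coeff (Fin 5) 0
    have := congrArg k hg
    rw [hp, map_zero, zero_add, map_add, map_sub, map_zero] at this
    simp only [cellIncl_apply, k1, k2] at this
    simpa [hX] using this
  have hc : quadricParam c = 0 := by
    rw [hp, ha, hb] at hg
    simp only [mul_zero, map_zero, zero_mul, zero_add, sub_zero] at hg
    obtain ⟨k, hk⟩ := SPoly.θ_mul_θ_coeff (Fin 5)
    have := (hk _).symm.trans (congrArg k hg)
    rw [map_zero] at this
    exact (mul_eq_zero.1 this).resolve_left hX
  obtain ⟨n, h0, h1, h2, h3⟩ := exists_of_syzygy m ha hb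
  rw [normalForm, sum_ofQ_mul_lam_eq_zero m n h0 h1 h2 h3,
    ofQ_eq_zero (quadric_dvd_of_quadricParam_eq_zero hp),
    ofQ_eq_zero (quadric_dvd_of_quadricParam_eq_zero hc)]
  simp

/-- `I_P` is the ideal of all relations between the Plücker coordinates on the big cell. -/
theorem mem_pluckerIdeal_of_eval_cellVec {f : PluckerPoly}
    (hf : SPoly.eval cellVec cellVec_homog f = 0) : f ∈ pluckerIdeal :=
  TwoSidedIdeal.mem_asIdeal.1 (Ideal.Quotient.eq_zero_iff_mem.1
    (eq_zero_of_toCell_eq_zero ((toCell_mk f).trans hf)))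

end Cell

end SuperGr

/-! ### Affine charts, determinants and the ideal of all relations. -/

namespace SuperGr

open SuperAlgebra

/-! ### Free planes -/

theorem pairing_single {R : Type*} [Ring R] {σ τ : Type*} [Fintype σ] [Fintype τ] [DecidableEq σ]
    [DecidableEq τ] (j : σ ⊕ τ) (v : σ ⊕ τ → R) : pairing (Pi.single j 1) v = v j := by
  rw [pairing_apply, Finset.sum_eq_single j]
  · simp
  · intro b _ hb
    simp [hb]
  · simp

section Free

variable {A : Type*} [Ring A] [Algebra ℂ A] [SuperAlgebra A]

theorem isPoint_span_of_dual {σ τ : Type*} [Fintype σ] [Fintype τ] {r : ℕ}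
    {b c : Fin r → σ ⊕ τ → A} (homog : ∀ k, IsHomog 0 (b k))
    (dual : ∀ k l, pairing (c l) (b k) = if k = l then 1 else 0) :
    IsPoint r (Submodule.span A (Set.range b)) := by
  refine IsPoint.of_frames fun p hp => ?_
  obtain ⟨c', h⟩ := isFrame_of_mem_span (t := 1) (L := Submodule.span A (Set.range b)) (b := b)
    (c := c) (fun k => Submodule.subset_span ⟨k, rfl⟩) homog dual
    (fun v hv => Submodule.smul_mem _ _ hv)
  refine ⟨1 * 1, ?_, b, c', h⟩
  rw [mul_one]
  exact fun h => hp.ne_top ((Ideal.eq_top_iff_one p).2 h)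

theorem isProjPoint_span {Q : EvenIdx ⊕ Fin 4 → A} {hQ : IsHomog 0 Q} (h : IsPluckerVec Q hQ)
    {i : EvenIdx} (hi : Q (.inl i) = 1) :
    IsProjPoint pluckerIdeal (Submodule.span A {Q}) := by
  classical
  refine ⟨?_, fun Q' hQ' hQ'h => fun f hf => IsPluckerVec.eval_eq_zero (fun r hr => ?_) hf⟩
  · have := isPoint_span_of_dual (b := fun _ : Fin 1 => Q)
      (c := fun _ => Pi.single (.inl i) 1) (fun _ => hQ)
      (fun k l => by rw [if_pos (Subsingleton.elim k l), pairing_single, hi])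
    rwa [Set.range_const] at this
  · obtain ⟨x, rfl⟩ := Submodule.mem_span_singleton.1 hQ'
    have hx : x ∈ part (A := A) 0 := by
      have := SPoly.inl_mem hQ'h i
      rw [Pi.smul_apply, hi, smul_eq_mul, mul_one] at this
      exact this
    rw [eval_rel_smul hQ hx hr, h r hr, mul_zero]

/-- A projective point with a coordinate equal to `1` is generated by a unique vector. -/
theorem exists_generator {M : Submodule A (EvenIdx ⊕ Fin 4 → A)} (hM : IsPoint 1 M)
    {i : EvenIdx} (hi : ∃ Q ∈ M, Q (.inl i) = 1) :
    ∃ Q ∈ M, IsHomog 0 Q ∧ Q (.inl i) = 1 ∧ Submodule.span A {Q} = M := by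
  obtain ⟨Q', hQ', hi⟩ := hi
  obtain ⟨Q, hQ, Q₁, hQ₁, h₀, h₁, hadd⟩ := hM.graded Q' hQ'
  have hQi : Q (.inl i) = 1 := by
    refine eq_of_add_eq (i := 0) (a₁ := Q₁ (.inl i)) (b₁ := 0) (SPoly.inl_mem h₀ i) ?_ one_mem
      (Submodule.zero_mem _) ?_
    · have := h₁ (.inl i)
      exact this
    · rw [add_zero, ← hi, ← hadd]
      rfl
  refine ⟨Q, hQ, h₀, hQi, le_antisymm ((Submodule.span_singleton_le_iff_mem _ _).2 hQ)
    fun m hm => ?_⟩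
  refine Submodule.mem_span_singleton.2 ⟨m (.inl i), (sub_eq_zero.1 ?_).symm⟩
  refine eq_zero_of_local (A := A) fun p hp => ?_
  obtain ⟨s, hs, b, c, h⟩ := hM.exists_frame p hp
  refine ⟨s * s, fun h => (hp.mem_or_mem h).elim hs hs, ?_⟩
  have hy : pairing (c 0) Q ∈ part (A := A) 0 := by
    simpa using pairing_mem h₀ (h.homog_form 0)
  have hm' : (s : A) • m = pairing (c 0) m • b 0 := by simpa using h.expand m hm
  have hQ' : (s : A) • Q = pairing (c 0) Q • b 0 := by simpa using h.expand Q hQ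
  -- The normalization `Q_i = 1` makes the `i`-th coordinate of the local generator a divisor of
  -- `s`; comparing `m` and `m_i Q` through `b 0` then gives equality after multiplication by `s *
  -- s`.
  have hs' : (s : A) = pairing (c 0) Q * b 0 (.inl i) := by
    have := congrFun hQ' (.inl i)
    rwa [Pi.smul_apply, Pi.smul_apply, hQi, smul_eq_mul, smul_eq_mul, mul_one] at this
  have hmi : (s : A) * m (.inl i) = pairing (c 0) m * b 0 (.inl i) := congrFun hm' (.inl i)
  have e₁ : (s : A) • (s : A) • m = (pairing (c 0) m * s) • b 0 := by
    rw [hm', smul_smul, commute_of_even s.2]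
  have e₂ : (s : A) • (s : A) • m (.inl i) • Q = (pairing (c 0) m * s) • b 0 := by
    rw [even_smul_comm s.2 (m (.inl i)) Q, hQ', smul_smul, smul_smul, hmi, mul_assoc,
      ← commute_of_even hy (b 0 _), ← hs']
  rw [Subalgebra.coe_mul, mul_smul, smul_sub, smul_sub, e₁, e₂, sub_self]

end Free

/-! ### Affine charts -/

namespace SPoly

variable {σ τ : Type} {A : Type*} [Ring A] [Algebra ℂ A] [SuperAlgebra A]

/-- Substitution as a morphism of superalgebras. -/
noncomputable def evalHom (Q : σ ⊕ τ → A) (hQ : IsHomog 0 Q) : SuperHom (SPoly σ τ) A :=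
  { eval Q hQ with map_part := fun _ _ hf => eval_mem hQ hf }

variable {I : TwoSidedIdeal (SPoly σ τ)} {i : σ}

theorem chartVar_self : chartVar I i (.inl i) = 1 := by
  have : (affVar i (.inl i) : SPoly {s : σ // s ≠ i} τ) = 1 := by simp [affVar]
  rw [chartVar, this, map_one]

theorem adjoin_range_chartVar : Algebra.adjoin ℂ (Set.range (chartVar I i)) = ⊤ := by
  have h : Set.range (chartVar I i) =
      Ideal.Quotient.mkₐ ℂ (locIdeal I i).asIdeal '' Set.range (affVar i) := by
    rw [← Set.range_comp]
    rfl
  have h' : Algebra.adjoin ℂ (Set.range (affVar i : σ ⊕ τ → SPoly {s : σ // s ≠ i} τ)) = ⊤ := by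
    rw [eq_top_iff, ← adjoin_range_var]
    refine Algebra.adjoin_mono ?_
    rintro _ ⟨⟨s, hs⟩ | t, rfl⟩
    · exact ⟨.inl s, by simp [affVar, hs, var]⟩
    · exact ⟨.inr t, rfl⟩
  rw [h, ← AlgHom.map_adjoin, h', Algebra.map_top,
    (AlgHom.range_eq_top _).2 (Ideal.Quotient.mkₐ_surjective ℂ _)]

theorem superHom_ext {B : Type*} [Ring B] [Algebra ℂ B] [SuperAlgebra B] {φ ψ : SuperHom A B}
    (h : φ.toAlgHom = ψ.toAlgHom) : φ = ψ := by
  cases φ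
  cases ψ
  congr

variable [HomogIdeal I]

theorem chartVar_homog : IsHomog 0 (chartVar I i) :=
  (mkHom (locIdeal I i)).vec_homog (affVar_homog i)

theorem eval_chartVar {f : SPoly σ τ} (hf : f ∈ I) :
    eval (chartVar I i) chartVar_homog f = 0 := by
  refine (map_eval (mkHom (locIdeal I i)) (affVar_homog i) f).symm.trans ?_
  exact Ideal.Quotient.eq_zero_iff_mem.2 (TwoSidedIdeal.mem_asIdeal.2
    (TwoSidedIdeal.subset_span ⟨f, hf, rfl⟩))

theorem chart_superHom_ext {φ ψ : SuperHom (Chart I i) A}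
    (h : ∀ j, φ.toAlgHom (chartVar I i j) = ψ.toAlgHom (chartVar I i j)) : φ = ψ := by
  refine superHom_ext (AlgHom.ext_of_adjoin_eq_top adjoin_range_chartVar ?_)
  rintro _ ⟨j, rfl⟩
  exact h j

/-- The universal property of the chart: `affVar i` is the universal even vector with `i`-th
coordinate `1`, and specializing it to `Q` sends the dehomogenization of `f` to the value of `f` at
`Q`. -/
theorem exists_chartHom {Q : σ ⊕ τ → A} (hQ : IsHomog 0 Q) (hi : Q (.inl i) = 1)
    (hI : ∀ f ∈ I, eval Q hQ f = 0) :
    ∃ ψ : SuperHom (Chart I i) A, ∀ j, ψ.toAlgHom (chartVar I i j) = Q j := by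
  let Q' : {s : σ // s ≠ i} ⊕ τ → A := Sum.elim (fun s => Q (.inl s)) fun t => Q (.inr t)
  have hQ' : IsHomog 0 Q' := by
    rintro (s | t)
    · exact hQ (.inl s)
    · exact hQ (.inr t)
  have hvec : (evalHom Q' hQ').vec (affVar i) = Q := by
    funext j
    rcases j with s | t
    · change eval Q' hQ' (affVar i (.inl s)) = _
      by_cases hs : s = i
      · subst hs
        simp [affVar, hi]
      · simp only [affVar, Sum.elim_inl, hs, dite_false, eval_x]
        rfl
    · exact eval_θ Q' hQ' t
  have hker : ∀ f ∈ (locIdeal I i).asIdeal, eval Q' hQ' f = 0 := by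
    have : locIdeal I i ≤ TwoSidedIdeal.ker (eval Q' hQ') := by
      refine TwoSidedIdeal.span_le.2 ?_
      rintro _ ⟨f, hf, rfl⟩
      refine (TwoSidedIdeal.mem_ker _).2 ((map_eval (evalHom Q' hQ') (affVar_homog i) f).trans ?_)
      rw [eval_congr hvec _ hQ, hI f hf]
    exact fun f hf => (TwoSidedIdeal.mem_ker _).1 (this (TwoSidedIdeal.mem_asIdeal.1 hf))
  refine ⟨{ Ideal.Quotient.liftₐ _ (eval Q' hQ') hker with map_part := ?_ }, fun j => ?_⟩
  · rintro k _ ⟨f, hf, rfl⟩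
    exact eval_mem hQ' hf
  · exact congrFun hvec j

end SPoly

/-- Normalizing the `i`-th coordinate to `1` picks out a unique generator of the line, so morphisms
from the chart are the lines of this kind satisfying the relations; by `bijOn_wedgeSq` these are the
`∧²L`. -/
theorem bijOn_chart (i : EvenIdx) (A : Type*) [Ring A] [Algebra ℂ A] [SuperAlgebra A] :
    Set.BijOn
      (fun ψ : SuperHom (SPoly.Chart pluckerIdeal i) A =>
        Submodule.span A {fun j => ψ.toAlgHom (SPoly.chartVar pluckerIdeal i j)})
      Set.univ
      {M | (∃ L, IsPoint 2 L ∧ wedgeSq L = M) ∧ ∃ Q ∈ M, Q (Sum.inl i) = 1} := by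
  have hone : ∀ ψ : SuperHom (SPoly.Chart pluckerIdeal i) A,
      ψ.toAlgHom (SPoly.chartVar pluckerIdeal i (.inl i)) = 1 := fun ψ => by
    rw [SPoly.chartVar_self, map_one]
  refine ⟨fun ψ _ => ⟨?_, _, Submodule.mem_span_singleton_self _, hone ψ⟩, fun ψ _ ψ' _ h => ?_,
    fun M hM => ?_⟩
  · have hP : IsPluckerVec (ψ.vec (SPoly.chartVar pluckerIdeal i))
        (ψ.vec_homog SPoly.chartVar_homog) :=
      isPluckerVec_of_vanishing fun f hf =>
        (SPoly.map_eval ψ SPoly.chartVar_homog f).symm.trans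
          (by rw [SPoly.eval_chartVar hf, map_zero])
    obtain ⟨L, hL, h⟩ := bijOn_wedgeSq.surjOn (isProjPoint_span hP (hone ψ))
    exact ⟨L, hL, h⟩
  · have hmem := Submodule.mem_span_singleton_self (R := A)
      (fun j => ψ.toAlgHom (SPoly.chartVar pluckerIdeal i j))
    simp only at h
    rw [h] at hmem
    obtain ⟨x, hx⟩ := Submodule.mem_span_singleton.1 hmem
    have hx1 : x = 1 := by
      have := congrFun hx (.inl i)
      rwa [Pi.smul_apply, hone ψ, hone ψ', smul_eq_mul, mul_one] at this
    rw [hx1, one_smul] at hx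
    exact (SPoly.chart_superHom_ext fun j => congrFun hx j).symm
  · obtain ⟨⟨L, hL, rfl⟩, hi⟩ := hM
    obtain ⟨Q, hQM, hQ, hQi, hspan⟩ := exists_generator hL.wedgeSq hi
    obtain ⟨ψ, hψ⟩ := SPoly.exists_chartHom (I := pluckerIdeal) hQ hQi
      ((isProjPoint_wedgeSq hL).2 Q hQM hQ)
    refine ⟨ψ, trivial, ?_⟩
    simp only [hψ]
    exact hspan

/-- A commutative algebra as a purely even superalgebra. -/
abbrev SuperAlgebra.ofCommRing (B : Type*) [CommRing B] [Algebra ℂ B] : SuperAlgebra B where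
  part i := if i = 0 then ⊤ else ⊥
  isCompl := by simpa using isCompl_top_bot
  one_mem := by simp
  mul_mem := by
    intro i j a b ha hb
    by_cases hi : i = 0
    · subst hi
      by_cases hj : j = 0
      · simp [hj]
      · rw [if_neg hj, Submodule.mem_bot] at hb
        simp [hb]
    · rw [if_neg hi, Submodule.mem_bot] at ha
      simp [ha]
  even_mul := fun _ _ => mul_comm _ _
  odd_mul_odd := by
    intro a b ha _
    rw [if_neg one_ne_zero, Submodule.mem_bot] at ha
    simp [ha]

theorem exists_polynomial_algHom {κ C : Type*} [Ring C] [Algebra ℂ C] [SuperAlgebra C] {f : κ → C}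
    (hf : ∀ k, f k ∈ part (A := C) 0) :
    ∃ ρ : MvPolynomial κ ℂ →ₐ[ℂ] C, ∀ k, ρ (MvPolynomial.X k) = f k :=
  ⟨(evenPart C).val.comp (MvPolynomial.aeval fun k => (⟨f k, hf k⟩ : evenPart C)), fun k =>
    congrArg Subtype.val (MvPolynomial.aeval_X (fun k => (⟨f k, hf k⟩ : evenPart C)) k)⟩

/-- A superalgebra which modulo its odd elements is a subalgebra of a reduced commutative algebra,
is reduced modulo its odd elements. -/
theorem isReduced_quotient_oddIdeal {C B : Type*} [Ring C] [Algebra ℂ C] [SuperAlgebra C]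
    [CommRing B] [IsReduced B] [Algebra ℂ B] {κ : C →ₐ[ℂ] B}
    (hκ : ∀ x ∈ part (A := C) 1, κ x = 0) (h : ∀ x, κ x = 0 → x ∈ oddIdeal C) :
    IsReduced (C ⧸ (oddIdeal C).asIdeal) := by
  have hκodd : ∀ x ∈ oddIdeal C, κ x = 0 := by
    have : oddIdeal C ≤ TwoSidedIdeal.ker κ := TwoSidedIdeal.span_le.2 fun x hx =>
      (TwoSidedIdeal.mem_ker _).2 (hκ x hx)
    exact fun x hx => (TwoSidedIdeal.mem_ker _).1 (this hx)
  refine ⟨fun x ⟨n, hn⟩ => ?_⟩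
  obtain ⟨x, rfl⟩ := Ideal.Quotient.mk_surjective x
  rw [← map_pow] at hn
  have h1 := hκodd _ (TwoSidedIdeal.mem_asIdeal.1 (Ideal.Quotient.eq_zero_iff_mem.1 hn))
  rw [map_pow] at h1
  exact Ideal.Quotient.eq_zero_iff_mem.2
    (TwoSidedIdeal.mem_asIdeal.2 (h x (IsReduced.eq_zero _ ⟨n, h1⟩)))

section Cell

variable (i j : Fin 4)

/-- The even part of the first row of a matrix in the big cell. -/
noncomputable def rowA (k : Fin 4) : MvPolynomial (Fin 4 × Fin 2) ℂ :=
  if k = i then 1 else if k = j then 0 else MvPolynomial.X (k, 0)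

/-- The even part of the second row of a matrix in the big cell. -/
noncomputable def rowB (k : Fin 4) : MvPolynomial (Fin 4 × Fin 2) ℂ :=
  if k = i then 0 else if k = j then 1 else MvPolynomial.X (k, 1)

variable {i j}

/-- Modulo odd elements `κ` has a left inverse `ρ`: it sends the rows of the cell to `q_kj` and
`q_ik`, whose minors are the `q_kl` by the Plücker relations with `q_ij = 1`. The coordinate `a_55 =
λ_i λ_j` lies in the odd ideal, as do the `λ_k`. So the kernel of `κ` does too. -/
theorem mem_oddIdeal_of_cell {C : Type*} [Ring C] [Algebra ℂ C] [SuperAlgebra C]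
    {v : EvenIdx ⊕ Fin 4 → C} {hv : IsHomog 0 v} (hP : IsPluckerVec v hv)
    (hS : skew v i j = 1) (hadj : Algebra.adjoin ℂ (Set.range v) = ⊤)
    {κ : C →ₐ[ℂ] MvPolynomial (Fin 4 × Fin 2) ℂ}
    (hq : ∀ k l h, κ (v (.inl (.q k l h))) = rowA i j k * rowB i j l - rowA i j l * rowB i j k)
    (ha : κ (v (.inl .a55)) = 0) (hl : ∀ k, κ (v (.inr k)) = 0) {x : C} (hx : κ x = 0) :
    x ∈ oddIdeal C := by
  have hodd : ∀ x ∈ oddIdeal C, Ideal.Quotient.mkₐ ℂ (oddIdeal C).asIdeal x = 0 := fun x hx =>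
    Ideal.Quotient.eq_zero_iff_mem.2 (TwoSidedIdeal.mem_asIdeal.2 hx)
  obtain ⟨ρ, hρ⟩ := exists_polynomial_algHom (C := C)
    (f := fun k : Fin 4 × Fin 2 => if k.2 = 0 then skew v k.1 j else skew v i k.1) fun k => by
      split_ifs <;> exact skew_mem hv _ _
  have hρ0 : ∀ k, ρ (MvPolynomial.X (k, 0)) = skew v k j := fun k => (hρ _).trans (if_pos rfl)
  have hρ1 : ∀ k, ρ (MvPolynomial.X (k, 1)) = skew v i k := fun k =>
    (hρ _).trans (if_neg one_ne_zero)
  have hρa : ∀ k, ρ (rowA i j k) = skew v k j := by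
    intro k
    rw [rowA]
    split_ifs with h h'
    · rw [h, hS, map_one]
    · rw [h', skew_self, map_zero]
    · exact hρ0 k
  have hρb : ∀ k, ρ (rowB i j k) = skew v i k := by
    intro k
    rw [rowB]
    split_ifs with h h'
    · rw [h, skew_self, map_zero]
    · rw [h', hS, map_one]
    · exact hρ1 k
  have hcomp : (Ideal.Quotient.mkₐ ℂ (oddIdeal C).asIdeal).comp (ρ.comp κ) =
      Ideal.Quotient.mkₐ ℂ (oddIdeal C).asIdeal := by
    refine AlgHom.ext_of_adjoin_eq_top hadj ?_
    rintro _ ⟨J, rfl⟩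
    rw [AlgHom.comp_apply, AlgHom.comp_apply]
    rcases J with (⟨k, l, hkl⟩ | _) | k
    · rw [hq, map_sub, map_mul, map_mul, hρa, hρa, hρb, hρb, ← skew_of_lt v hkl]
      congr 1
      have h := hP.skew_mul_skew i j k l
      rw [hS, one_mul] at h
      rw [← h, skew_swap v j k, skew_swap v j l, commute_of_even (skew_mem hv i k),
        commute_of_even (skew_mem hv i l)]
      simp only [neg_mul]
      abel
    · rw [ha, map_zero, map_zero]
      symm
      apply hodd
      have h := hP.lam_mul_lam i j
      rw [hS, mul_one] at h
      rw [← h]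
      exact TwoSidedIdeal.mul_mem_right _ _ _ (TwoSidedIdeal.subset_span (SPoly.inr_mem hv i))
    · rw [hl, map_zero, map_zero]
      symm
      exact hodd _ (TwoSidedIdeal.subset_span (SPoly.inr_mem hv k))
  have h := DFunLike.congr_fun hcomp x
  rw [AlgHom.comp_apply, AlgHom.comp_apply, hx, map_zero, map_zero] at h
  exact TwoSidedIdeal.mem_asIdeal.1 (Ideal.Quotient.eq_zero_iff_mem.1 h.symm)

end Cell

theorem isReduced_chart (i j : Fin 4) (hij : i < j) :
    IsReduced (SPoly.Chart pluckerIdeal (.q i j hij) ⧸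
      (oddIdeal (SPoly.Chart pluckerIdeal (.q i j hij))).asIdeal) := by
  let : SuperAlgebra (MvPolynomial (Fin 4 × Fin 2) ℂ) := SuperAlgebra.ofCommRing _
  have hrow : ∀ c : Fin 4 → MvPolynomial (Fin 4 × Fin 2) ℂ,
      IsHomog 0 (Sum.elim c 0 : Fin 4 ⊕ Fin 1 → MvPolynomial (Fin 4 × Fin 2) ℂ) := by
    rintro c (k | k)
    · exact Submodule.mem_top
    · exact Submodule.zero_mem _
  have ha := hrow (rowA i j)
  have hb := hrow (rowB i j)
  -- The morphism classifying the generic plane of the cell with vanishing odd coordinates.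
  obtain ⟨κ, hκ⟩ := SPoly.exists_chartHom (I := pluckerIdeal) (i := .q i j hij)
    (wedge_homog ha hb) (by simp [wedge, rowA, rowB, hij.ne']) (fun f hf =>
      (isPluckerVec_wedge ha hb).eval_eq_zero hf)
  refine isReduced_quotient_oddIdeal (κ := κ.toAlgHom)
    (fun x hx => (Submodule.mem_bot ℂ).1 (κ.map_part 1 x hx)) fun x =>
      mem_oddIdeal_of_cell (hv := SPoly.chartVar_homog) (isPluckerVec_of_vanishing fun f hf =>
        SPoly.eval_chartVar hf) ((skew_of_lt _ hij).trans SPoly.chartVar_self)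
        SPoly.adjoin_range_chartVar (fun k l h => hκ _) ?_ fun k => ?_
  · rw [hκ, wedge_a55 ha]
    simp
  · rw [hκ, wedge_lam ha]
    simp

theorem isAffine_chart (i : EvenIdx) : IsAffine (SPoly.Chart pluckerIdeal i) := by
  refine ⟨⟨Subalgebra.fg_def.2 ⟨_, Set.finite_range _, SPoly.adjoin_range_chartVar⟩⟩, ?_⟩
  rcases i with ⟨i, j, hij⟩ | _
  · exact isReduced_chart i j hij
  · have hP : IsPluckerVec (SPoly.chartVar pluckerIdeal .a55) SPoly.chartVar_homog :=
      isPluckerVec_of_vanishing fun f hf => SPoly.eval_chartVar hf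
    -- Where `a_55 = 1`, the relation `a_55² = 0` reads `1 = 0`: this chart is empty.
    have h := hP.a55_mul_a55
    rw [SPoly.chartVar_self, one_mul] at h
    have : Subsingleton (SPoly.Chart pluckerIdeal .a55) := subsingleton_of_zero_eq_one h.symm
    exact ⟨fun x _ => Subsingleton.elim _ _⟩

/-! ### The determinants -/

/-- The first column of the generic matrix. -/
noncomputable def matA : Fin 4 ⊕ Fin 1 → MatPoly :=
  Sum.elim (fun k => SPoly.x (k, 0)) fun _ => SPoly.θ 0

/-- The second column of the generic matrix. -/
noncomputable def matB : Fin 4 ⊕ Fin 1 → MatPoly :=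
  Sum.elim (fun k => SPoly.x (k, 1)) fun _ => SPoly.θ 1

theorem matA_homog : IsHomog 0 matA := by
  rintro (k | k)
  · exact SPoly.x_mem _
  · exact SPoly.θ_mem 0

theorem matB_homog : IsHomog 0 matB := by
  rintro (k | k)
  · exact SPoly.x_mem _
  · exact SPoly.θ_mem 1

theorem wedge_matA_matB : wedge matA matB = det := by
  funext j
  rcases j with (⟨i, j, h⟩ | _) | i
  · rw [wedge, commute_of_even (SPoly.inl_mem matA_homog j)]
    change _ = SPoly.x (i, 0) * SPoly.x (j, 1) - SPoly.x (i, 1) * SPoly.x (j, 0)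
    rfl
  · rw [wedge_a55 matA_homog, ← odd_mul_odd (SPoly.inr_mem matA_homog 0)
      (SPoly.inr_mem matB_homog 0)]
    rfl
  · rw [wedge_lam matA_homog, ← commute_of_even (SPoly.inl_mem matA_homog i)]
    rfl

theorem det_homog : IsHomog 0 det := wedge_matA_matB ▸ wedge_homog matA_homog matB_homog

theorem isPluckerVec_det : IsPluckerVec det det_homog := fun f hf => by
  rw [eval_congr wedge_matA_matB.symm _ (wedge_homog matA_homog matB_homog)]
  exact isPluckerVec_wedge matA_homog matB_homog f hf

/-- The homomorphism from `𝒪(Gr)` given by the determinants. -/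
noncomputable def toMat : GrRing →ₐ[ℂ] MatPoly :=
  Ideal.Quotient.liftₐ _ (SPoly.eval det det_homog) fun _ hf =>
    isPluckerVec_det.eval_eq_zero (TwoSidedIdeal.mem_asIdeal.1 hf)

theorem toMat_mk (f : PluckerPoly) : toMat (Ideal.Quotient.mk pluckerIdeal.asIdeal f) =
    SPoly.eval det det_homog f := rfl

theorem toMat_mk_var (j : EvenIdx ⊕ Fin 4) :
    toMat (Ideal.Quotient.mk pluckerIdeal.asIdeal (SPoly.var j)) = det j := by
  rw [toMat_mk]
  rcases j with j | j
  · exact SPoly.eval_x _ _ _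
  · exact SPoly.eval_θ _ _ _

theorem toMat_mem {i : ZMod 2} {a : GrRing} (ha : a ∈ part (A := GrRing) i) :
    toMat a ∈ part (A := MatPoly) i := by
  obtain ⟨f, hf, rfl⟩ := ha
  exact SPoly.eval_mem det_homog hf

/-- The matrix with columns `x_0 • cellA`, `cellB`. -/
noncomputable def cellMat : (Fin 4 × Fin 2) ⊕ Fin 2 → CellRing :=
  Sum.elim (fun k => if k.2 = 0 then SPoly.x 0 * cellA (.inl k.1) else cellB (.inl k.1))
    fun k => if k = 0 then SPoly.x 0 * SPoly.θ 0 else SPoly.θ 1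

theorem cellMat_homog : IsHomog 0 cellMat := by
  rintro (⟨k, l⟩ | l)
  · have : cellMat (.inl (k, l)) ∈ part (A := CellRing) 0 := by
      simp only [cellMat, Sum.elim_inl]
      split_ifs
      · exact even_smul_mem (SPoly.x_mem 0) (SPoly.inl_mem cellA_homog k)
      · exact SPoly.inl_mem cellB_homog k
    exact this
  · have : cellMat (.inr l) ∈ part (A := CellRing) 1 := by
      simp only [cellMat, Sum.elim_inr]
      split_ifs
      · exact even_smul_mem (SPoly.x_mem 0) (SPoly.θ_mem 0)
      · exact SPoly.θ_mem 1
    exact this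

theorem evalHom_cellMat_det : (SPoly.evalHom cellMat cellMat_homog).vec det = cellVec := by
  have hA : (SPoly.evalHom cellMat cellMat_homog).vec matA = (SPoly.x 0 : CellRing) • cellA := by
    funext j
    rcases j with j | j
    · exact SPoly.eval_x cellMat cellMat_homog _
    · exact SPoly.eval_θ cellMat cellMat_homog _
  have hB : (SPoly.evalHom cellMat cellMat_homog).vec matB = cellB := by
    funext j
    rcases j with j | j
    · exact SPoly.eval_x cellMat cellMat_homog _
    · exact SPoly.eval_θ cellMat cellMat_homog _
  rw [← wedge_matA_matB, SuperHom.vec_wedge _ matA_homog, hA, hB, wedge_smul_left]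
  rfl

/-- Specializing the generic matrix to `cellMat` turns the determinants into `cellVec`, so whatever
the determinants kill already vanishes on the big cell. -/
theorem toMat_injective : Function.Injective toMat := by
  rw [injective_iff_map_eq_zero]
  intro g hg
  obtain ⟨f, rfl⟩ := Ideal.Quotient.mk_surjective g
  rw [toMat_mk] at hg
  refine Ideal.Quotient.eq_zero_iff_mem.2
    (TwoSidedIdeal.mem_asIdeal.2 (mem_pluckerIdeal_of_eval_cellVec ?_))
  rw [← eval_congr evalHom_cellMat_det (SuperHom.vec_homog _ det_homog) cellVec_homog,
    ← SPoly.map_eval _ det_homog, hg, map_zero]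

theorem range_toMat : toMat.range = Algebra.adjoin ℂ (Set.range det) := by
  rw [← Algebra.map_top, ← adjoin_range_grVar, AlgHom.map_adjoin, ← Set.range_comp]
  congr 2
  funext j
  exact toMat_mk_var j

theorem exists_grRing_equiv : ∃ e : GrRing ≃ₐ[ℂ] Algebra.adjoin ℂ (Set.range det),
    (∀ j, (e (Ideal.Quotient.mk _ (SPoly.var j)) : MatPoly) = det j) ∧
      ∀ (i : ZMod 2) (a : GrRing),
        a ∈ SuperAlgebra.part i ↔ (e a : MatPoly) ∈ SuperAlgebra.part i := by
  refine ⟨(AlgEquiv.ofInjective toMat toMat_injective).trans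
    (Subalgebra.equivOfEq _ _ range_toMat), toMat_mk_var, fun i a => ⟨toMat_mem, fun h => ?_⟩⟩
  change toMat a ∈ _ at h
  obtain ⟨a₀, h₀, a₁, h₁, rfl⟩ := exists_add_part i a
  -- The component of the wrong parity has an image of both parities, hence zero.
  have : toMat a₁ = 0 := by
    refine eq_zero_of_mem_part ?_ (toMat_mem h₁)
    rw [map_add] at h
    exact (Submodule.add_mem_iff_right _ (toMat_mem h₀)).1 h
  rw [(injective_iff_map_eq_zero _).1 toMat_injective _ this, add_zero]
  exact h₀

/-! ### All relations -/

section Lift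

universe v w

variable (A : Type w) [Ring A] [Algebra ℂ A] [SuperAlgebra A]

/-- This lets `CellRing`, which lives in the lowest universe, serve as a test algebra in any
universe. -/
noncomputable instance : SuperAlgebra (ULift.{v} A) where
  part i := (part (A := A) i).comap (ULift.algEquiv (R := ℂ) (A := A)).toLinearMap
  isCompl := by
    refine ⟨Submodule.disjoint_def.2 fun a h₀ h₁ => ?_, codisjoint_iff.2 (eq_top_iff.2 ?_)⟩
    · exact ULift.down_injective (eq_zero_of_mem_part (i := 0) h₀ h₁)
    · rintro ⟨a⟩ -
      obtain ⟨a₀, h₀, a₁, h₁, rfl⟩ := exists_add a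
      have h₀' : ULift.up a₀ ∈ (part (A := A) 0).comap
          (ULift.algEquiv : ULift.{v} A ≃ₐ[ℂ] A).toLinearMap := h₀
      have h₁' : ULift.up a₁ ∈ (part (A := A) 1).comap
          (ULift.algEquiv : ULift.{v} A ≃ₐ[ℂ] A).toLinearMap := h₁
      exact Submodule.add_mem_sup h₀' h₁'
  one_mem := one_mem (A := A)
  mul_mem := fun ha hb => mul_mem (A := A) ha hb
  even_mul := fun ha hb => ULift.down_injective (even_mul (A := A) ha hb)
  odd_mul_odd := fun ha hb => ULift.down_injective (odd_mul_odd (A := A) ha hb)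

/-- The isomorphism with a copy in a higher universe. -/
noncomputable def SuperHom.up : SuperHom A (ULift.{v} A) :=
  { (ULift.algEquiv (R := ℂ) (A := A)).symm.toAlgHom with map_part := fun _ _ h => h }

theorem SuperHom.up_injective : Function.Injective (SuperHom.up.{v} A).toAlgHom :=
  ULift.up_injective

end Lift

/-- A single plane tests all relations: the universal plane of the big cell. Its `∧²` contains the
multiple of `wedge cellA cellB` by the free scalar `x 0`, so vanishing there means vanishing at
`cellVec`. -/
theorem mem_pluckerIdeal_iff.{v} (f : PluckerPoly) : f ∈ pluckerIdeal ↔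
    ∀ (A : Type v) [Ring A] [Algebra ℂ A] [SuperAlgebra A]
      (L : Submodule A (Fin 4 ⊕ Fin 1 → A)), IsPoint 2 L →
      ∀ Q ∈ wedgeSq L, ∀ hQ : IsHomog 0 Q, SPoly.eval Q hQ f = 0 := by
  refine ⟨fun hf A _ _ _ L hL Q hQL hQ => (isProjPoint_wedgeSq hL).2 Q hQL hQ f hf, fun h => ?_⟩
  apply mem_pluckerIdeal_of_eval_cellVec
  let φ := SuperHom.up.{v} CellRing
  apply SuperHom.up_injective.{v} CellRing
  change φ.toAlgHom _ = φ.toAlgHom 0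
  rw [map_zero, SPoly.map_eval]
  have hp : IsPoint 2 (Submodule.span (ULift.{v} CellRing)
      (Set.range ![φ.vec cellA, φ.vec cellB])) := by
    refine isPoint_span_of_dual (c := ![Pi.single (.inl 0) 1, Pi.single (.inl 1) 1])
      (fun k => ?_) (fun k l => ?_)
    · fin_cases k
      · exact φ.vec_homog cellA_homog
      · exact φ.vec_homog cellB_homog
    · have e1 : φ.vec cellA (.inl 0) = 1 := map_one φ.toAlgHom
      have e2 : φ.vec cellA (.inl 1) = 0 := map_zero φ.toAlgHom
      have e3 : φ.vec cellB (.inl 0) = 0 := map_zero φ.toAlgHom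
      have e4 : φ.vec cellB (.inl 1) = 1 := map_one φ.toAlgHom
      fin_cases k <;> fin_cases l <;> simp [pairing_single, e1, e2, e3, e4]
  refine h _ _ hp _ ?_ _
  rw [cellVec, φ.vec_smul, φ.vec_wedge cellA_homog]
  exact Submodule.smul_mem _ _
    (wedge_mem (Submodule.subset_span ⟨0, rfl⟩) (Submodule.subset_span ⟨1, rfl⟩))

end SuperGr

theorem mainTheorem6 :
    -- The functors of points of `Gr` and of `ℙ(∧² ℂ^{4|1})`, and naturality of `L ↦ ∧² L`.
    (∀ (A B : Type u) [Ring A] [Algebra ℂ A] [SuperAlgebra A] [Ring B] [Algebra ℂ B]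
        [SuperAlgebra B] (φ : SuperHom A B),
      (∀ L : Submodule A (Fin 4 ⊕ Fin 1 → A), IsPoint 2 L →
        IsPoint 2 (baseChange φ L) ∧ wedgeSq (baseChange φ L) = baseChange φ (wedgeSq L)) ∧
      (∀ M : Submodule A (EvenIdx ⊕ Fin 4 → A), IsPoint 1 M → IsPoint 1 (baseChange φ M))) ∧
    -- `L ↦ ∧² L` identifies `Gr` with the closed subfunctor of `ℙ(∧² ℂ^{4|1})` defined by `I_P`.
    (∀ (A : Type u) [Ring A] [Algebra ℂ A] [SuperAlgebra A],
      Set.BijOn (wedgeSq (A := A)) {L | IsPoint 2 L} {M | IsProjPoint pluckerIdeal M}) ∧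
    -- `I_P` contains all the relations satisfied by the Plücker coordinates.
    (∀ f : PluckerPoly, f ∈ pluckerIdeal ↔
      ∀ (A : Type u) [Ring A] [Algebra ℂ A] [SuperAlgebra A]
        (L : Submodule A (Fin 4 ⊕ Fin 1 → A)), IsPoint 2 L →
        ∀ Q ∈ wedgeSq L, ∀ hQ : IsHomog 0 Q, SPoly.eval Q hQ f = 0) ∧
    -- `Gr` is covered by affine supervarieties, with coordinate superalgebras the projective
    -- localizations of `𝒪(Gr)`.
    (∀ i : EvenIdx, IsAffine (SPoly.Chart pluckerIdeal i)) ∧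
    (∀ (i : EvenIdx) (A : Type u) [Ring A] [Algebra ℂ A] [SuperAlgebra A],
      Set.BijOn
        (fun ψ : SuperHom (SPoly.Chart pluckerIdeal i) A =>
          Submodule.span A {fun j => ψ.toAlgHom (SPoly.chartVar pluckerIdeal i j)})
        Set.univ
        {M | (∃ L, IsPoint 2 L ∧ wedgeSq L = M) ∧ ∃ Q ∈ M, Q (Sum.inl i) = 1}) ∧
    (∀ (A : Type u) [Ring A] [Algebra ℂ A] [SuperAlgebra A]
        (L : Submodule A (Fin 4 ⊕ Fin 1 → A)), IsPoint 2 L →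
      Ideal.span {a : A | ∃ i : EvenIdx, ∃ Q ∈ wedgeSq L, Q (Sum.inl i) = a} = ⊤) ∧
    -- `𝒪(Gr)` is isomorphic to the superring generated by the determinants.
    (∃ e : GrRing ≃ₐ[ℂ] Algebra.adjoin ℂ (Set.range det),
      (∀ j, (e (Ideal.Quotient.mk _ (SPoly.var j)) : MatPoly) = det j) ∧
      ∀ (i : ZMod 2) (a : GrRing),
        a ∈ SuperAlgebra.part i ↔ (e a : MatPoly) ∈ SuperAlgebra.part i) := by
  exact ⟨fun A B _ _ _ _ _ _ φ => ⟨fun L hL => ⟨hL.baseChange φ, wedgeSq_baseChange φ hL⟩,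
    fun M hM => hM.baseChange φ⟩, fun A _ _ _ => bijOn_wedgeSq, mem_pluckerIdeal_iff,
    isAffine_chart, fun i A _ _ _ => bijOn_chart i A,
    fun A _ _ _ L hL => span_even_coordinates_eq_top hL, exists_grRing_equiv⟩
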